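/- An election consists of a finite set $\mathcal C$ of $m\ge 1$ candidates, a finite set $\mathcal V$ of $n\ge 1$ voters, a profile $(\succ_i)_{i\in\mathcal V}$ of linear orders over $\mathcal C$, and a tie-breaking linear order $\succ_t$ over $\mathcal C$. The (simplified) Bucklin score of a candidate $c$ is the least $l$ such that at least half of the voters rank $c$ among their top $l$ positions; the Bucklin voting rule $r$ selects, among the candidates with lowest Bucklin score, the one ranked highest by $\succ_t$. Let $x=r((\succ_i)_{i\in\mathcal V})$ be the current winner. A set $M\subseteq\mathcal V$ is a coalition of possible manipulators against a candidate $y\ne x$ if there are linear orders $(\succ'_j)_{j\in M}$ over $\mathcal C$ with $x\succ'_j y$ for all $j\in M$ and $r\big((\succ_j)_{j\in\mathcal V\setminus M},(\succ'_j)_{j\in M}\big)=y$; it is a coalition of possible manipulators if it is one against some $y \neq x$. Consider the following decision problems for the Bucklin voting rule, whose input always contains an election: - CPMW: given also $M\subseteq\mathcal V$ and $y\in\mathcal C$, is $M$ a coalition of possible manipulators against $y$? - CPM: given also $M\subseteq\mathcal V$, is $M$ a coalition of possible manipulators? - CPMSW: given also $y\in\mathcal C$ and $k\in\mathbb N$,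 is there a coalition $M\subseteq\mathcal V$ with $|M|\le k$ of possible manipulators against $y$? - CPMS: given also $k\in\mathbb N$, is there a coalition $M\subseteq\mathcal V$ with $|M|\le k$ of possible manipulators? **Theorem.** CPMW and CPM for the Bucklin voting rule are in $\mathsf P$ (with no restriction on $|M|$). For every constant $K$, CPMSW and CPMS for the Bucklin voting rule, restricted to instances with $k\le K$, are in $\mathsf P$. -/

import Mathlib

namespace PossibleManipulators

/-! ### Preferences, voting rules and the Bucklin rule -/

/-- A preference (linear order) over the candidates `Fin m`, written as its ranking from best to
worst: `p j` is the candidate at position `j` (positions are counted from `0`), so `p.symm c` is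
the position of the candidate `c`. -/
abbrev Preference (m : ℕ) : Type := Equiv.Perm (Fin m)

/-- `p.Prefers a b`: the preference `p` ranks `a` strictly above `b`. -/
def Preference.Prefers {m : ℕ} (p : Preference m) (a b : Fin m) : Prop :=
  p.symm a < p.symm b

/-- A preference profile of the voters `Fin n`. -/
abbrev Profile (m n : ℕ) : Type := Fin n → Preference m

/-- A voting rule with lexicographic tie breaking: for every number `m ≥ 1` of candidates, every
number `n` of voters and every tie-breaking preference, it selects one winner of each profile. -/
abbrev VotingRule : Type :=
  ∀ (m n : ℕ) [NeZero m], Preference m → Profile m n → Fin m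

/-- The lexicographic tie-breaking rule of the preference `t`: it selects the candidate of `S`
that `t` ranks highest. -/
def lexTieBreak {m : ℕ} (t : Preference m) (S : Finset (Fin m)) (hS : S.Nonempty) : Fin m :=
  t ((S.image t.symm).min' (hS.image t.symm))

/-- The number of voters that rank `c` in their top `l` positions. -/
def topCount {m n : ℕ} (V : Profile m n) (c : Fin m) (l : ℕ) : ℕ :=
  (Finset.univ.filter fun i : Fin n => ((V i).symm c : ℕ) < l).card

/-- The (simplified) Bucklin score: the least `l` such that at least half of the voters rank `c`
in their top `l` positions. -/
noncomputable def bucklinScore {m n : ℕ} (V : Profile m n) (c : Fin m) : ℕ :=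
  sInf {l : ℕ | n ≤ 2 * topCount V c l}

/-- The Bucklin voting correspondence: the candidates with lowest Bucklin score. -/
noncomputable def bucklinWinners {m n : ℕ} (V : Profile m n) : Finset (Fin m) :=
  Finset.univ.filter fun c => ∀ d, bucklinScore V c ≤ bucklinScore V d

theorem bucklinWinners_nonempty {m n : ℕ} [NeZero m] (V : Profile m n) :
    (bucklinWinners V).Nonempty := by
  obtain ⟨c, -, hc⟩ := Finset.exists_min_image Finset.univ (bucklinScore V) ⟨0, Finset.mem_univ _⟩
  exact ⟨c, by simpa [bucklinWinners] using hc⟩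

/-- The Bucklin voting rule. -/
noncomputable def bucklin : VotingRule :=
  fun _ _ _ t V => lexTieBreak t (bucklinWinners V) (bucklinWinners_nonempty V)

/-! ### Coalitions of possible manipulators -/

/-- `M` is a coalition of possible manipulators against `y` in the profile `V`, for the voting rule
`r` on `m` candidates and `n` voters: `y` differs from the current winner `r V`, and the members of
`M` can replace their votes by preferences that all rank the current winner above `y`, so that `y`
wins. (`M.piecewise W V` takes the votes of `M` from `W` and all others from `V`.) -/
def IsPossibleCoalitionAgainst {m n : ℕ} (r : Profile m n → Fin m) (V : Profile m n)
    (M : Finset (Fin n)) (y : Fin m) : Prop :=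
  y ≠ r V ∧ ∃ W : Profile m n, (∀ j ∈ M, (W j).Prefers (r V) y) ∧ r (M.piecewise W V) = y

/-- `M` is a coalition of possible manipulators. -/
def IsPossibleCoalition {m n : ℕ} (r : Profile m n → Fin m) (V : Profile m n)
    (M : Finset (Fin n)) : Prop :=
  ∃ y, IsPossibleCoalitionAgainst r V M y

/-! ### Elections and their encoding as strings -/

/-- An election: at least one candidate, at least one voter, the tie-breaking preference and the
reported votes. -/
structure Election where
  /-- number of candidates -/
  numCand : ℕ
  /-- number of voters -/
  numVoters : ℕ
  candNe : NeZero numCand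
  votersNe : NeZero numVoters
  /-- the tie-breaking preference -/
  tie : Preference numCand
  /-- the reported votes -/
  votes : Profile numCand numVoters

attribute [instance] Election.candNe Election.votersNe

/-- The voting rule `r` on the candidates and voters of the election `E`. -/
def Election.rule (r : VotingRule) (E : Election) :
    Profile E.numCand E.numVoters → Fin E.numCand :=
  r E.numCand E.numVoters E.tie

open Computability

/-- A candidate is written as its index in unary, followed by a comma. A single vote lists all `m`
candidates, so compared with binary indices the length changes only polynomially. -/
def encodeCandidate {m : ℕ} (c : Fin m) : List Γ' :=
  List.replicate (c : ℕ) (Γ'.bit true) ++ [Γ'.comma]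

/-- A preference is written as the bracketed list of the candidates from best to worst. -/
def encodePreference {m : ℕ} (p : Preference m) : List Γ' :=
  Γ'.bra :: ((List.ofFn fun j => encodeCandidate (p j)).flatten ++ [Γ'.ket])

/-- An election is written as the tie-breaking preference followed by all the votes. -/
def encodeElection (E : Election) : List Γ' :=
  encodePreference E.tie ++ (List.ofFn fun i => encodePreference (E.votes i)).flatten

/-- A set of voters is written as the bit string of its indicator function. -/
def encodeCoalition {n : ℕ} (M : Finset (Fin n)) : List Γ' :=
  List.ofFn fun i => Γ'.bit (decide (i ∈ M))

/-- A natural number is written in binary. -/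
def encodeNumber (k : ℕ) : List Γ' :=
  (encodeNat k).map Γ'.bit

/-! ### The four decision problems, as languages of encoded yes-instances -/

/-- CPMW: given an election, a set `M` of voters and a candidate `y`, is `M` a coalition of
possible manipulators against `y`? -/
def CPMW (r : VotingRule) : Language Γ' :=
  {w | ∃ (E : Election) (M : Finset (Fin E.numVoters)) (y : Fin E.numCand),
    w = encodeElection E ++ encodeCoalition M ++ [Γ'.comma] ++ encodeCandidate y ∧
    IsPossibleCoalitionAgainst (E.rule r) E.votes M y}

/-- CPM: given an election and a set `M` of voters, is `M` a coalition of possible manipulators? -/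
def CPM (r : VotingRule) : Language Γ' :=
  {w | ∃ (E : Election) (M : Finset (Fin E.numVoters)),
    w = encodeElection E ++ encodeCoalition M ∧
    IsPossibleCoalition (E.rule r) E.votes M}

/-- CPMSW restricted to instances whose maximum coalition size `k` is at most the constant `K`:
given an election, a candidate `y` and a number `k`, is there a coalition of at most `k` possible
manipulators against `y`? -/
def CPMSW (r : VotingRule) (K : ℕ) : Language Γ' :=
  {w | ∃ (E : Election) (y : Fin E.numCand) (k : ℕ), k ≤ K ∧
    w = encodeElection E ++ encodeCandidate y ++ encodeNumber k ∧
    ∃ M : Finset (Fin E.numVoters), M.card ≤ k ∧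
      IsPossibleCoalitionAgainst (E.rule r) E.votes M y}

/-- CPMS restricted to instances whose maximum coalition size `k` is at most the constant `K`:
given an election and a number `k`, is there a coalition of at most `k` possible manipulators? -/
def CPMS (r : VotingRule) (K : ℕ) : Language Γ' :=
  {w | ∃ (E : Election) (k : ℕ), k ≤ K ∧
    w = encodeElection E ++ encodeNumber k ∧
    ∃ M : Finset (Fin E.numVoters), M.card ≤ k ∧
      IsPossibleCoalition (E.rule r) E.votes M}

open Classical in
/-- The complexity class `P`: some multi-stack Turing machine decides membership in the language,
on every input string, within a number of steps polynomial in the length of the string. -/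
def InP {Γ : Type} (L : Language Γ) : Prop :=
  Nonempty (Turing.TM2ComputableInPolyTime (fun w : List Γ => w) encodeBool
    (fun w => decide (w ∈ L)))

end PossibleManipulators

/-! Suppose `y` wins after a manipulation, with Bucklin score `l + 1`. Then at least half of the
voters have `y` among their top `l + 1`, while every rival stays below half within its own segment:
the top `l` for a weak rival, which loses a tie against `y`, and the top `l + 1` for a strong one.
Let `τ` manipulators place `y` in their top `l + 1`. Each of them ranks `x` higher, hence in its top
`l`, and has `l - 1` places left; each other manipulator has `l + 1` places, none of them taken by
`y`. Filling these places uses up the support, at most `(n - 1) / 2`, that a rival may have in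
total. The only place that can be filled for free is the last one of a segment, when a weak rival
stands there.

Fix the total numbers `U` and `U'` of weak rivals in the segments of the two groups of manipulators,
not counting `x` for those who rank `y` high. Since each voter has one free place, the weak rivals
must absorb at least `U` and `U'` minus the sizes of the groups, and the strong rivals all remaining
places. What is left is to split two demands among candidates that have a common capacity and a
separate bound for each demand; three inequalities between sums decide whether this is possible
(`Suffices.exists`). Conversely, numbers of this kind always come from votes: candidates are dealt
to voters so evenly that all segments get the required size (`exists_balanced`, `exists_deal`).
Hence a manipulation exists if and only if one of polynomially many quadruples `(l, τ, U, U')`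
satisfies an arithmetic condition (`exists_manipulation_iff`).

For the complexity claim, the conditions are written as expressions built from the word by addition,
truncated subtraction, symbol tests and bounded sums. A fixed expression has polynomially bounded
values, so it can be evaluated in unary on the stacks of a Turing machine in polynomial time
(`Expr.runs_compile`, `Expr.polyBounded_cost`, `Expr.inP`). Bounded quantifiers, counting and string
comparison are all expressible. Malformed inputs need no parser: the entries are read off by
counting symbols, the encoding is rebuilt from them, and the result is compared with the input.

CPM adds a quantifier over `y`. For CPMSW and CPMS a coalition of size at most `k` is guessed by `k`
nested quantifiers over voters; their number is fixed because `k ≤ K`. -/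

namespace PossibleManipulators

open Computability Turing

/-! ### A small programming language on stacks -/

/-- Programs acting on stacks indexed by `ℕ`. -/
inductive Prog : Type
  | skip : Prog
  | push (k : ℕ) (a : Γ') : Prog
  | drop (k : ℕ) : Prog
  | move (j k : ℕ) : Prog
  | seq (p q : Prog) : Prog
  | ifHead (k : ℕ) (a : Γ') (p q : Prog) : Prog
  | loop (k : ℕ) (p : Prog) : Prog

namespace Prog

/-- The contents of all stacks. -/
abbrev Store : Type := ℕ → List Γ'

/-- The store whose only nonempty stack is `l`, at index `r`. -/
def single (r : ℕ) (l : List Γ') : Store := Function.update (fun _ => []) r l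

theorem single_self (r : ℕ) (l : List Γ') : single r l r = l := by simp [single]

theorem single_of_ne {k r : ℕ} (h : k ≠ r) (l : List Γ') : single r l k = [] := by
  simp [single, h]

theorem single_nil (r : ℕ) : single r [] = fun _ => [] := by
  funext k; by_cases h : k = r <;> simp [single]

/-- Big-step semantics: `Run p S S' t` says that `p` turns `S` into `S'` in `t` steps. -/
inductive Run : Prog → Store → Store → ℕ → Prop
  | skip (S : Store) : Run skip S S 1
  | push (k : ℕ) (a : Γ') (S : Store) : Run (push k a) S (Function.update S k (a :: S k)) 1
  | drop (k : ℕ) (S : Store) : Run (drop k) S (Function.update S k (S k).tail) 1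
  | move_nil (j k : ℕ) (S : Store) (h : S j = []) : Run (move j k) S S 1
  | move_cons (j k : ℕ) (S : Store) (a : Γ') (l : List Γ') (h : S j = a :: l) :
      Run (move j k) S (Function.update (Function.update S j l) k
        (a :: Function.update S j l k)) 1
  | seq {p q : Prog} {S S' S'' : Store} {t t' : ℕ} (h : Run p S S' t) (h' : Run q S' S'' t') :
      Run (seq p q) S S'' (t + t')
  | if_pos {k : ℕ} {a : Γ'} {p q : Prog} {S S' : Store} {t : ℕ} (hk : (S k).head? = some a)
      (h : Run p S S' t) : Run (ifHead k a p q) S S' (t + 1)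
  | if_neg {k : ℕ} {a : Γ'} {p q : Prog} {S S' : Store} {t : ℕ} (hk : (S k).head? ≠ some a)
      (h : Run q S S' t) : Run (ifHead k a p q) S S' (t + 1)
  | loop_nil {k : ℕ} {p : Prog} {S : Store} (hk : S k = []) : Run (loop k p) S S 1
  | loop_cons {k : ℕ} {p : Prog} {S S' S'' : Store} {t t' : ℕ} (hk : S k ≠ [])
      (h : Run p S S' t) (h' : Run (loop k p) S' S'' t') : Run (loop k p) S S'' (t + t' + 1)

/-- All stacks occurring in the program have an index below `N`. -/
@[reducible]
def Bounded (N : ℕ) : Prog → Prop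
  | skip => True
  | push k _ => k < N
  | drop k => k < N
  | move j k => j < N ∧ k < N
  | seq p q => p.Bounded N ∧ q.Bounded N
  | ifHead k _ p q => k < N ∧ p.Bounded N ∧ q.Bounded N
  | loop k p => k < N ∧ p.Bounded N

theorem Bounded.mono {N N' : ℕ} (h : N ≤ N') : ∀ {p : Prog}, p.Bounded N → p.Bounded N'
  | skip, _ => trivial
  | push _ _, hp => lt_of_lt_of_le hp h
  | drop _, hp => lt_of_lt_of_le hp h
  | move _ _, hp => ⟨lt_of_lt_of_le hp.1 h, lt_of_lt_of_le hp.2 h⟩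
  | seq _ _, hp => ⟨Bounded.mono h hp.1, Bounded.mono h hp.2⟩
  | ifHead _ _ _ _, hp => ⟨lt_of_lt_of_le hp.1 h, Bounded.mono h hp.2.1, Bounded.mono h hp.2.2⟩
  | loop _ _, hp => ⟨lt_of_lt_of_le hp.1 h, Bounded.mono h hp.2⟩

theorem exists_bounded : ∀ p : Prog, ∃ N, p.Bounded N
  | skip => ⟨0, trivial⟩
  | push k _ => ⟨k + 1, Nat.lt_succ_self k⟩
  | drop k => ⟨k + 1, Nat.lt_succ_self k⟩
  | move j k => ⟨max j k + 1, Nat.lt_succ_of_le (le_max_left j k),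
      Nat.lt_succ_of_le (le_max_right j k)⟩
  | seq p q => by
    obtain ⟨N, hN⟩ := exists_bounded p
    obtain ⟨N', hN'⟩ := exists_bounded q
    exact ⟨max N N', hN.mono (le_max_left _ _), hN'.mono (le_max_right _ _)⟩
  | ifHead k _ p q => by
    obtain ⟨N, hN⟩ := exists_bounded p
    obtain ⟨N', hN'⟩ := exists_bounded q
    exact ⟨max (k + 1) (max N N'), lt_of_lt_of_le (Nat.lt_succ_self k) (le_max_left _ _),
      hN.mono (by simp), hN'.mono (by simp)⟩
  | loop k p => by
    obtain ⟨N, hN⟩ := exists_bounded p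
    exact ⟨max (k + 1) N, lt_of_lt_of_le (Nat.lt_succ_self k) (le_max_left _ _),
      hN.mono (le_max_right _ _)⟩

/-! ### Compilation to multi-stack Turing machines -/

/-- The stack alphabets: an output stack over `Bool` and `N` work stacks over `Γ'`. -/
@[reducible]
def Alphabet (N : ℕ) : Option (Fin N) → Type
  | none => Bool
  | some _ => Γ'

/-- The machine stacks holding an output and the contents of a store. -/
def toStacks (N : ℕ) (o : List Bool) (S : Store) : ∀ k : Option (Fin N), List (Alphabet N k)
  | none => o
  | some i => S i

theorem toStacks_update {N : ℕ} (o : List Bool) (S : Store) (k : Fin N) (l : List Γ') :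
    Function.update (toStacks N o S) (some k) l = toStacks N o (Function.update S k l) := by
  funext i
  rcases i with _ | i
  · rw [Function.update_of_ne (by simp)]; rfl
  · by_cases h : i = k
    · subst h; simp [toStacks]
    · rw [Function.update_of_ne (by simpa using h)]
      simp [toStacks, Function.update_of_ne (fun h' => h (Fin.ext h'))]

/-- The labels of a compiled program. -/
@[reducible]
def Label : Prog → Type
  | skip => Unit
  | push _ _ => Unit
  | drop _ => Unit
  | move _ _ => Unit
  | seq p q => Label p ⊕ Label q
  | ifHead _ _ p q => Option (Label p ⊕ Label q)
  | loop _ p => Option (Label p)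

/-- Compiled programs have finitely many labels. -/
@[reducible]
def labelFintype : ∀ p : Prog, Fintype (Label p)
  | skip => inferInstanceAs (Fintype Unit)
  | push _ _ => inferInstanceAs (Fintype Unit)
  | drop _ => inferInstanceAs (Fintype Unit)
  | move _ _ => inferInstanceAs (Fintype Unit)
  | seq p q =>
    haveI := labelFintype p; haveI := labelFintype q
    inferInstanceAs (Fintype (Label p ⊕ Label q))
  | ifHead _ _ p q =>
    haveI := labelFintype p; haveI := labelFintype q
    inferInstanceAs (Fintype (Option (Label p ⊕ Label q)))
  | loop _ p =>
    haveI := labelFintype p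
    inferInstanceAs (Fintype (Option (Label p)))

/-- The entry point of a compiled program. -/
def entry : ∀ p : Prog, Label p
  | skip => ()
  | push _ _ => ()
  | drop _ => ()
  | move _ _ => ()
  | seq p _ => Sum.inl (entry p)
  | ifHead _ _ _ _ => none
  | loop _ _ => none

/-- The code of a program, whose labels are embedded into `Λ` by `emb`, and which continues at the
label `exit`. -/
def code {N : ℕ} {Λ : Type} : ∀ p : Prog, p.Bounded N → (Label p → Λ) → Λ →
    Label p → TM2.Stmt (Alphabet N) Λ (Option Γ')
  | skip, _, _, exit, _ => .goto fun _ => exit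
  | push k a, hk, _, exit, _ => .push (some ⟨k, hk⟩) (fun _ => a) (.goto fun _ => exit)
  | drop k, hk, _, exit, _ => .pop (some ⟨k, hk⟩) (fun v _ => v) (.goto fun _ => exit)
  | move j k, hk, _, exit, _ => .pop (some ⟨j, hk.1⟩) (fun _ a => a)
      (.branch Option.isSome (.push (some ⟨k, hk.2⟩) (fun v => (v.getD Γ'.blank : Γ'))
        (.goto fun _ => exit)) (.goto fun _ => exit))
  | seq p q, h, emb, exit, l => Sum.elim
      (code p h.1 (fun l => emb (Sum.inl l)) (emb (Sum.inr (entry q))))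
      (code q h.2 (fun l => emb (Sum.inr l)) exit) l
  | ifHead k a p q, h, emb, exit, l => Option.elim l
      (.peek (some ⟨k, h.1⟩) (fun _ b => b) (.goto fun v =>
        if v = some a then emb (some (Sum.inl (entry p))) else emb (some (Sum.inr (entry q)))))
      (Sum.elim (code p h.2.1 (fun l => emb (some (Sum.inl l))) exit)
        (code q h.2.2 (fun l => emb (some (Sum.inr l))) exit))
  | loop k p, h, emb, exit, l => Option.elim l
      (.peek (some ⟨k, h.1⟩) (fun _ b => b) (.goto fun v =>
        if v.isSome then emb (some (entry p)) else exit))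
      (code p h.2 (fun l => emb (some l)) (emb none))

theorem iterate_step {N : ℕ} {Λ : Type} {m : Λ → TM2.Stmt (Alphabet N) Λ (Option Γ')}
    {l : Λ} {s : TM2.Stmt (Alphabet N) Λ (Option Γ')} (h : m l = s) (t : ℕ) (v : Option Γ')
    (S : ∀ k : Option (Fin N), List (Alphabet N k)) :
    (flip bind (TM2.step m))^[t + 1] (some ⟨some l, v, S⟩) =
      (flip bind (TM2.step m))^[t] (some (TM2.stepAux s v S)) := by
  subst h; rfl

/-- A machine containing the code of `p` simulates `p`. -/
theorem Run.simulate {N : ℕ} {Λ : Type} (m : Λ → TM2.Stmt (Alphabet N) Λ (Option Γ'))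
    (o : List Bool) {p : Prog} {S S' : Store} {t : ℕ} (hr : Run p S S' t) :
    ∀ (hp : p.Bounded N) (emb : Label p → Λ) (exit : Λ), (∀ l, m (emb l) = code p hp emb exit l) →
    ∀ v : Option Γ', ∃ v', (flip bind (TM2.step m))^[t]
      (some ⟨some (emb (entry p)), v, toStacks N o S⟩) = some ⟨some exit, v', toStacks N o S'⟩ := by
  induction hr with
  | skip S =>
    intro hp emb exit hm v
    exact ⟨v, iterate_step (hm ()) 0 v _⟩
  | push k a S =>
    intro hp emb exit hm v
    exact ⟨v, (iterate_step (hm ()) 0 v _).trans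
      (congrArg (fun T => some (TM2.Cfg.mk (some exit) v T)) (toStacks_update o S ⟨k, hp⟩ _))⟩
  | drop k S =>
    intro hp emb exit hm v
    exact ⟨v, (iterate_step (hm ()) 0 v _).trans
      (congrArg (fun T => some (TM2.Cfg.mk (some exit) v T)) (toStacks_update o S ⟨k, hp⟩ _))⟩
  | move_nil j k S h =>
    intro hp emb exit hm v
    refine ⟨none, (iterate_step (hm ()) 0 v _).trans ?_⟩
    have hS : toStacks N o S (some ⟨j, hp.1⟩) = ([] : List Γ') := h
    simp only [code, TM2.stepAux, Function.iterate_zero, id]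
    rw [hS]
    simp only [List.head?_nil, Option.isSome_none, cond_false, List.tail_nil]
    rw [← hS, Function.update_eq_self]
  | move_cons j k S a l h =>
    intro hp emb exit hm v
    refine ⟨some a, (iterate_step (hm ()) 0 v _).trans ?_⟩
    have hS : toStacks N o S (some ⟨j, hp.1⟩) = (a :: l : List Γ') := h
    simp only [code, TM2.stepAux, Function.iterate_zero, id]
    rw [hS]
    simp only [List.head?_cons, Option.isSome_some, cond_true, List.tail_cons, Option.getD_some]
    rw [toStacks_update, toStacks_update]
    rfl
  | @seq p q S S' S'' t t' h h' ih ih' =>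
    intro hp emb exit hm v
    obtain ⟨v₁, h₁⟩ := ih hp.1 (fun l => emb (Sum.inl l)) (emb (Sum.inr (entry q)))
      (fun l => hm (Sum.inl l)) v
    obtain ⟨v₂, h₂⟩ := ih' hp.2 (fun l => emb (Sum.inr l)) exit (fun l => hm (Sum.inr l)) v₁
    refine ⟨v₂, ?_⟩
    rw [add_comm, Function.iterate_add_apply]
    exact (congrArg _ h₁).trans h₂
  | @if_pos k a p q S S' t hk h ih =>
    intro hp emb exit hm v
    obtain ⟨v₁, h₁⟩ := ih hp.2.1 (fun l => emb (some (Sum.inl l))) exit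
      (fun l => hm (some (Sum.inl l))) (some a)
    refine ⟨v₁, (iterate_step (hm none) t v _).trans (Eq.trans (congrArg _ ?_) h₁)⟩
    change some (TM2.Cfg.mk (some (if (S k).head? = some a then _ else _)) (S k).head? _) = _
    rw [hk, _root_.if_pos rfl]
  | @if_neg k a p q S S' t hk h ih =>
    intro hp emb exit hm v
    obtain ⟨v₁, h₁⟩ := ih hp.2.2 (fun l => emb (some (Sum.inr l))) exit
      (fun l => hm (some (Sum.inr l))) (S k).head?
    refine ⟨v₁, (iterate_step (hm none) t v _).trans (Eq.trans (congrArg _ ?_) h₁)⟩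
    change some (TM2.Cfg.mk (some (if (S k).head? = some a then _ else _)) (S k).head? _) = _
    rw [_root_.if_neg hk]
  | @loop_nil k p S hk =>
    intro hp emb exit hm v
    refine ⟨none, (iterate_step (hm none) 0 v _).trans ?_⟩
    change some (TM2.Cfg.mk (some (if ((S k).head?).isSome then _ else _)) (S k).head? _) = _
    rw [hk]; rfl
  | @loop_cons k p S S' S'' t t' hk h h' ih ih' =>
    intro hp emb exit hm v
    obtain ⟨v₁, h₁⟩ := ih hp.2 (fun l => emb (some l)) (emb none)
      (fun l => hm (some l)) (S k).head?
    -- The body exits to `emb none`, which is the head test of the same loop, so the remaining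
    -- iterations start exactly where the body stops.
    obtain ⟨v₂, h₂⟩ := ih' hp emb exit hm v₁
    refine ⟨v₂, (iterate_step (hm none) (t + t') v _).trans ?_⟩
    have hs : (S k).head?.isSome = true := by
      cases hl : S k with
      | nil => exact absurd hl hk
      | cons a l => rfl
    rw [add_comm t, Function.iterate_add_apply]
    refine Eq.trans (congrArg _ (Eq.trans (congrArg _ ?_) h₁)) h₂
    change some (TM2.Cfg.mk (some (if ((S k).head?).isSome then _ else _)) (S k).head? _) = _
    rw [_root_.if_pos hs]

/-- The statement executed last: the result is read off the stack `r` and written as a bit. -/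
def finish {N : ℕ} {Λ : Type} (r : Fin N) : TM2.Stmt (Alphabet N) Λ (Option Γ') :=
  .pop (some r) (fun _ a => a) (.push none (fun v => (v.isSome : Bool)) (.load (fun _ => none) .halt))

/-- The Turing machine of a program with input stack `0` and result stack `r`. -/
def machine (p : Prog) (N : ℕ) (hp : p.Bounded (N + 1)) (r : Fin (N + 1)) : FinTM2 :=
  haveI := labelFintype p
  haveI : Fintype (Alphabet (N + 1) (some 0)) := inferInstanceAs (Fintype Γ')
  { K := Option (Fin (N + 1))
    k₀ := some 0
    k₁ := none
    Γ := Alphabet (N + 1)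
    Λ := Option (Label p)
    main := some (entry p)
    σ := Option Γ'
    initialState := none
    m := fun l => l.elim (finish r) (code p hp some none) }

theorem initList_machine (p : Prog) (N : ℕ) (hp : p.Bounded (N + 1)) (r : Fin (N + 1))
    (w : List Γ') : initList (machine p N hp r) w =
      ⟨some (some (entry p)), none, toStacks (N + 1) [] (single 0 w)⟩ := by
  refine congrArg (TM2.Cfg.mk (some (some (entry p))) none) ?_
  funext k
  rcases k with _ | k
  · rfl
  · by_cases hk : k = 0
    · subst hk; rfl
    · have h0 : (k : ℕ) ≠ 0 := fun h => hk (Fin.ext h)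
      have h1 : (some k : Option (Fin (N + 1))) ≠ some 0 := fun h => hk (Option.some.inj h)
      exact (dif_neg h1).trans (single_of_ne h0 w).symm

theorem haltList_machine (p : Prog) (N : ℕ) (hp : p.Bounded (N + 1)) (r : Fin (N + 1))
    (b : List Bool) : haltList (machine p N hp r) b =
      ⟨none, none, toStacks (N + 1) b (fun _ => [])⟩ := by
  refine congrArg (TM2.Cfg.mk none none) ?_
  funext k
  rcases k with _ | k <;> rfl

/-- A halting configuration must have every stack empty except the output. The last statement pops a
single symbol, hence the bound on the length of `l`; whether there was a symbol becomes the answer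
bit. -/
theorem stepAux_finish {N : ℕ} {Λ : Type} (r : Fin N) (v : Option Γ') (l : List Γ')
    (hl : l.length ≤ 1) :
    TM2.stepAux (finish (Λ := Λ) r) v (toStacks N [] (single r l)) =
      ⟨none, none, toStacks N [!l.isEmpty] (fun _ => [])⟩ := by
  have h1 : toStacks N [] (single r l) (some r) = l :=
    single_self r l
  simp only [finish, TM2.stepAux]
  rw [h1, toStacks_update]
  refine congrArg (TM2.Cfg.mk none none) ?_
  have h2 : l.tail = [] := by
    rcases l with _ | ⟨a, _ | ⟨b, l⟩⟩
    · rfl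
    · rfl
    · simp at hl
  have h3 : l.head?.isSome = !l.isEmpty := by cases l <;> rfl
  rw [h2, h3, single, Function.update_idem, ← single]
  rw [show single (r : ℕ) [] = fun _ => [] from single_nil r]
  funext k
  rcases k with _ | k
  · exact Function.update_self _ _ _
  · exact Function.update_of_ne (by simp) _ _

/-- A polynomial time program that decides a language witnesses membership in `P`. -/
theorem inP_of_run {L : Language Γ'} (p : Prog) (r : ℕ) (time : Polynomial ℕ)
    (h : ∀ w : List Γ', ∃ t ≤ time.eval w.length, ∃ l : List Γ', (l.isEmpty ↔ w ∉ L) ∧ l.length ≤ 1 ∧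
      Run p (single 0 w) (single r l) t) :
    InP L := by
  classical
  obtain ⟨N, hN⟩ := exists_bounded p
  have hN' : p.Bounded (max N r + 1) := hN.mono (by omega)
  have hr' : r < max N r + 1 := by omega
  refine ⟨{ tm := machine p (max N r) hN' ⟨r, hr'⟩
            inputAlphabet := Equiv.refl Γ'
            outputAlphabet := Equiv.refl Bool
            time := time + 1
            outputsFun := fun w => Classical.choice ?_ }⟩
  obtain ⟨t, ht, l, hl, hl1, hr⟩ := h w
  obtain ⟨v, hv⟩ := hr.simulate (fun l => l.elim (finish ⟨r, hr'⟩) (code p hN' some none)) []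
    hN' some none (fun _ => rfl) none
  have hb : (!l.isEmpty) = decide (w ∈ L) := by
    by_cases hw : w ∈ L
    · have : ¬ (l.isEmpty = true) := fun h => hl.1 h hw
      simp [hw, this]
    · simp [hw, hl.2 hw]
  -- The additional step executes `finish`.
  refine ⟨⟨⟨t + 1, ?_⟩, by simpa using ht⟩⟩
  have hmap : List.map (Equiv.refl Γ').invFun w = w := List.map_id w
  refine Eq.trans (congrArg (fun u => (flip bind (machine p (max N r) hN' ⟨r, hr'⟩).step)^[t + 1]
    (some (initList (machine p (max N r) hN' ⟨r, hr'⟩) u))) hmap) ?_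
  refine Eq.trans (congrArg (fun u => (flip bind (machine p (max N r) hN' ⟨r, hr'⟩).step)^[t + 1]
    (some u)) (initList_machine p _ hN' ⟨r, hr'⟩ w)) ?_
  refine Eq.trans ?_ (congrArg some (haltList_machine p _ hN' ⟨r, hr'⟩ [decide (w ∈ L)])).symm
  rw [← hb]
  refine Eq.trans (Function.iterate_succ_apply' _ t _) ?_
  refine Eq.trans (congrArg _ hv) ?_
  exact congrArg some (stepAux_finish (Λ := Option (Label p)) ⟨r, hr'⟩ v l hl1)

end Prog

end PossibleManipulators

/-! ### Time-bounded runs and basic stack routines -/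

namespace PossibleManipulators

open Computability Turing

namespace Prog

/-- `p` turns `S` into `S'` in at most `T` steps. -/
def Runs (p : Prog) (S S' : Store) (T : ℕ) : Prop := ∃ t ≤ T, Run p S S' t

theorem Run.runs {p : Prog} {S S' : Store} {t : ℕ} (h : Run p S S' t) : Runs p S S' t :=
  ⟨t, le_rfl, h⟩

theorem Runs.mono {p : Prog} {S S' : Store} {T T' : ℕ} (h : Runs p S S' T) (hT : T ≤ T') :
    Runs p S S' T' :=
  let ⟨t, ht, h⟩ := h
  ⟨t, ht.trans hT, h⟩

theorem Runs.seq {p q : Prog} {S S' S'' : Store} {T T' : ℕ} (h : Runs p S S' T)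
    (h' : Runs q S' S'' T') : Runs (p.seq q) S S'' (T + T') :=
  let ⟨t, ht, h⟩ := h
  let ⟨t', ht', h'⟩ := h'
  ⟨t + t', Nat.add_le_add ht ht', h.seq h'⟩

theorem Runs.loop_cons {k : ℕ} {p : Prog} {S S' S'' : Store} {T T' : ℕ} (hk : S k ≠ [])
    (h : Runs p S S' T) (h' : Runs (loop k p) S' S'' T') : Runs (loop k p) S S'' (T + T' + 1) :=
  let ⟨t, ht, h⟩ := h
  let ⟨t', ht', h'⟩ := h'
  ⟨t + t' + 1, by omega, h.loop_cons hk h'⟩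

theorem Runs.congr {p : Prog} {S S' S'' : Store} {T : ℕ} (h : Runs p S S' T)
    (hS : ∀ k, S' k = S'' k) : Runs p S S'' T :=
  (funext hS : S' = S'') ▸ h

/-- The unary representation of a number on a stack. -/
abbrev unary (n : ℕ) : List Γ' := List.replicate n (Γ'.bit true)

/-- Each symbol costs a head test and a move, and the final test costs one more. Moving reverses the
order, so a stack parked in a buffer is restored by moving it back. -/
theorem runs_moveAll {j k : ℕ} (hjk : j ≠ k) (l : List Γ') : ∀ S : Store, S j = l →
    Runs (loop j (move j k)) S
      (Function.update (Function.update S j []) k (l.reverse ++ S k)) (2 * l.length + 1) := by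
  induction l with
  | nil =>
    intro S h
    refine (Run.loop_nil h).runs.congr fun i => ?_
    simp only [Function.update_apply]; split_ifs <;> simp_all
  | cons a l ih =>
    intro S h
    refine ((Runs.loop_cons (by simp [h]) (Run.move_cons j k S a l h).runs
      (ih _ (by simp [hjk]))).congr fun i => ?_).mono (by simp; omega)
    simp only [Function.update_apply]; split_ifs <;> simp_all

theorem runs_dropAll (k : ℕ) (l : List Γ') : ∀ S : Store, S k = l →
    Runs (loop k (drop k)) S (Function.update S k []) (2 * l.length + 1) := by
  induction l with
  | nil =>
    intro S h
    refine (Run.loop_nil h).runs.congr fun i => ?_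
    simp only [Function.update_apply]; split_ifs <;> simp_all
  | cons a l ih =>
    intro S h
    refine ((Runs.loop_cons (by simp [h]) (Run.drop k S).runs
      (ih _ (by simp [h]))).congr fun i => ?_).mono (by simp; omega)
    simp only [Function.update_apply]; split_ifs <;> simp_all

theorem unary_succ' (n : ℕ) (l : List Γ') :
    unary n ++ Γ'.bit true :: l = Γ'.bit true :: (unary n ++ l) := by
  rw [← List.singleton_append, ← List.append_assoc]
  have : unary n ++ [Γ'.bit true] = Γ'.bit true :: unary n := by
    rw [unary, ← List.replicate_succ', List.replicate_succ]
  rw [this]; rfl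

/-- Moving a stack and counting its elements in another one. -/
theorem runs_countAll {j k r : ℕ} (hjk : j ≠ k) (hjr : j ≠ r) (hkr : k ≠ r) (l : List Γ') :
    ∀ S : Store, S j = l →
    Runs (loop j (seq (push r (Γ'.bit true)) (move j k))) S
      (Function.update (Function.update (Function.update S j []) k (l.reverse ++ S k)) r
        (unary l.length ++ S r)) (3 * l.length + 1) := by
  induction l with
  | nil =>
    intro S h
    refine (Run.loop_nil h).runs.congr fun i => ?_
    simp only [Function.update_apply]; split_ifs <;> simp_all
  | cons a l ih =>
    intro S h
    refine ((Runs.loop_cons (by simp [h]) ((Run.push r (Γ'.bit true) S).runs.seq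
      (Run.move_cons j k _ a l (by simp [h, hjr])).runs)
      (ih _ (by simp [hjk]))).congr fun i => ?_).mono (by simp; omega)
    simp only [Function.update_apply, List.length_cons]
    split_ifs <;> simp_all [unary_succ', List.replicate_succ]

/-- Moving a prefix of the input whose length is given in unary. -/
theorem runs_seek {j k r : ℕ} (hjk : j ≠ k) (hjr : j ≠ r) (hkr : k ≠ r) (n : ℕ) :
    ∀ S : Store, S r = unary n →
    Runs (loop r (seq (drop r) (move j k))) S
      (Function.update (Function.update (Function.update S j ((S j).drop n)) k
        (((S j).take n).reverse ++ S k)) r []) (3 * n + 1) := by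
  induction n with
  | zero =>
    intro S h
    refine (Run.loop_nil h).runs.congr fun i => ?_
    simp only [Function.update_apply]; split_ifs <;> simp_all
  | succ n ih =>
    intro S h
    rcases hS : S j with _ | ⟨a, l⟩
    -- The number may exceed the length of the stack. The surplus moves do nothing, in accordance
    -- with `List.drop` and `List.take`.
    · refine ((Runs.loop_cons (by simp [h, List.replicate_succ]) ((Run.drop r S).runs.seq
        (Run.move_nil j k _ (by simp [hS, hjr])).runs)
        (ih _ (by simp [h]))).congr fun i => ?_).mono (by omega)
      simp only [Function.update_apply]
      split_ifs <;> simp_all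
    · refine ((Runs.loop_cons (by simp [h, List.replicate_succ]) ((Run.drop r S).runs.seq
        (Run.move_cons j k _ a l (by simp [hS, hjr])).runs)
        (ih _ (by simp [h, hjr.symm, hkr.symm]))).congr fun i => ?_).mono (by omega)
      simp only [Function.update_apply]
      split_ifs <;> simp_all

/-- Dropping from an empty stack has no effect, which is precisely truncated subtraction in unary.
-/
theorem runs_subtract {j r : ℕ} (hjr : j ≠ r) (n : ℕ) :
    ∀ (S : Store) (m : ℕ), S r = unary n → S j = unary m →
    Runs (loop r (seq (drop r) (drop j))) S
      (Function.update (Function.update S j (unary (m - n))) r []) (3 * n + 1) := by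
  induction n with
  | zero =>
    intro S m h h'
    refine (Run.loop_nil h).runs.congr fun i => ?_
    simp only [Function.update_apply]; split_ifs <;> simp_all
  | succ n ih =>
    intro S m h h'
    refine ((Runs.loop_cons (by simp [h, List.replicate_succ]) ((Run.drop r S).runs.seq
        (Run.drop j _).runs)
        (ih _ (m - 1) (by simp [h, hjr.symm]) (by simp [h', hjr]))).congr fun i => ?_).mono
        (by omega)
    simp only [Function.update_apply, show m - 1 - n = m - (n + 1) by omega]
    split_ifs <;> simp_all

/-- The loop evaluating a bounded sum: the stack `r` accumulates the sum, the stack `r + 1` holds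
the number of remaining summands, and the stack `r + 2` holds the summation index. -/
theorem runs_sumLoop {p : Prog} {r : ℕ} {S : Store} {f g : ℕ → ℕ} (hS : S (r + 3) = [])
    (hp : ∀ (i : ℕ) (T : Store), (∀ k, k ≠ r → k ≠ r + 1 → k ≠ r + 2 → T k = S k) →
      T (r + 2) = unary i → Runs p T (Function.update T (r + 3) (unary (f i))) (g i))
    (c : ℕ) : ∀ (i acc : ℕ) (T : Store), (∀ k, k ≠ r → k ≠ r + 1 → k ≠ r + 2 → T k = S k) →
      T r = unary acc → T (r + 1) = unary c → T (r + 2) = unary i →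
      Runs (.loop (r + 1) (.seq (.drop (r + 1)) (.seq p
          (.seq (.loop (r + 3) (.move (r + 3) r)) (.push (r + 2) (.bit true)))))) T
        (Function.update (Function.update (Function.update T r
          (unary (acc + ∑ j ∈ Finset.range c, f (i + j)))) (r + 1) []) (r + 2) (unary (i + c)))
        (∑ j ∈ Finset.range c, (g (i + j) + 2 * f (i + j) + 4) + 1) := by
  induction c with
  | zero =>
    intro i acc T _ h0 h1 h2
    refine (Run.loop_nil h1).runs.congr fun k => ?_
    simp only [Function.update_apply]
    split_ifs <;> simp_all
  | succ c ih =>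
    intro i acc T hT h0 h1 h2
    have hd : ∀ k, k ≠ r → k ≠ r + 1 → k ≠ r + 2 →
        Function.update T (r + 1) (T (r + 1)).tail k = S k := fun k hk hk' hk'' => by
      rw [Function.update_of_ne hk', hT k hk hk' hk'']
    have he := hp i _ hd (by simp [h2])
    have hm := runs_moveAll (j := r + 3) (k := r) (by omega) (unary (f i)) _
      (Function.update_self (r + 3) (unary (f i)) (Function.update T (r + 1) (T (r + 1)).tail))
    have hl := ih (i + 1) (acc + f i)
      (Function.update (Function.update (Function.update T (r + 1) (unary c)) r
        (unary (acc + f i))) (r + 2) (unary (i + 1)))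
      (fun k hk hk' hk'' => by simp [hk, hk', hk'', hT]) (by simp) (by simp) (by simp)
    have h3 : T (r + 3) = [] := by rw [hT _ (by omega) (by omega) (by omega), hS]
    refine ((Runs.loop_cons (by simp [h1, List.replicate_succ])
      ((Run.drop (r + 1) T).runs.seq (he.seq (hm.seq
        ((Run.push (r + 2) _ _).runs.congr fun k => ?_)))) hl).congr fun k => ?_).mono ?_
    · clear hl hm he hd ih hp hT
      simp only [Function.update_apply]
      split_ifs <;> first | omega | simp_all [Nat.add_comm, List.replicate_succ]
    · clear hl hm he hd ih hp hT
      have e1 : acc + f i + ∑ j ∈ Finset.range c, f (i + 1 + j) =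
          acc + ∑ j ∈ Finset.range (c + 1), f (i + j) := by
        rw [Finset.sum_range_succ', Finset.sum_congr rfl fun j _ => by
          rw [show i + 1 + j = i + (j + 1) by omega], Nat.add_zero]
        omega
      rw [e1, show i + 1 + c = i + (c + 1) by omega]
      simp only [Function.update_apply]
      split_ifs <;> rfl
    · rw [Finset.sum_range_succ', Finset.sum_congr rfl fun j _ => by
        rw [show i + 1 + j = i + (j + 1) by omega]]
      simp only [Nat.add_zero, List.length_replicate]
      omega

end Prog

open Prog

/-! ### Counting expressions over a word -/

/-- Arithmetic expressions over a word and an environment of numbers, with bounded sums. -/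
inductive Expr : Type
  | len : Expr
  | one : Expr
  | var (i : ℕ) : Expr
  | sym (a : Γ') (e : Expr) : Expr
  | add (e f : Expr) : Expr
  | sub (e f : Expr) : Expr
  | sum (b e : Expr) : Expr

namespace Expr

/-- The value of an expression; `sym a e` is `1` if the symbol at position `e` is `a`, and
`sum b e` is the sum of `e` over all values of a new variable below `b`. -/
def eval (w : List Γ') : Expr → List ℕ → ℕ
  | len, _ => w.length
  | one, _ => 1
  | var i, v => v.getD i 0
  | sym a e, v => if w[e.eval w v]? = some a then 1 else 0
  | add e f, v => e.eval w v + f.eval w v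
  | sub e f, v => e.eval w v - f.eval w v
  | sum b e, v => ∑ i ∈ Finset.range (b.eval w v), e.eval w (i :: v)

/-- A program writing the value of the expression on the stack `r`. The input is on stack `0`,
the variables are on the stacks `ρ`, and the stacks from `r` on are used as work space. -/
def compile : Expr → List ℕ → ℕ → Prog
  | len, _, r => .seq (.loop 0 (.seq (.push r (.bit true)) (.move 0 1))) (.loop 1 (.move 1 0))
  | one, _, r => .push r (.bit true)
  | var i, ρ, r => (ρ[i]?).elim .skip fun k =>
      .seq (.loop k (.seq (.push r (.bit true)) (.move k (r + 1)))) (.loop (r + 1) (.move (r + 1) k))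
  | sym a e, ρ, r => .seq (e.compile ρ (r + 1)) (.seq (.loop (r + 1) (.seq (.drop (r + 1)) (.move 0 1)))
      (.seq (.ifHead 0 a (.push r (.bit true)) .skip) (.loop 1 (.move 1 0))))
  | add e f, ρ, r => .seq (e.compile ρ r) (.seq (f.compile ρ (r + 1)) (.loop (r + 1) (.move (r + 1) r)))
  | sub e f, ρ, r => .seq (e.compile ρ r) (.seq (f.compile ρ (r + 1))
      (.loop (r + 1) (.seq (.drop (r + 1)) (.drop r))))
  | sum b e, ρ, r => .seq (b.compile ρ (r + 1)) (.seq
      (.loop (r + 1) (.seq (.drop (r + 1)) (.seq (e.compile ((r + 2) :: ρ) (r + 3))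
        (.seq (.loop (r + 3) (.move (r + 3) r)) (.push (r + 2) (.bit true))))))
      (.loop (r + 2) (.drop (r + 2))))

/-- A bound on the running time of the compiled expression. -/
def cost (w : List Γ') : Expr → List ℕ → ℕ
  | len, _ => 5 * w.length + 2
  | one, _ => 1
  | var i, v => 5 * v.getD i 0 + 2
  | sym _ e, v => e.cost w v + 3 * e.eval w v + 2 * w.length + 4
  | add e f, v => e.cost w v + f.cost w v + 2 * f.eval w v + 1
  | sub e f, v => e.cost w v + f.cost w v + 3 * f.eval w v + 1
  | sum b e, v => b.cost w v + ∑ i ∈ Finset.range (b.eval w v),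
      (e.cost w (i :: v) + 2 * e.eval w (i :: v) + 4) + 2 * b.eval w v + 2

/-- The stores in which a compiled expression can be run. -/
structure Ready (w : List Γ') (ρ v : List ℕ) (r : ℕ) (S : Store) : Prop where
  two_le : 2 ≤ r
  input : S 0 = w
  aux : S 1 = []
  env : List.Forall₂ (fun k x => (2 ≤ k ∧ k < r) ∧ S k = unary x) ρ v
  free : ∀ k, r ≤ k → S k = []

theorem Ready.of_eq {w : List Γ'} {ρ v : List ℕ} {r r' : ℕ} {S S' : Store} (h : Ready w ρ v r S)
    (hr : r ≤ r') (hS : ∀ k < r, S' k = S k) (hf : ∀ k, r' ≤ k → S' k = []) :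
    Ready w ρ v r' S' where
  two_le := h.two_le.trans hr
  input := (hS 0 (by have := h.two_le; omega)).trans h.input
  aux := (hS 1 (by have := h.two_le; omega)).trans h.aux
  env := h.env.imp fun k x hk => ⟨⟨hk.1.1, hk.1.2.trans_le hr⟩, (hS k hk.1.2).trans hk.2⟩
  free := hf

/-- The invariant behind the induction is stack discipline: an expression compiled at `r` changes
nothing but stack `r`, so the variables below `r` survive and the stacks above are empty again for
the next subexpression. Stack `1` is a buffer for the input, empty before and after. -/
theorem runs_compile (w : List Γ') (e : Expr) : ∀ (ρ v : List ℕ) (r : ℕ) (S : Store),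
    Ready w ρ v r S →
    Runs (e.compile ρ r) S (Function.update S r (unary (e.eval w v))) (e.cost w v) := by
  induction e with
  | len =>
    intro ρ v r S h
    have h2 := h.two_le
    have hr := h.free r le_rfl
    refine (((runs_countAll (by decide) (by omega) (by omega) w S h.input).seq
      (runs_moveAll (by decide) w.reverse _ (by simp [h.aux, show (1 : ℕ) ≠ r by omega]))).congr
      fun i => ?_).mono (by simp only [List.length_reverse, cost]; omega)
    have := h.input
    have := h.aux
    simp only [Function.update_apply, eval]
    split_ifs <;> simp_all
  | one =>
    intro ρ v r S h
    have hr := h.free r le_rfl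
    refine (Run.push r _ S).runs.congr fun i => ?_
    simp [hr, eval]
  | var i =>
    intro ρ v r S h
    have h2 := h.two_le
    have hr := h.free r le_rfl
    have hr1 := h.free (r + 1) (by omega)
    have hlen := h.env.length_eq
    rcases lt_or_ge i ρ.length with hi | hi
    · have hk := h.env.get hi (hlen ▸ hi)
      simp only [List.get_eq_getElem] at hk
      have hv : v.getD i 0 = v[i]'(hlen ▸ hi) := by simp [List.getD, hlen ▸ hi]
      simp only [compile, List.getElem?_eq_getElem hi, Option.elim_some, eval, cost, hv]
      generalize ρ[i] = k at hk
      generalize v[i]'(hlen ▸ hi) = x at hk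
      refine (((runs_countAll (by omega) (by omega) (by omega) _ S hk.2).seq
        (runs_moveAll (by omega) (unary x) _ (by simp [hr1]))).congr
        fun i => ?_).mono (by simp only [List.length_replicate]; omega)
      simp only [Function.update_apply]
      split_ifs <;> first | omega | simp_all
    · have hv : v.getD i 0 = 0 := by simp [List.getD, hlen ▸ hi]
      simp only [compile, List.getElem?_eq_none hi, Option.elim_none, eval, cost, hv]
      refine ((Run.skip S).runs.congr fun i => ?_).mono (by omega)
      simp only [Function.update_apply]
      split_ifs <;> simp_all
  | sym a e ih =>
    intro ρ v r S h
    have h2 := h.two_le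
    have hr := h.free r le_rfl
    have hr1 := h.free (r + 1) (by omega)
    have hin := h.input
    have haux := h.aux
    have h1 := ih ρ v (r + 1) S (h.of_eq (by omega) (fun _ _ => rfl)
      (fun k hk => h.free k (by omega)))
    -- The symbols before the requested position are parked on stack `1`, which exposes the
    -- requested symbol at the head of stack `0`. Past the end of the word nothing is exposed and
    -- the test fails.
    have h2 := runs_seek (j := 0) (k := 1) (r := r + 1) (by decide) (by omega) (by omega) _ _
      (Function.update_self (r + 1) (unary (e.eval w v)) S)
    have h3 := h1.seq (h2.seq (Runs.seq (p := .ifHead 0 a (.push r (.bit true)) .skip)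
      (q := .loop 1 (.move 1 0)) (T := 2)
      (S' := Function.update (Function.update (Function.update S 0 (w.drop (e.eval w v))) 1
        (w.take (e.eval w v)).reverse) r (unary (eval w (sym a e) v))) ?_
      (runs_moveAll (by decide) (w.take (e.eval w v)).reverse _
        (by simp [show (1 : ℕ) ≠ r by omega]))))
    · refine (h3.congr fun i => ?_).mono ?_
      · simp only [Function.update_apply]
        split_ifs <;> first | omega | simp_all
      · simp only [cost, List.length_reverse, List.length_take]
        have := min_le_right (e.eval w v) w.length
        omega
    · by_cases hw : w[e.eval w v]? = some a
      · refine ((Run.if_pos (k := 0) (a := a) ?_ (Run.push r _ _)).runs.congr fun i => ?_)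
        · simp [hin, hw]
        · simp only [Function.update_apply, eval, hw, if_true]
          split_ifs <;> first | omega | simp_all
      · refine ((Run.if_neg (k := 0) (a := a) ?_ (Run.skip _)).runs.congr fun i => ?_)
        · simpa [show (0 : ℕ) ≠ r by omega, hin] using hw
        · simp only [Function.update_apply, eval, hw, if_false]
          split_ifs <;> first | omega | simp_all
  | add e f ihe ihf =>
    intro ρ v r S h
    have hr := h.free r le_rfl
    have hr1 := h.free (r + 1) (by omega)
    have h1 := ihe ρ v r S h
    have h2 := ihf ρ v (r + 1) _ (h.of_eq (S' := Function.update S r (unary (e.eval w v)))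
      (by omega) (fun k hk => by simp [show k ≠ r by omega])
      (fun k hk => by simp [show k ≠ r by omega, h.free k (by omega)]))
    refine ((h1.seq (h2.seq (runs_moveAll (k := r) (by omega) (unary (f.eval w v)) _
      (by simp)))).congr fun i => ?_).mono (by simp only [cost, List.length_replicate]; omega)
    simp only [Function.update_apply, eval]
    split_ifs <;> first | omega | simp_all [Nat.add_comm]
  | sub e f ihe ihf =>
    intro ρ v r S h
    have hr := h.free r le_rfl
    have hr1 := h.free (r + 1) (by omega)
    have h1 := ihe ρ v r S h
    have h2 := ihf ρ v (r + 1) _ (h.of_eq (S' := Function.update S r (unary (e.eval w v)))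
      (by omega) (fun k hk => by simp [show k ≠ r by omega])
      (fun k hk => by simp [show k ≠ r by omega, h.free k (by omega)]))
    refine ((h1.seq (h2.seq (runs_subtract (j := r) (by omega) (f.eval w v) _ (e.eval w v)
      (by simp) (by simp)))).congr fun i => ?_).mono (by simp only [cost]; omega)
    simp only [Function.update_apply, eval]
    split_ifs <;> first | omega | simp_all
  | sum b e ihb ihe =>
    intro ρ v r S h
    have hr := h.free r le_rfl
    have hr1 := h.free (r + 1) (by omega)
    have hr2 := h.free (r + 2) (by omega)
    have h1 := ihb ρ v (r + 1) S (h.of_eq (by omega) (fun _ _ => rfl)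
      (fun k hk => h.free k (by omega)))
    -- The counter on stack `r + 2` serves as the newest variable of the summand, whose work space
    -- therefore starts at `r + 3`.
    have hbody : ∀ (i : ℕ) (T : Store), (∀ k, k ≠ r → k ≠ r + 1 → k ≠ r + 2 → T k = S k) →
        T (r + 2) = unary i →
        Runs (e.compile ((r + 2) :: ρ) (r + 3)) T
          (Function.update T (r + 3) (unary (e.eval w (i :: v)))) (e.cost w (i :: v)) := by
      intro i T hT h2
      have hT' : Ready w ρ v (r + 3) T := h.of_eq (by omega)
        (fun k hk => hT k (by omega) (by omega) (by omega))
        (fun k hk => (hT k (by omega) (by omega) (by omega)).trans (h.free k (by omega)))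
      exact ihe _ _ _ _ { hT' with env := .cons ⟨⟨by omega, by omega⟩, h2⟩ hT'.env }
    have key := runs_sumLoop (h.free (r + 3) (by omega)) hbody
    have h2 := key (b.eval w v) 0 0 (Function.update S (r + 1) (unary (b.eval w v)))
      (fun k _ hk _ => by simp [hk]) (by simp [hr]) (by simp) (by simp [hr2])
    refine ((h1.seq (h2.seq (runs_dropAll (r + 2) (unary (b.eval w v)) _ (by simp)))).congr
      fun k => ?_).mono (by simp only [cost, List.length_replicate, Nat.zero_add]; omega)
    simp only [Function.update_apply, eval, Nat.zero_add]
    split_ifs <;> first | omega | simp_all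

end Expr

end PossibleManipulators

/-! ### Polynomial bounds on values and running times -/

namespace PossibleManipulators

open Computability Turing

open Prog

namespace Expr

/-- Functions bounded by a fixed power of every bound on the length of the word and the values of
the variables. -/
def PolyBounded (f : List Γ' → List ℕ → ℕ) : Prop :=
  ∃ c : ℕ, ∀ (w : List Γ') (v : List ℕ) (X : ℕ), 2 ≤ X → w.length ≤ X → (∀ x ∈ v, x ≤ X) →
    f w v ≤ X ^ c

namespace PolyBounded

theorem const (c : ℕ) : PolyBounded fun _ _ => c :=
  ⟨c, fun _ _ _ hX _ _ => Nat.lt_two_pow_self.le.trans (Nat.pow_le_pow_left hX c)⟩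

theorem length : PolyBounded fun w _ => w.length :=
  ⟨1, fun _ _ X _ hw _ => by simpa using hw⟩

theorem var (i : ℕ) : PolyBounded fun _ v => v.getD i 0 :=
  ⟨1, fun w v X hX hw hv => by
    rcases lt_or_ge i v.length with hi | hi
    · simpa [List.getD, hi] using hv _ (List.getElem_mem hi)
    · simp [List.getD, hi]⟩

theorem mul {f g : List Γ' → List ℕ → ℕ} (hf : PolyBounded f) (hg : PolyBounded g) :
    PolyBounded fun w v => f w v * g w v := by
  obtain ⟨a, ha⟩ := hf
  obtain ⟨b, hb⟩ := hg
  exact ⟨a + b, fun w v X hX hw hv => by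
    rw [pow_add]; exact Nat.mul_le_mul (ha w v X hX hw hv) (hb w v X hX hw hv)⟩

theorem mono {f g : List Γ' → List ℕ → ℕ} (hf : PolyBounded f) (h : ∀ w v, g w v ≤ f w v) :
    PolyBounded g :=
  let ⟨a, ha⟩ := hf
  ⟨a, fun w v X hX hw hv => (h w v).trans (ha w v X hX hw hv)⟩

theorem add {f g : List Γ' → List ℕ → ℕ} (hf : PolyBounded f) (hg : PolyBounded g) :
    PolyBounded fun w v => f w v + g w v := by
  obtain ⟨a, ha⟩ := hf
  obtain ⟨b, hb⟩ := hg
  refine ⟨max a b + 1, fun w v X hX hw hv => ?_⟩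
  have h1 := (ha w v X hX hw hv).trans (Nat.pow_le_pow_right (by omega) (le_max_left a b))
  have h2 := (hb w v X hX hw hv).trans (Nat.pow_le_pow_right (by omega) (le_max_right a b))
  rw [pow_succ]
  nlinarith [Nat.zero_le (X ^ max a b)]

theorem sum {b f : List Γ' → List ℕ → ℕ} (hb : PolyBounded b) (hf : PolyBounded f) :
    PolyBounded fun w v => ∑ i ∈ Finset.range (b w v), f w (i :: v) := by
  obtain ⟨a, ha⟩ := hb
  obtain ⟨c, hc⟩ := hf
  -- There are at most `X ^ a` summands. The index is below `X ^ a`, so `X ^ (a + 1)` bounds all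
  -- variables of the summand; it is also at least `X` when `a = 0`. Each summand is thus at most `X
  -- ^ ((a + 1) * c)`.
  refine ⟨a + (a + 1) * c, fun w v X hX hw hv => ?_⟩
  have hX' : X ≤ X ^ (a + 1) := Nat.le_self_pow (by omega) X
  have ha' : X ^ a ≤ X ^ (a + 1) := Nat.pow_le_pow_right (by omega) (by omega)
  have hb := ha w v X hX hw hv
  calc ∑ i ∈ Finset.range (b w v), f w (i :: v)
      ≤ ∑ i ∈ Finset.range (b w v), (X ^ (a + 1)) ^ c := by
        refine Finset.sum_le_sum fun i hi => hc w _ _ (hX.trans hX') (hw.trans hX') ?_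
        intro x hx
        rcases List.mem_cons.1 hx with rfl | hx
        · have := Finset.mem_range.1 hi
          omega
        · exact (hv x hx).trans hX'
    _ ≤ X ^ (a + (a + 1) * c) := by
        rw [Finset.sum_const, Finset.card_range, smul_eq_mul, pow_add X a ((a + 1) * c), pow_mul]
        exact Nat.mul_le_mul_right _ hb

end PolyBounded

/-- A bounded sum multiplies the bound of its range with that of its body. As the expression is
fixed, the exponents stay constant, which is what makes unary storage affordable. -/
theorem polyBounded_eval (e : Expr) : PolyBounded fun w v => e.eval w v := by
  induction e with
  | len => exact .length
  | one => exact .const 1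
  | var i => exact .var i
  | sym a e _ => exact (PolyBounded.const 1).mono fun w v => by simp only [eval]; split_ifs <;> omega
  | add e f he hf => exact he.add hf
  | sub e f he _ => exact he.mono fun w v => Nat.sub_le _ _
  | sum b e hb he => exact hb.sum he

theorem polyBounded_cost (e : Expr) : PolyBounded fun w v => e.cost w v := by
  induction e with
  | len => exact ((PolyBounded.const 5).mul .length).add (.const 2)
  | one => exact .const 1
  | var i => exact ((PolyBounded.const 5).mul (.var i)).add (.const 2)
  | sym a e he =>
    exact ((he.add ((PolyBounded.const 3).mul e.polyBounded_eval)).add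
      ((PolyBounded.const 2).mul .length)).add (.const 4)
  | add e f he hf =>
    exact ((he.add hf).add ((PolyBounded.const 2).mul f.polyBounded_eval)).add (.const 1)
  | sub e f he hf =>
    exact ((he.add hf).add ((PolyBounded.const 3).mul f.polyBounded_eval)).add (.const 1)
  | sum b e hb he =>
    exact ((hb.add (b.polyBounded_eval.sum
      ((he.add ((PolyBounded.const 2).mul e.polyBounded_eval)).add (.const 4)))).add
        ((PolyBounded.const 2).mul b.polyBounded_eval)).add (.const 2)

/-- A language whose indicator function is given by a counting expression is in `P`. -/
theorem inP {L : Language Γ'} (e : Expr) (h1 : ∀ w ∈ L, e.eval w [] = 1)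
    (h0 : ∀ w ∉ L, e.eval w [] = 0) : InP L := by
  obtain ⟨c, hc⟩ := e.polyBounded_cost
  -- The input is erased at the end because the machine has to halt with empty stacks. The values
  -- `0` and `1` in unary are the empty and the one-symbol stack expected by `inP_of_run`. The
  -- summand `2` keeps the base of the power at least `2`, as `PolyBounded` requires.
  refine inP_of_run (.seq (e.compile [] 2) (.loop 0 (.drop 0))) 2
    ((Polynomial.X + 2) ^ c + 2 * Polynomial.X + 1) fun w => ?_
  have hr : Ready w [] [] 2 (single 0 w) :=
    { two_le := le_rfl
      input := single_self 0 w
      aux := single_of_ne (by omega) w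
      env := .nil
      free := fun k hk => single_of_ne (by omega) w }
  obtain ⟨t, ht, h⟩ := ((e.runs_compile w [] [] 2 _ hr).seq
    (runs_dropAll 0 w _ (by simp [single_self]))).congr (S'' := single 2 (unary (e.eval w [])))
    fun k => by
      simp only [single, Function.update_apply]
      split_ifs <;> simp_all
  refine ⟨t, ht.trans ?_, _, ?_, ?_, h⟩
  · have : e.cost w [] ≤ (w.length + 2) ^ c := hc w [] (w.length + 2) (by omega) (by omega) (by simp)
    simp
    omega
  · by_cases hw : w ∈ L
    · simp [hw, h1]
    · simp [hw, h0]
  · by_cases hw : w ∈ L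
    · simp [hw, h1]
    · simp [hw, h0]

/-! ### Renaming and substitution -/

/-- Renaming of variables. -/
def rename (g : ℕ → ℕ) : Expr → Expr
  | len => len
  | one => one
  | var i => var (g i)
  | sym a e => sym a (e.rename g)
  | add e f => add (e.rename g) (f.rename g)
  | sub e f => sub (e.rename g) (f.rename g)
  | sum b e => sum (b.rename g) (e.rename fun i => Nat.casesOn i 0 fun i => g i + 1)

theorem eval_rename (w : List Γ') (e : Expr) : ∀ (g : ℕ → ℕ) (v v' : List ℕ),
    (∀ i, v'.getD (g i) 0 = v.getD i 0) → (e.rename g).eval w v' = e.eval w v := by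
  induction e with
  | len => intros; rfl
  | one => intros; rfl
  | var i => intro g v v' h; exact h i
  | sym a e he => intro g v v' h; simp only [rename, eval, he g v v' h]
  | add e f he hf => intro g v v' h; simp only [rename, eval, he g v v' h, hf g v v' h]
  | sub e f he hf => intro g v v' h; simp only [rename, eval, he g v v' h, hf g v v' h]
  | sum b e hb he =>
    intro g v v' h
    simp only [rename, eval, hb g v v' h]
    refine Finset.sum_congr rfl fun x _ => he _ _ _ fun i => ?_
    cases i with
    | zero => simp
    | succ i => simpa using h i

/-- Simultaneous substitution of expressions for variables. -/
def subst (s : ℕ → Expr) : Expr → Expr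
  | len => len
  | one => one
  | var i => s i
  | sym a e => sym a (e.subst s)
  | add e f => add (e.subst s) (f.subst s)
  | sub e f => sub (e.subst s) (f.subst s)
  | sum b e => sum (b.subst s) (e.subst fun i => Nat.casesOn i (var 0) fun i => (s i).rename Nat.succ)

theorem eval_subst (w : List Γ') (e : Expr) : ∀ (s : ℕ → Expr) (v v' : List ℕ),
    (∀ i, (s i).eval w v' = v.getD i 0) → (e.subst s).eval w v' = e.eval w v := by
  induction e with
  | len => intros; rfl
  | one => intros; rfl
  | var i => intro g v v' h; exact h i
  | sym a e he => intro g v v' h; simp only [subst, eval, he g v v' h]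
  | add e f he hf => intro g v v' h; simp only [subst, eval, he g v v' h, hf g v v' h]
  | sub e f he hf => intro g v v' h; simp only [subst, eval, he g v v' h, hf g v v' h]
  | sum b e hb he =>
    intro g v v' h
    simp only [subst, eval, hb g v v' h]
    refine Finset.sum_congr rfl fun x _ => he _ _ _ fun i => ?_
    cases i with
    | zero => simp [eval]
    | succ i => simpa using ((g i).eval_rename w Nat.succ v' (x :: v') (by simp)).trans (h i)

end Expr

end PossibleManipulators

namespace PossibleManipulators

open Computability

/-! ### Definable functions, predicates and strings -/

/-- A context: its elements carry a word and finitely many natural numbers. -/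
class Ctx (X : Type) where
  inp : X → List Γ'
  vars : X → List ℕ

instance : Ctx (List Γ') := ⟨id, fun _ => []⟩

/-- The new number is put at the head, where `Expr.sum` puts its summation index; a pair thus plays
the role of a context below a binder. -/
instance {X : Type} [Ctx X] : Ctx (X × ℕ) := ⟨fun x => Ctx.inp x.1, fun x => x.2 :: Ctx.vars x.1⟩

variable {X Y : Type} [Ctx X] [Ctx Y]

/-- Functions given by a counting expression. -/
def Def (f : X → ℕ) : Prop := ∃ e : Expr, ∀ x, e.eval (Ctx.inp x) (Ctx.vars x) = f x

/-- Maps between contexts that keep the word, with definable numbers. -/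
def CtxMap (φ : X → Y) : Prop :=
  (∀ x, Ctx.inp (φ x) = Ctx.inp x) ∧ ∃ s : ℕ → Expr, ∀ x i,
    (s i).eval (Ctx.inp x) (Ctx.vars x) = (Ctx.vars (φ x)).getD i 0

theorem Def.comp {f : Y → ℕ} (hf : Def f) {φ : X → Y} (hφ : CtxMap φ) : Def fun x => f (φ x) := by
  obtain ⟨e, he⟩ := hf
  obtain ⟨h, s, hs⟩ := hφ
  exact ⟨e.subst s, fun x => by
    rw [Expr.eval_subst _ e s (Ctx.vars (φ x)) _ (hs x), ← h]
    exact he (φ x)⟩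

theorem CtxMap.fst : CtxMap fun x : X × ℕ => x.1 :=
  ⟨fun _ => rfl, fun i => .var (i + 1), fun _ _ => by simp [Expr.eval, Ctx.vars]⟩

theorem CtxMap.comp {Z : Type} [Ctx Z] {φ : X → Y} {ψ : Z → X} (hφ : CtxMap φ) (hψ : CtxMap ψ) :
    CtxMap fun z => φ (ψ z) := by
  obtain ⟨h, s, hs⟩ := hφ
  obtain ⟨h', s', hs'⟩ := hψ
  exact ⟨fun z => (h _).trans (h' z), fun i => (s i).subst s', fun z i => by
    rw [Expr.eval_subst _ (s i) s' (Ctx.vars (ψ z)) _ (hs' z), ← hs, h']⟩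

theorem CtxMap.pair {φ : X → Y} (hφ : CtxMap φ) {a : X → ℕ} (ha : Def a) :
    CtxMap fun x => (φ x, a x) := by
  obtain ⟨h, s, hs⟩ := hφ
  obtain ⟨e, he⟩ := ha
  refine ⟨h, fun i => Nat.casesOn i e s, fun x i => ?_⟩
  cases i with
  | zero => simpa [Ctx.vars] using he x
  | succ i => simpa [Ctx.vars] using hs x i

theorem Def.snd : Def fun x : X × ℕ => x.2 :=
  ⟨.var 0, fun _ => by simp [Expr.eval, Ctx.vars]⟩

theorem Def.fst {f : X → ℕ} (hf : Def f) : Def fun x : X × ℕ => f x.1 := hf.comp CtxMap.fst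

/-- Weakening under a binder. -/
theorem CtxMap.under : CtxMap fun x : (X × ℕ) × ℕ => (x.1.1, x.2) :=
  (CtxMap.fst.comp CtxMap.fst).pair Def.snd

theorem Def.under {f : X → ℕ → ℕ} (hf : Def fun x : X × ℕ => f x.1 x.2) :
    Def fun x : (X × ℕ) × ℕ => f x.1.1 x.2 :=
  hf.comp (φ := fun x : (X × ℕ) × ℕ => (x.1.1, x.2)) CtxMap.under

theorem Def.add {f g : X → ℕ} (hf : Def f) (hg : Def g) : Def fun x => f x + g x :=
  let ⟨e, he⟩ := hf
  let ⟨e', he'⟩ := hg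
  ⟨.add e e', fun x => by simp only [Expr.eval, he, he']⟩

theorem Def.sub {f g : X → ℕ} (hf : Def f) (hg : Def g) : Def fun x => f x - g x :=
  let ⟨e, he⟩ := hf
  let ⟨e', he'⟩ := hg
  ⟨.sub e e', fun x => by simp only [Expr.eval, he, he']⟩

theorem Def.one : Def fun _ : X => 1 := ⟨.one, fun _ => rfl⟩

theorem Def.const (c : ℕ) : Def fun _ : X => c := by
  induction c with
  | zero => exact Def.one.sub Def.one
  | succ c ih => exact ih.add Def.one

theorem Def.sum {b : X → ℕ} {f : X → ℕ → ℕ} (hb : Def b) (hf : Def fun x : X × ℕ => f x.1 x.2) :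
    Def fun x => ∑ i ∈ Finset.range (b x), f x i :=
  let ⟨e, he⟩ := hb
  let ⟨e', he'⟩ := hf
  ⟨.sum e e', fun x => by
    simp only [Expr.eval, he]
    exact Finset.sum_congr rfl fun i _ => he' (x, i)⟩

theorem Def.mul {f g : X → ℕ} (hf : Def f) (hg : Def g) : Def fun x => f x * g x := by
  simpa using hf.sum (f := fun x _ => g x) hg.fst

theorem Def.length_inp : Def fun x : X => (Ctx.inp x).length := ⟨.len, fun _ => rfl⟩

theorem Def.min {f g : X → ℕ} (hf : Def f) (hg : Def g) : Def fun x => min (f x) (g x) := by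
  have : (fun x => Min.min (f x) (g x)) = fun x => f x - (f x - g x) := by
    funext x; omega
  rw [this]
  exact hf.sub (hf.sub hg)

open Classical in
/-- Predicates whose indicator function is definable. -/
def DefP (p : X → Prop) : Prop := Def fun x => if p x then 1 else 0

theorem DefP.comp {p : Y → Prop} (hp : DefP p) {φ : X → Y} (hφ : CtxMap φ) :
    DefP fun x => p (φ x) :=
  Def.comp hp hφ

theorem DefP.under {p : X → ℕ → Prop} (hp : DefP fun x : X × ℕ => p x.1 x.2) :
    DefP fun x : (X × ℕ) × ℕ => p x.1.1 x.2 :=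
  hp.comp (φ := fun x : (X × ℕ) × ℕ => (x.1.1, x.2)) CtxMap.under

theorem DefP.congr {p q : X → Prop} (hp : DefP p) (h : ∀ x, q x ↔ p x) : DefP q := by
  rwa [show q = p from funext fun x => propext (h x)]

/-- With truncated subtraction, `1 - (1 - f)` is the indicator of `f ≠ 0`. Connectives and
quantifiers then only need an arithmetic term that is nonzero in the right cases. -/
theorem DefP.of_def {p : X → Prop} {f : X → ℕ} (hf : Def f) (h : ∀ x, p x ↔ f x ≠ 0) : DefP p := by
  classical
  have : (fun x => if p x then 1 else 0) = fun x => 1 - (1 - f x) := by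
    funext x
    have := h x
    split_ifs with hp
    · have := this.1 hp; omega
    · have : f x = 0 := by_contra fun h => hp (this.2 h)
      omega
  unfold DefP
  convert! Def.one.sub (Def.one.sub hf) using 1

theorem DefP.sym (a : Γ') {f : X → ℕ} (hf : Def f) : DefP fun x => (Ctx.inp x)[f x]? = some a :=
  let ⟨e, he⟩ := hf
  ⟨.sym a e, fun x => by simp only [Expr.eval, he]; congr⟩

theorem DefP.lt {f g : X → ℕ} (hf : Def f) (hg : Def g) : DefP fun x => f x < g x :=
  .of_def (hg.sub hf) fun x => by omega

theorem DefP.le {f g : X → ℕ} (hf : Def f) (hg : Def g) : DefP fun x => f x ≤ g x :=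
  .of_def ((hg.add .one).sub hf) fun x => by omega

theorem DefP.not {p : X → Prop} (hp : DefP p) : DefP fun x => ¬ p x :=
  .of_def (Def.one.sub hp) fun x => by split_ifs <;> simp_all

theorem DefP.and {p q : X → Prop} (hp : DefP p) (hq : DefP q) : DefP fun x => p x ∧ q x :=
  .of_def (Def.mul hp hq) fun x => by split_ifs <;> simp_all

theorem DefP.or {p q : X → Prop} (hp : DefP p) (hq : DefP q) : DefP fun x => p x ∨ q x :=
  .of_def (Def.add hp hq) fun x => by split_ifs <;> simp_all

theorem DefP.imp {p q : X → Prop} (hp : DefP p) (hq : DefP q) : DefP fun x => p x → q x :=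
  (hp.not.or hq).congr fun _ => imp_iff_not_or

theorem DefP.iff {p q : X → Prop} (hp : DefP p) (hq : DefP q) : DefP fun x => p x ↔ q x :=
  ((hp.imp hq).and (hq.imp hp)).congr fun _ => iff_iff_implies_and_implies

theorem DefP.eq {f g : X → ℕ} (hf : Def f) (hg : Def g) : DefP fun x => f x = g x :=
  ((DefP.le hf hg).and (DefP.le hg hf)).congr fun _ => le_antisymm_iff

theorem DefP.ne {f g : X → ℕ} (hf : Def f) (hg : Def g) : DefP fun x => f x ≠ g x :=
  (DefP.eq hf hg).not

theorem Def.ite {p : X → Prop} {_ : ∀ x, Decidable (p x)} {f g : X → ℕ} (hp : DefP p) (hf : Def f)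
    (hg : Def g) : Def fun x => if p x then f x else g x := by
  have := (Def.mul hp hf).add (Def.mul hp.not hg)
  convert! this using 2 with x
  by_cases h : p x <;> simp [h]

theorem Def.count {b : X → ℕ} {p : X → ℕ → Prop} {dec : ∀ x i, Decidable (p x i)} (hb : Def b)
    (hp : DefP fun x : X × ℕ => p x.1 x.2) :
    Def fun x => ((Finset.range (b x)).filter (p x)).card := by
  have := hb.sum (f := fun x i => if p x i then 1 else 0) (Def.ite hp .one (.const 0))
  convert! this using 2 with x
  rw [Finset.card_filter]

theorem DefP.ex {b : X → ℕ} {p : X → ℕ → Prop} (hb : Def b)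
    (hp : DefP fun x : X × ℕ => p x.1 x.2) : DefP fun x => ∃ i < b x, p x i := by
  classical
  exact .of_def (Def.count (dec := fun _ _ => inferInstance) hb hp) fun x => by simp [Finset.filter_eq_empty_iff]

theorem DefP.all {b : X → ℕ} {p : X → ℕ → Prop} (hb : Def b)
    (hp : DefP fun x : X × ℕ => p x.1 x.2) : DefP fun x => ∀ i < b x, p x i :=
  (DefP.ex (p := fun x i => ¬ p x i) hb hp.not).not.congr fun x => by simp

/-- Strings whose length and whose symbols are definable. -/
def DefStr (s : X → List Γ') : Prop :=
  Def (fun x => (s x).length) ∧ ∀ a, DefP fun x : X × ℕ => (s x.1)[x.2]? = some a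

theorem DefStr.comp {s : Y → List Γ'} (hs : DefStr s) {φ : X → Y} (hφ : CtxMap φ) :
    DefStr fun x => s (φ x) :=
  ⟨hs.1.comp hφ, fun a => (hs.2 a).comp (φ := fun x : X × ℕ => (φ x.1, x.2))
    ((hφ.comp CtxMap.fst).pair Def.snd)⟩

theorem DefStr.inp : DefStr fun x : X => Ctx.inp x :=
  ⟨Def.length_inp, fun a => DefP.sym (X := X × ℕ) a Def.snd⟩

theorem DefStr.replicate (b : Γ') {f : X → ℕ} (hf : Def f) :
    DefStr fun x => List.replicate (f x) b := by
  refine ⟨by simpa using hf, fun a => ?_⟩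
  by_cases h : b = a
  · subst h
    exact (DefP.lt Def.snd hf.fst).congr fun x => by simp [List.getElem?_replicate]
  · exact (DefP.lt (Def.const 0) (Def.const 0)).congr fun x => by
      simp [List.getElem?_replicate, h]

theorem DefStr.append {s t : X → List Γ'} (hs : DefStr s) (ht : DefStr t) :
    DefStr fun x => s x ++ t x := by
  refine ⟨by simpa using hs.1.add ht.1, fun a => ?_⟩
  have h : DefP fun x : X × ℕ => (t x.1)[x.2 - (s x.1).length]? = some a :=
    (ht.2 a).comp (φ := fun x : X × ℕ => (x.1, x.2 - (s x.1).length))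
      (CtxMap.fst.pair (Def.snd.sub hs.1.fst))
  refine (((DefP.lt Def.snd hs.1.fst).and (hs.2 a)).or ((DefP.le hs.1.fst Def.snd).and h)).congr
    fun x => ?_
  rcases lt_or_ge x.2 (s x.1).length with hx | hx
  · simp [hx, List.getElem?_append_left hx, not_le.2 hx]
  · simp [hx, List.getElem?_append_right hx, not_lt.2 hx]

theorem DefStr.const (l : List Γ') : DefStr fun _ : X => l := by
  induction l with
  | nil => simpa using DefStr.replicate (X := X) Γ'.blank (Def.const 0)
  | cons a l ih => simpa using (DefStr.replicate (X := X) a Def.one).append ih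

theorem length_flatMap_range (s : ℕ → List Γ') (b : ℕ) :
    ((List.range b).flatMap s).length = ∑ j ∈ Finset.range b, (s j).length := by
  induction b with
  | zero => simp
  | succ b ih => rw [List.range_succ, List.flatMap_append, List.length_append, ih,
      Finset.sum_range_succ]; simp

/-- The block containing position `p` is found by its offset, the total length of the earlier
blocks. A successful lookup forces `p` to lie inside the block, so no upper bound has to be stated.
Offsets are bounded sums, which makes the right-hand side definable. -/
theorem getElem?_flatMap_range (s : ℕ → List Γ') (a : Γ') (b p : ℕ) :
    ((List.range b).flatMap s)[p]? = some a ↔ ∃ i < b,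
      ∑ j ∈ Finset.range i, (s j).length ≤ p ∧
        (s i)[p - ∑ j ∈ Finset.range i, (s j).length]? = some a := by
  induction b with
  | zero => simp
  | succ b ih =>
    rw [List.range_succ, List.flatMap_append, List.flatMap_singleton]
    rcases lt_or_ge p ((List.range b).flatMap s).length with hp | hp
    · rw [List.getElem?_append_left hp, ih]
      rw [length_flatMap_range] at hp
      constructor
      · rintro ⟨i, hi, h⟩
        exact ⟨i, by omega, h⟩
      · rintro ⟨i, hi, h⟩
        refine ⟨i, ?_, h⟩
        rcases Nat.lt_succ_iff_lt_or_eq.1 hi with hi | rfl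
        · exact hi
        · omega
    · rw [List.getElem?_append_right hp, length_flatMap_range]
      rw [length_flatMap_range] at hp
      constructor
      · intro h
        exact ⟨b, by omega, hp, h⟩
      · rintro ⟨i, hi, h, h'⟩
        rcases Nat.lt_succ_iff_lt_or_eq.1 hi with hi | rfl
        · have h1 := (List.getElem?_eq_some_iff.1 h').1
          have h2 : ∑ j ∈ Finset.range (i + 1), (s j).length ≤ ∑ j ∈ Finset.range b, (s j).length :=
            Finset.sum_le_sum_of_subset (Finset.range_subset_range.2 hi)
          rw [Finset.sum_range_succ] at h2
          omega
        · exact h'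

theorem DefStr.flatMap {b : X → ℕ} {s : X → ℕ → List Γ'} (hb : Def b)
    (hs : DefStr fun x : X × ℕ => s x.1 x.2) : DefStr fun x => (List.range (b x)).flatMap (s x) := by
  constructor
  · simpa only [length_flatMap_range] using hb.sum hs.1
  · intro a
    have hoff : Def fun x : (X × ℕ) × ℕ => ∑ j ∈ Finset.range x.2, (s x.1.1 j).length :=
      Def.snd.sum (Def.under (f := fun (x : X × ℕ) j => (s x.1 j).length)
        (Def.under (f := fun x j => (s x j).length) hs.1))
    refine (DefP.ex hb.fst (p := fun x i => ∑ j ∈ Finset.range i, (s x.1 j).length ≤ x.2 ∧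
      (s x.1 i)[x.2 - ∑ j ∈ Finset.range i, (s x.1 j).length]? = some a)
      ((DefP.le hoff Def.snd.fst).and ?_)).congr fun x => getElem?_flatMap_range _ _ _ _
    exact (hs.2 a).comp (φ := fun x : (X × ℕ) × ℕ =>
      ((x.1.1, x.2), x.1.2 - ∑ j ∈ Finset.range x.2, (s x.1.1 j).length))
      (CtxMap.under.pair (Def.snd.fst.sub hoff))

/-- A definable string only answers questions of the form "is this symbol `a`", so two symbols are
compared by asking for each of the six elements of `Γ'`. -/
theorem DefP.str_eq {s t : X → List Γ'} (hs : DefStr s) (ht : DefStr t) :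
    DefP fun x => s x = t x := by
  have h : DefP fun x => (s x).length = (t x).length ∧ ∀ i < (s x).length,
      (((s x)[i]? = some Γ'.blank ↔ (t x)[i]? = some Γ'.blank) ∧
      ((s x)[i]? = some Γ'.bra ↔ (t x)[i]? = some Γ'.bra) ∧
      ((s x)[i]? = some Γ'.ket ↔ (t x)[i]? = some Γ'.ket) ∧
      ((s x)[i]? = some Γ'.comma ↔ (t x)[i]? = some Γ'.comma) ∧
      ((s x)[i]? = some (Γ'.bit true) ↔ (t x)[i]? = some (Γ'.bit true)) ∧
      ((s x)[i]? = some (Γ'.bit false) ↔ (t x)[i]? = some (Γ'.bit false))) :=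
    (DefP.eq hs.1 ht.1).and (DefP.all hs.1
      (((hs.2 _).iff (ht.2 _)).and (((hs.2 _).iff (ht.2 _)).and (((hs.2 _).iff (ht.2 _)).and
        (((hs.2 _).iff (ht.2 _)).and (((hs.2 _).iff (ht.2 _)).and ((hs.2 _).iff (ht.2 _))))))))
  refine h.congr fun x => ⟨fun h => by simp [h], fun ⟨h1, h2⟩ => List.ext_getElem h1 fun i hi hi' => ?_⟩
  have h3 := h2 i hi
  simp only [List.getElem?_eq_getElem hi, List.getElem?_eq_getElem hi', Option.some.injEq] at h3
  generalize (s x)[i] = a at h3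
  generalize (t x)[i] = b at h3
  rcases a with _ | (_ | _) | _ | _ | _ <;> simp_all

/-- Languages with a definable membership predicate are in `P`. -/
theorem DefP.inP {L : Language Γ'} (h : DefP fun w : List Γ' => w ∈ L) : InP L :=
  let ⟨e, he⟩ := h
  Expr.inP e (fun w hw => (he w).trans (by simp [hw])) (fun w hw => (he w).trans (by simp [hw]))

end PossibleManipulators

namespace PossibleManipulators

/-! ### The Bucklin winner -/

section Winner

variable {m n : ℕ}

theorem topCount_mono (V : Profile m n) (c : Fin m) {l l' : ℕ} (h : l ≤ l') :
    topCount V c l ≤ topCount V c l' :=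
  Finset.card_le_card fun i hi => by
    simp only [Finset.mem_filter, Finset.mem_univ, true_and] at hi ⊢
    omega

theorem topCount_zero (V : Profile m n) (c : Fin m) : topCount V c 0 = 0 := by
  simp [topCount]

theorem topCount_card (V : Profile m n) (c : Fin m) : topCount V c m = n := by
  simp [topCount]

/-- The count is monotone in `l` and reaches `n` at `l = m`. So the infimum is over a nonempty
upward closed set and is attained. -/
theorem bucklinScore_le_iff (V : Profile m n) (c : Fin m) (l : ℕ) :
    bucklinScore V c ≤ l ↔ n ≤ 2 * topCount V c l := by
  constructor
  · intro h
    have hne : {l : ℕ | n ≤ 2 * topCount V c l}.Nonempty :=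
      ⟨m, by simp only [Set.mem_ofPred_eq, topCount_card]; omega⟩
    have h1 : n ≤ 2 * topCount V c (bucklinScore V c) := Nat.sInf_mem hne
    have h2 := topCount_mono V c h
    omega
  · exact fun h => Nat.sInf_le h

theorem bucklin_eq_iff_mem [NeZero m] (t : Preference m) (V : Profile m n) (y : Fin m) :
    bucklin m n t V = y ↔
      y ∈ bucklinWinners V ∧ ∀ d ∈ bucklinWinners V, ¬ t.Prefers d y := by
  unfold bucklin lexTieBreak Preference.Prefers
  set S := (bucklinWinners V).image t.symm with hS
  have hne : S.Nonempty := (bucklinWinners_nonempty V).image _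
  constructor
  · rintro rfl
    obtain ⟨c, hc, hc'⟩ := Finset.mem_image.1 (S.min'_mem hne)
    refine ⟨by rwa [← hc', Equiv.apply_symm_apply], fun d hd => ?_⟩
    rw [Equiv.symm_apply_apply, not_lt]
    exact S.min'_le _ (Finset.mem_image_of_mem _ hd)
  · rintro ⟨hy, hd⟩
    rw [← Equiv.eq_symm_apply]
    refine le_antisymm (S.min'_le _ (Finset.mem_image_of_mem _ hy)) (S.le_min' _ _ fun c hc => ?_)
    obtain ⟨d, hd', rfl⟩ := Finset.mem_image.1 hc
    exact not_lt.1 (hd d hd')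

/-- A candidate wins if and only if some length of the top segment witnesses it. -/
theorem bucklin_eq_iff [NeZero m] (hn : 0 < n) (t : Preference m) (V : Profile m n) (y : Fin m) :
    bucklin m n t V = y ↔ ∃ l < m, n ≤ 2 * topCount V y (l + 1) ∧
      ∀ d, d ≠ y → 2 * topCount V d l < n ∧ (t.Prefers d y → 2 * topCount V d (l + 1) < n) := by
  rw [bucklin_eq_iff_mem]
  simp only [bucklinWinners, Finset.mem_filter, Finset.mem_univ, true_and]
  constructor
  · rintro ⟨hy, ht⟩
    have hm : bucklinScore V y ≤ m := (bucklinScore_le_iff V y m).2 (by rw [topCount_card]; omega)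
    have h0 : ¬ bucklinScore V y ≤ 0 := by
      rw [bucklinScore_le_iff, topCount_zero]; omega
    -- The score is positive because there is a voter and no candidate is in a top segment of length
    -- `0`; the witness is the score minus one.
    obtain ⟨l, hl⟩ : ∃ l, bucklinScore V y = l + 1 := ⟨bucklinScore V y - 1, by omega⟩
    refine ⟨l, by omega, (bucklinScore_le_iff V y _).1 hl.le, fun d hd => ⟨?_, fun hdy => ?_⟩⟩
    · by_contra h
      have := (bucklinScore_le_iff V d l).2 (by omega)
      have := hy d
      omega
    · by_contra h
      have := (bucklinScore_le_iff V d (l + 1)).2 (by omega)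
      exact ht d (fun e => by have := hy e; omega) hdy
  · rintro ⟨l, hl, hy, hd⟩
    have hy' := (bucklinScore_le_iff V y _).2 hy
    refine ⟨fun d => ?_, fun d hdw hdy => ?_⟩
    · by_cases hdy : d = y
      · rw [hdy]
      · have h1 : ¬ bucklinScore V d ≤ l := by
          rw [bucklinScore_le_iff]; have := (hd d hdy).1; omega
        omega
    · have hne : d ≠ y := fun h => by subst h; exact lt_irrefl _ hdy
      have h1 : ¬ bucklinScore V d ≤ l + 1 := by
        rw [bucklinScore_le_iff]; have := (hd d hne).2 hdy; omega
      have := hdw y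
      omega

end Winner

/-! ### Dealing candidates to voters -/

section Deal

variable {ι J : Type*}

/-- A discrete intermediate value property. Greedily, the new index takes as much as possible while
leaving the others the sum of their lower bounds. -/
theorem exists_sum_eq (s : Finset ι) (lo hi : ι → ℕ) (h : ∀ i ∈ s, lo i ≤ hi i) :
    ∀ U : ℕ, ∑ i ∈ s, lo i ≤ U → U ≤ ∑ i ∈ s, hi i →
    ∃ u : ι → ℕ, (∀ i ∈ s, lo i ≤ u i ∧ u i ≤ hi i) ∧ ∑ i ∈ s, u i = U := by
  classical
  induction s using Finset.induction_on with
  | empty => intro U _ h2; exact ⟨lo, by simp, by simp at h2 ⊢; omega⟩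
  | insert a s ha ih =>
    intro U h1 h2
    rw [Finset.sum_insert ha] at h1 h2
    have hs : ∑ i ∈ s, lo i ≤ ∑ i ∈ s, hi i :=
      Finset.sum_le_sum fun i hi => h i (Finset.mem_insert_of_mem hi)
    have hla := h a (Finset.mem_insert_self a s)
    obtain ⟨u, hu, hsum⟩ := ih (fun i hi => h i (Finset.mem_insert_of_mem hi))
      (U - min (hi a) (U - ∑ i ∈ s, lo i)) (by omega) (by omega)
    refine ⟨Function.update u a (min (hi a) (U - ∑ i ∈ s, lo i)), fun i hi => ?_, ?_⟩
    · rcases Finset.mem_insert.1 hi with rfl | hi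
      · simp only [Function.update_self]; omega
      · rw [Function.update_of_ne (ne_of_mem_of_not_mem hi ha)]
        exact hu i hi
    · rw [Finset.sum_insert ha, Function.update_self, Finset.sum_congr rfl fun i hi =>
        Function.update_of_ne (ne_of_mem_of_not_mem hi ha) _ u, hsum]
      omega

/-- Capacities `c` suffice for two demands `U` and `V` if they suffice for each of them and for
both together, where at most `p i` (respectively `q i`) units of `i` can be used. -/
def Suffices (s : Finset ι) (c p q : ι → ℕ) (U V : ℕ) : Prop :=
  U ≤ ∑ i ∈ s, min (c i) (p i) ∧ V ≤ ∑ i ∈ s, min (c i) (q i) ∧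
    U + V ≤ ∑ i ∈ s, min (c i) (p i + q i)

theorem Suffices.of_exists {s : Finset ι} {c p q u v : ι → ℕ} {U V : ℕ}
    (h : ∀ i ∈ s, u i ≤ p i ∧ v i ≤ q i ∧ u i + v i ≤ c i) (hU : U ≤ ∑ i ∈ s, u i)
    (hV : V ≤ ∑ i ∈ s, v i) : Suffices s c p q U V := by
  refine ⟨hU.trans (Finset.sum_le_sum fun i hi => ?_), hV.trans (Finset.sum_le_sum fun i hi => ?_),
    (add_le_add hU hV).trans ?_⟩
  · have := h i hi; omega
  · have := h i hi; omega
  · rw [← Finset.sum_add_distrib]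
    refine Finset.sum_le_sum fun i hi => ?_
    have := h i hi; omega

/-- Once `u` is chosen, the second demand can be met if it is at most the sum of `min (c - u) q`.
Since `u + min (c - u) q = min c (u + q)`, raising `u` costs the second demand nothing up to `min c
(p + q) - q`; above this value, the total already reaches `min c (p + q)`. So it is enough to place
`u` uniformly on one side of this value, depending on the size of `U`. -/
theorem Suffices.exists {s : Finset ι} {c p q : ι → ℕ} {U V : ℕ} (h : Suffices s c p q U V) :
    ∃ u v : ι → ℕ, (∀ i ∈ s, u i ≤ p i ∧ v i ≤ q i ∧ u i + v i ≤ c i) ∧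
      ∑ i ∈ s, u i = U ∧ ∑ i ∈ s, v i = V := by
  obtain ⟨hU, hV, hUV⟩ := h
  suffices H : ∃ u : ι → ℕ, (∀ i ∈ s, u i ≤ min (c i) (p i)) ∧ ∑ i ∈ s, u i = U ∧
      V ≤ ∑ i ∈ s, min (c i - u i) (q i) by
    obtain ⟨u, hu, hsum, hV'⟩ := H
    obtain ⟨v, hv, hvsum⟩ := exists_sum_eq s (fun _ => 0) (fun i => min (c i - u i) (q i))
      (fun _ _ => Nat.zero_le _) V (by simp) hV'
    refine ⟨u, v, fun i hi => ?_, hsum, hvsum⟩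
    have := hu i hi
    have := hv i hi
    omega
  rcases le_or_gt (∑ i ∈ s, (min (c i) (p i + q i) - q i)) U with hlo | hlo
  · obtain ⟨u, hu, hsum⟩ := exists_sum_eq s (fun i => min (c i) (p i + q i) - q i)
      (fun i => min (c i) (p i)) (fun i _ => by omega) U hlo hU
    refine ⟨u, fun i hi => (hu i hi).2, hsum, ?_⟩
    have : ∑ i ∈ s, min (c i) (p i + q i) ≤ ∑ i ∈ s, u i + ∑ i ∈ s, min (c i - u i) (q i) := by
      rw [← Finset.sum_add_distrib]
      refine Finset.sum_le_sum fun i hi => ?_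
      have := hu i hi
      omega
    omega
  -- Here `U` fits below the critical values, so `min (c - u) q` is as large as `min c q`, and the
  -- second inequality alone provides for `V`.
  · obtain ⟨u, hu, hsum⟩ := exists_sum_eq s (fun _ => 0) (fun i => min (c i) (p i + q i) - q i)
      (fun i _ => Nat.zero_le _) U (by simp) hlo.le
    refine ⟨u, fun i hi => ?_, hsum, hV.trans (Finset.sum_le_sum fun i hi => ?_)⟩
    · have := hu i hi; omega
    · have := hu i hi; omega

/-- The sizes of the sets `A j` for `j ∈ P` differ by at most one. -/
def Balanced (P : Finset J) (A : J → Finset ι) : Prop :=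
  ∀ i ∈ P, ∀ j ∈ P, (A i).card ≤ (A j).card + 1

/-- Averaging: one set with fewer than `a` elements would keep all the others at `a` or less, making
the total too small. -/
theorem Balanced.le_card {P : Finset J} {A : J → Finset ι} (h : Balanced P A) {a : ℕ}
    (hs : P.card * a ≤ ∑ j ∈ P, (A j).card) : ∀ j ∈ P, a ≤ (A j).card := by
  intro j hj
  by_contra hlt
  have : ∑ i ∈ P, (A i).card < ∑ i ∈ P, a :=
    Finset.sum_lt_sum (fun i hi => by have := h i hi j hj; omega) ⟨j, hj, by omega⟩
  rw [Finset.sum_const, smul_eq_mul] at this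
  omega

theorem Balanced.card_le {P : Finset J} {A : J → Finset ι} (h : Balanced P A) {b : ℕ}
    (hs : ∑ j ∈ P, (A j).card ≤ P.card * b) : ∀ j ∈ P, (A j).card ≤ b := by
  intro j hj
  by_contra hlt
  have : ∑ i ∈ P, b < ∑ i ∈ P, (A i).card :=
    Finset.sum_lt_sum (fun i hi => by have := h j hj i hi; omega) ⟨j, hj, by omega⟩
  rw [Finset.sum_const, smul_eq_mul] at this
  omega

theorem sum_card_eq_sum_degree [DecidableEq ι] (P : Finset J) (S : Finset ι) (A : J → Finset ι)
    (h : ∀ j ∈ P, A j ⊆ S) :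
    ∑ j ∈ P, (A j).card = ∑ d ∈ S, (P.filter fun j => d ∈ A j).card := by
  have := Finset.sum_card_bipartiteAbove_eq_sum_card_bipartiteBelow (s := P) (t := S)
    (fun j d => d ∈ A j)
  simp only [Finset.bipartiteAbove, Finset.bipartiteBelow] at this
  rw [← this]
  refine Finset.sum_congr rfl fun j hj => ?_
  rw [Finset.filter_mem_eq_inter, Finset.inter_eq_right.2 (h j hj)]

/-- The new element goes to sets of minimal size first, and to larger ones only when all minimal
sets have received it; neither case creates a gap of two. -/
theorem Balanced.insert [DecidableEq ι] [DecidableEq J] {P : Finset J} {S : Finset ι} {A : J → Finset ι} (h : Balanced P A)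
    (hA : ∀ j ∈ P, A j ⊆ S) {d : ι} (hd : d ∉ S) {u : ℕ} (hu : u ≤ P.card) :
    ∃ B ⊆ P, B.card = u ∧ Balanced P fun j => if j ∈ B then Insert.insert d (A j) else A j := by
  rcases P.eq_empty_or_nonempty with rfl | hP
  · exact ⟨∅, by simp, by simp at hu ⊢; omega, fun i hi => by simp at hi⟩
  obtain ⟨j₀, hj₀, hmin⟩ := Finset.exists_min_image P (fun j => (A j).card) hP
  have hcard : ∀ j ∈ P, (Insert.insert d (A j)).card = (A j).card + 1 := fun j hj =>
    Finset.card_insert_of_notMem fun h => hd (hA j hj h)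
  have hle : ∀ j ∈ P, (A j).card ≤ (A j₀).card + 1 := fun j hj => h j hj j₀ hj₀
  set L := P.filter fun j => (A j).card = (A j₀).card with hL
  rcases le_total u L.card with hu' | hu'
  · obtain ⟨B, hB, hBu⟩ := Finset.exists_subset_card_eq hu'
    refine ⟨B, hB.trans (Finset.filter_subset _ _), hBu, fun i hi j hj => ?_⟩
    have h1 := hmin i hi
    have h2 := hmin j hj
    have h3 := hle i hi
    have h4 := hle j hj
    have h5 : i ∈ B → (A i).card = (A j₀).card := fun h => (Finset.mem_filter.1 (hB h)).2
    dsimp only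
    split_ifs with hi' hj' hj' <;> (try simp only [hcard i hi, hcard j hj]) <;>
      first | omega | (have := h5 hi'; omega)
  · obtain ⟨B, hLB, hB, hBu⟩ := Finset.exists_subsuperset_card_eq (Finset.filter_subset _ _) hu' hu
    refine ⟨B, hB, hBu, fun i hi j hj => ?_⟩
    have h1 := hmin i hi
    have h2 := hmin j hj
    have h3 := hle i hi
    have h4 := hle j hj
    have h5 : j ∉ B → (A j).card ≠ (A j₀).card := fun h h' =>
      h (hLB (Finset.mem_filter.2 ⟨hj, h'⟩))
    dsimp only
    split_ifs with hi' hj' hj' <;> (try simp only [hcard i hi, hcard j hj]) <;>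
      first | omega | (have := h5 hj'; omega)

/-- Later elements are dealt without touching the earlier deal. This is what allows balance to hold
for a subset and for the whole at the same time. -/
theorem Balanced.extend [DecidableEq ι] {P : Finset J} {S : Finset ι} {A : J → Finset ι} (h : Balanced P A)
    (hA : ∀ j ∈ P, A j ⊆ S) (u : ι → ℕ) (T : Finset ι) (hST : Disjoint S T)
    (hu : ∀ d ∈ T, u d ≤ P.card) : ∃ B : J → Finset ι, Balanced P B ∧ (∀ j ∈ P, B j ⊆ S ∪ T) ∧
      (∀ j ∈ P, B j ∩ S = A j) ∧ ∀ d ∈ T, (P.filter fun j => d ∈ B j).card = u d := by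
  classical
  induction T using Finset.induction_on with
  | empty =>
    exact ⟨A, h, by simpa using hA, fun j hj => Finset.inter_eq_left.2 (hA j hj), by simp⟩
  | insert a T ha ih =>
    rw [Finset.disjoint_insert_right] at hST
    obtain ⟨B, hB, hBS, hBA, hBu⟩ := ih hST.2 fun d hd => hu d (Finset.mem_insert_of_mem hd)
    have haS : a ∉ S ∪ T := by simp [hST.1, ha]
    obtain ⟨C, hCP, hCu, hC⟩ := hB.insert hBS haS (hu a (Finset.mem_insert_self a T))
    refine ⟨_, hC, fun j hj => ?_, fun j hj => ?_, fun d hd => ?_⟩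
    · have := hBS j hj
      split_ifs
      · rw [Finset.union_insert]
        exact Finset.insert_subset_insert _ this
      · exact this.trans (Finset.union_subset_union_right (Finset.subset_insert _ _))
    · rw [← hBA j hj]
      split_ifs
      · rw [Finset.insert_inter_of_notMem hST.1]
      · rfl
    · rcases Finset.mem_insert.1 hd with rfl | hd
      · rw [← hCu]
        congr 1
        ext j
        simp only [Finset.mem_filter]
        constructor
        · rintro ⟨hj, hj'⟩
          by_contra hjC
          rw [if_neg hjC] at hj'
          exact haS (hBS j hj hj')
        · intro hj
          exact ⟨hCP hj, by simp [hj]⟩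
      · rw [← hBu d hd]
        congr 1
        ext j
        simp only [Finset.mem_filter]
        refine and_congr_right fun _ => ?_
        split_ifs
        · rw [Finset.mem_insert, or_iff_right (ne_of_mem_of_not_mem hd ha)]
        · rfl

/-- Balanced dealing: every `d ∈ S` is dealt to exactly `u d` members of `P`, such that the numbers
of elements of `S` and of `W` received by the members of `P` are balanced. -/
theorem exists_balanced [DecidableEq ι] (P : Finset J) {W S : Finset ι} (hWS : W ⊆ S) (u : ι → ℕ)
    (hu : ∀ d ∈ S, u d ≤ P.card) : ∃ A : J → Finset ι, Balanced P A ∧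
      (Balanced P fun j => A j ∩ W) ∧ (∀ j ∈ P, A j ⊆ S) ∧
      ∀ d ∈ S, (P.filter fun j => d ∈ A j).card = u d := by
  -- The elements of `W` are dealt first, which balances the traces on `W`; the elements of `S \ W`
  -- then continue from there.
  obtain ⟨A, hA, hAS, -, hAu⟩ := Balanced.extend (P := P) (S := ∅) (A := fun _ => ∅)
    (fun i _ j _ => by simp) (by simp) u W (by simp) fun d hd => hu d (hWS hd)
  simp only [Finset.empty_union] at hAS
  obtain ⟨B, hB, hBS, hBA, hBu⟩ := hA.extend hAS u (S \ W) Finset.disjoint_sdiff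
    fun d hd => hu d (Finset.mem_sdiff.1 hd).1
  rw [Finset.union_sdiff_of_subset hWS] at hBS
  refine ⟨B, hB, fun i hi j hj => ?_, hBS, fun d hd => ?_⟩
  · simp only [hBA i hi, hBA j hj]
    exact hA i hi j hj
  · by_cases hdW : d ∈ W
    · rw [← hAu d hdW]
      congr 1
      ext j
      simp only [Finset.mem_filter]
      refine and_congr_right fun hj => ?_
      rw [← hBA j hj]
      simp [hdW]
    · exact hBu d (Finset.mem_sdiff.2 ⟨hd, hdW⟩)

/-- Every member `j` of `P` receives a set `T j` of at least `s` elements of `S`, and a subset `A j`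
of at least `s - 1` elements; an element `d` of `W` is contained in at most `u d` of the sets `A j`,
and every other element `d` in at most `u d` of the sets `T j`. -/
theorem exists_deal [DecidableEq ι] (P : Finset J) {W S : Finset ι} (hWS : W ⊆ S) (u : ι → ℕ) (s U : ℕ)
    (hu : ∀ d ∈ S, u d ≤ P.card) (hU : U ≤ P.card * s) (hUW : U ≤ P.card * W.card)
    (hW : ∑ d ∈ W, u d = U - P.card) (hS : ∑ d ∈ S \ W, u d = P.card * s - U) :
    ∃ A T : J → Finset ι, (∀ j ∈ P, A j ⊆ T j ∧ T j ⊆ S ∧ s ≤ (A j).card + 1 ∧ s ≤ (T j).card) ∧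
      (∀ d ∈ W, (P.filter fun j => d ∈ A j).card ≤ u d) ∧
      ∀ d ∈ S \ W, (P.filter fun j => d ∈ T j).card ≤ u d := by
  rcases Nat.eq_zero_or_pos s with rfl | hs
  · exact ⟨fun _ => ∅, fun _ => ∅, by simp, by simp, by simp⟩
  obtain ⟨A, hA, hAW, hAS, hAu⟩ := exists_balanced P hWS u hu
  -- This total is at least `P.card * (s - 1)` whether or not `U` exceeds `P.card`, so balance gives
  -- every member at least `s - 1` elements.
  have hsum : ∑ j ∈ P, (A j).card = P.card * s - U + (U - P.card) := by
    rw [sum_card_eq_sum_degree P S A hAS, Finset.sum_congr rfl hAu, ← Finset.sum_sdiff hWS, hS, hW]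
  -- With no element of `W` available for the free place, `U = 0` and the total is the full `P.card
  -- * s`, so `A` itself is large enough.
  rcases W.eq_empty_or_nonempty with rfl | hne
  · refine ⟨A, A, fun j hj => ?_, by simp, fun d hd => (hAu d (Finset.mem_sdiff.1 hd).1).le⟩
    simp only [Finset.card_empty, mul_zero, Nat.le_zero] at hUW
    have := hA.le_card (a := s) (by omega) j hj
    exact ⟨subset_rfl, hAS j hj, by omega, this⟩
  · have hWpos := hne.card_pos
    have e1 : P.card * (s - 1) = P.card * s - P.card := by rw [Nat.mul_sub, mul_one]
    have e2 : P.card * (W.card - 1) = P.card * W.card - P.card := by rw [Nat.mul_sub, mul_one]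
    -- All of `W` may be added to `A j`, since elements of `W` are only counted in `A`. Balance on
    -- `W` and `U ≤ P.card * W.card` ensure that `A j` misses some element of `W`, so the union
    -- really is larger.
    refine ⟨A, fun j => A j ∪ W, fun j hj => ?_, fun d hd => (hAu d (hWS hd)).le, fun d hd => ?_⟩
    · have h1 := hA.le_card (a := s - 1) (by omega) j hj
      have h2 : (A j ∩ W).card ≤ W.card - 1 := hAW.card_le (b := W.card - 1) (by
        rw [sum_card_eq_sum_degree P W _ (fun j _ => Finset.inter_subset_right),
          Finset.sum_congr rfl fun d hd => show _ = u d by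
            rw [← hAu d (hWS hd)]; simp [hd]]
        change ∑ d ∈ W, u d ≤ _
        omega) j hj
      have h3 := Finset.card_union_add_card_inter (A j) W
      exact ⟨Finset.subset_union_left, Finset.union_subset (hAS j hj) hWS, by omega,
        show s ≤ (A j ∪ W).card by omega⟩
    · rw [Finset.mem_sdiff] at hd
      rw [← hAu d hd.1]
      simp [hd.2]

end Deal

/-! ### Votes with prescribed top segments -/

section Vote

variable {m : ℕ}

/-- Votes are produced by sorting the candidates by a priority: `Tuple.sort f` maps positions to
candidates such that `f` is monotone along the positions. Ties within a priority class are
irrelevant. -/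
theorem sort_prefers {f : Fin m → ℕ} {a b : Fin m} (h : f a < f b) :
    Preference.Prefers (Tuple.sort f) a b := by
  by_contra hlt
  have := Tuple.monotone_sort f (not_lt.1 hlt)
  simp only [Function.comp, Equiv.apply_symm_apply] at this
  omega

/-- Otherwise all of the at least `s` candidates of priority at most `k` would precede `d`. -/
theorem le_of_sort_symm_lt {f : Fin m → ℕ} {d : Fin m} {s k : ℕ}
    (hs : s ≤ (Finset.univ.filter fun c => f c ≤ k).card) (hd : ((Tuple.sort f).symm d : ℕ) < s) :
    f d ≤ k := by
  by_contra hlt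
  have : (Finset.univ.filter fun c => f c ≤ k).card ≤
      (Finset.Iio ((Tuple.sort f).symm d)).card := by
    refine Finset.card_le_card_of_injOn (Tuple.sort f).symm (fun c hc => ?_)
      (Tuple.sort f).symm.injective.injOn
    have hc : f c ≤ k := by simpa using hc
    have := sort_prefers (show f c < f d by omega)
    simpa [Preference.Prefers] using this
  rw [Fin.card_Iio] at this
  omega

theorem sort_symm_lt {f : Fin m → ℕ} {d : Fin m} {s : ℕ}
    (hs : (Finset.univ.filter fun c => f c ≤ f d).card ≤ s) : ((Tuple.sort f).symm d : ℕ) < s := by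
  have : (Finset.Iic ((Tuple.sort f).symm d)).card ≤
      (Finset.univ.filter fun c => f c ≤ f d).card := by
    refine Finset.card_le_card_of_injOn (Tuple.sort f) (fun c hc => ?_)
      (Tuple.sort f).injective.injOn
    have := Tuple.monotone_sort f (show c ≤ (Tuple.sort f).symm d by simpa using hc)
    simpa using this
  rw [Fin.card_Iic] at this
  omega

/-- A vote that ranks `x` above `y`, with `y` at the bottom. -/
theorem exists_vote_bot {x y : Fin m} (hxy : x ≠ y) {A T : Finset (Fin m)} {l : ℕ} (hAT : A ⊆ T)
    (hy : y ∉ T) (hA : l ≤ A.card) (hT : l + 1 ≤ T.card) :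
    ∃ p : Preference m, p.Prefers x y ∧ ∀ d, d ≠ y →
      ((p.symm d : ℕ) < l → d ∈ A) ∧ ((p.symm d : ℕ) < l + 1 → d ∈ T) := by
  set f : Fin m → ℕ := fun d => if d = y then 3 else if d ∈ A then 0 else if d ∈ T then 1 else 2
    with hf
  have hyA : y ∉ A := fun h => hy (hAT h)
  refine ⟨Tuple.sort f, sort_prefers ?_, fun d hd => ⟨fun h => ?_, fun h => ?_⟩⟩
  · simp only [hf, hxy, if_true, if_false]; split_ifs <;> omega
  · have h1 := le_of_sort_symm_lt (f := f) (k := 0) (hA.trans (Finset.card_le_card fun c hc => by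
      have : c ≠ y := fun h => hyA (h ▸ hc)
      simp [hf, hc, this])) h
    by_contra hdA
    simp only [hf, hd, hdA, if_false] at h1
    split_ifs at h1 <;> omega
  · have h1 := le_of_sort_symm_lt (f := f) (k := 1) (hT.trans (Finset.card_le_card fun c hc => by
      have : c ≠ y := fun h => hy (h ▸ hc)
      simp only [hf, this, hc, if_false, if_true, Finset.mem_filter, Finset.mem_univ, true_and]
      split_ifs <;> omega)) h
    by_contra hdT
    have hdA : d ∉ A := fun h => hdT (hAT h)
    simp only [hf, hd, hdA, hdT, if_false] at h1
    omega

/-- A vote that ranks `x` first and `y` second. -/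
theorem exists_vote_top {x y : Fin m} (hxy : x ≠ y) {A T : Finset (Fin m)} {l : ℕ} (hAT : A ⊆ T)
    (hx : x ∉ T) (hy : y ∉ T) (hl : 0 < l) (hA : l ≤ A.card + 2) (hT : l ≤ T.card + 1) :
    ∃ p : Preference m, p.Prefers x y ∧ (p.symm y : ℕ) < l + 1 ∧ ∀ d, d ≠ y → d ≠ x →
      ((p.symm d : ℕ) < l → d ∈ A) ∧ ((p.symm d : ℕ) < l + 1 → d ∈ T) := by
  set f : Fin m → ℕ := fun d => if d = x then 0 else if d = y then 1 else if d ∈ A then 2 else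
    if d ∈ T then 3 else 4 with hf
  have hfx : f x = 0 := by simp [hf]
  have hfy : f y = 1 := by simp [hf, hxy.symm]
  have hins : ∀ B : Finset (Fin m), x ∉ B → y ∉ B → (insert x (insert y B)).card = B.card + 2 := by
    intro B h1 h2
    rw [Finset.card_insert_of_notMem (by simp [h1, hxy]), Finset.card_insert_of_notMem h2]
  refine ⟨Tuple.sort f, sort_prefers (by omega), sort_symm_lt ?_, fun d hd hdx =>
    ⟨fun h => ?_, fun h => ?_⟩⟩
  · calc _ ≤ ({x, y} : Finset (Fin m)).card := Finset.card_le_card fun c hc => by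
          simp only [hfy, Finset.mem_filter, Finset.mem_univ, true_and] at hc
          simp only [Finset.mem_insert, Finset.mem_singleton]
          by_contra h
          rw [not_or] at h
          simp only [hf, h.1, h.2, if_false] at hc
          split_ifs at hc <;> omega
      _ ≤ 2 := Finset.card_le_two
      _ ≤ l + 1 := by omega
  · have hxA : x ∉ A := fun h => hx (hAT h)
    have hyA : y ∉ A := fun h => hy (hAT h)
    have h1 := le_of_sort_symm_lt (f := f) (k := 2) (s := l) ((show l ≤ _ by
      rw [← hins A hxA hyA] at hA; exact hA).trans (Finset.card_le_card fun c hc => by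
        simp only [Finset.mem_filter, Finset.mem_univ, true_and]
        rcases Finset.mem_insert.1 hc with rfl | hc
        · omega
        rcases Finset.mem_insert.1 hc with rfl | hc
        · omega
        simp only [hf, hc, if_true]; split_ifs <;> omega)) h
    by_contra hdA
    simp only [hf, hd, hdx, hdA, if_false] at h1
    split_ifs at h1 <;> omega
  · have h1 := le_of_sort_symm_lt (f := f) (k := 3) (s := l + 1) ((show l + 1 ≤ (insert x (insert y T)).card by
      have := hins T hx hy; omega).trans (Finset.card_le_card fun c hc => by
        simp only [Finset.mem_filter, Finset.mem_univ, true_and]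
        rcases Finset.mem_insert.1 hc with rfl | hc
        · omega
        rcases Finset.mem_insert.1 hc with rfl | hc
        · omega
        simp only [hf, hc, if_true]; split_ifs <;> omega)) h
    by_contra hdT
    have hdA : d ∉ A := fun h => hdT (hAT h)
    simp only [hf, hd, hdx, hdA, hdT, if_false] at h1
    omega

end Vote

end PossibleManipulators

namespace PossibleManipulators

/-! ### The numerical criterion -/

section Criterion

variable {m n : ℕ}

/-- The number of voters outside of `M` that rank `c` in their top `l` positions. -/
def outCount (V : Profile m n) (M : Finset (Fin n)) (c : Fin m) (l : ℕ) : ℕ :=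
  (Finset.univ.filter fun i : Fin n => i ∉ M ∧ ((V i).symm c : ℕ) < l).card

theorem topCount_piecewise (V W : Profile m n) (M : Finset (Fin n)) (c : Fin m) (l : ℕ) :
    topCount (M.piecewise W V) c l =
      outCount V M c l + (M.filter fun j => ((W j).symm c : ℕ) < l).card := by
  unfold topCount outCount
  rw [← Finset.card_union_of_disjoint]
  · congr 1
    ext i
    by_cases hi : i ∈ M <;> simp [hi]
  · refine Finset.disjoint_left.2 fun i hi hi' => ?_
    simp only [Finset.mem_filter, Finset.mem_univ, true_and] at hi hi'
    exact hi.1 hi'.1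

instance (t : Preference m) (a b : Fin m) : Decidable (t.Prefers a b) :=
  inferInstanceAs (Decidable (t.symm a < t.symm b))

/-- If `y` wins with a top segment of length `l + 1`, then a candidate `d` may not be contained in
the top segments of this length of half of the voters. -/
def threshold (t : Preference m) (y : Fin m) (l : ℕ) (d : Fin m) : ℕ :=
  if t.Prefers d y then l + 1 else l

/-- The candidates which lose a tie against `y`. -/
def weakRivals (t : Preference m) (y : Fin m) : Finset (Fin m) :=
  Finset.univ.filter fun d => d ≠ y ∧ ¬ t.Prefers d y

/-- The candidates which win a tie against `y`. -/
def strongRivals (t : Preference m) (y : Fin m) : Finset (Fin m) :=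
  Finset.univ.filter fun d => t.Prefers d y

/-- The support of the candidate `d` caused by the voters outside of `M` and by `τ` manipulators
that rank `y`, and thus `x`, high. -/
def load (t : Preference m) (V : Profile m n) (M : Finset (Fin n)) (x y : Fin m) (l τ : ℕ)
    (d : Fin m) : ℕ :=
  outCount V M d (threshold t y l d) + if d = x then τ else 0

/-- The numerical criterion for the existence of a manipulation after which `y` wins with a top
segment of length `l + 1`, and `τ` manipulators have `y` in their top segment. The members of the
other `M.card - τ` top segments that are weak rivals number `U`, and the members of the `τ` top
segments that are weak rivals different from `x` number `U'`. -/
def Feasible (t : Preference m) (V : Profile m n) (M : Finset (Fin n)) (x y : Fin m)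
    (l τ U U' : ℕ) : Prop :=
  (l = 0 → τ = 0) ∧ n ≤ 2 * (outCount V M y (l + 1) + τ) ∧
  (∀ d, d ≠ y → load t V M x y l τ d ≤ (n - 1) / 2) ∧
  (U ≤ (M.card - τ) * (weakRivals t y).card ∧ U' ≤ τ * ((weakRivals t y).erase x).card) ∧
  Suffices (weakRivals t y) (fun d => (n - 1) / 2 - load t V M x y l τ d) (fun _ => M.card - τ)
    (fun d => if d = x then 0 else τ) (U - (M.card - τ)) (U' - τ) ∧
  Suffices (strongRivals t y) (fun d => (n - 1) / 2 - load t V M x y l τ d) (fun _ => M.card - τ)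
    (fun d => if d = x then 0 else τ) ((M.card - τ) * (l + 1) - U) (τ * (l - 1) - U')

theorem mem_weakRivals {t : Preference m} {y d : Fin m} :
    d ∈ weakRivals t y ↔ d ≠ y ∧ ¬ t.Prefers d y := by simp [weakRivals]

theorem mem_strongRivals {t : Preference m} {y d : Fin m} :
    d ∈ strongRivals t y ↔ t.Prefers d y := by simp [strongRivals]

theorem not_prefers_self (t : Preference m) (y : Fin m) : ¬ t.Prefers y y := lt_irrefl _

theorem card_top (p : Preference m) (s : ℕ) (hs : s ≤ m) :
    (Finset.univ.filter fun d => (p.symm d : ℕ) < s).card = s := by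
  have : (Finset.univ.filter fun d => (p.symm d : ℕ) < s) =
      (Finset.univ.filter fun i : Fin m => (i : ℕ) < s).map p.toEmbedding := by
    ext d
    simp only [Finset.mem_filter, Finset.mem_univ, true_and, Finset.mem_map_equiv]
  rw [this, Finset.card_map, Fin.card_filter_val_lt, min_eq_right hs]

theorem sum_card_filter_comm {α β : Type*} (P : Finset α) (S : Finset β) (r : α → β → Prop)
    [∀ a b, Decidable (r a b)] :
    ∑ d ∈ S, (P.filter fun j => r j d).card = ∑ j ∈ P, (S.filter fun d => r j d).card :=
  (Finset.sum_card_bipartiteAbove_eq_sum_card_bipartiteBelow r).symm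

/-- The parameters are read off from the given votes: `Q` consists of the manipulators with `y` in
the top `l + 1`, `P` of the others, and `U`, `U'` count the weak rivals in their segments. The
numbers of voters of `P` and `Q` that support a candidate are the required splitting. -/
theorem exists_feasible [NeZero m] (hn : 0 < n) (t : Preference m) (V W : Profile m n)
    (M : Finset (Fin n)) {x y : Fin m} (hxy : x ≠ y) (hW : ∀ j ∈ M, (W j).Prefers x y)
    (hwin : bucklin m n t (M.piecewise W V) = y) :
    ∃ l < m, ∃ τ ≤ M.card, ∃ U ≤ (M.card - τ) * (l + 1), ∃ U' ≤ τ * (l - 1),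
      Feasible t V M x y l τ U U' := by
  obtain ⟨l, hl, hy, hd⟩ := (bucklin_eq_iff hn t _ y).1 hwin
  set Q := M.filter fun j => ((W j).symm y : ℕ) < l + 1 with hQ
  set P := M.filter fun j => ¬ ((W j).symm y : ℕ) < l + 1 with hP
  have hcard : Q.card + P.card = M.card := Finset.card_filter_add_card_filter_not _
  have hP' : M.card - Q.card = P.card := by omega
  have hQM : Q ⊆ M := Finset.filter_subset _ _
  have hPM : P ⊆ M := Finset.filter_subset _ _
  -- Being strictly above `y`, the candidate `x` is even in the top `l`, so it is counted whether it
  -- is a weak or a strong rival.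
  have hxQ : ∀ j ∈ Q, ((W j).symm x : ℕ) < l := fun j hj => by
    have h1 : ((W j).symm x : ℕ) < (W j).symm y := hW j (hQM hj)
    have h2 := (Finset.mem_filter.1 hj).2
    omega
  let B : Fin n → Fin m → Prop := fun j d => ((W j).symm d : ℕ) < threshold t y l d
  have hthr : ∀ d, l ≤ threshold t y l d := fun d => by unfold threshold; split_ifs <;> omega
  -- the support of the rivals
  have hsupp : ∀ d, d ≠ y → outCount V M d (threshold t y l d) +
      ((P.filter fun j => B j d).card + (Q.filter fun j => B j d).card) ≤ (n - 1) / 2 := by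
    intro d hdy
    have h1 : 2 * topCount (M.piecewise W V) d (threshold t y l d) < n := by
      unfold threshold
      split_ifs with h
      · exact (hd d hdy).2 h
      · exact (hd d hdy).1
    rw [topCount_piecewise] at h1
    have h2 : (P.filter fun j => B j d).card + (Q.filter fun j => B j d).card =
        (M.filter fun j => B j d).card := by
      rw [hQ, hP, Finset.filter_filter, Finset.filter_filter, add_comm,
        ← Finset.card_filter_add_card_filter_not (s := M.filter fun j => B j d)
          (fun j => ((W j).symm y : ℕ) < l + 1), Finset.filter_filter, Finset.filter_filter]
      simp only [and_comm]
    rw [h2]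
    change _ + (M.filter fun j => ((W j).symm d : ℕ) < threshold t y l d).card ≤ _
    omega
  have hQx : (Q.filter fun j => B j x).card = Q.card := by
    rw [Finset.filter_true_of_mem fun j hj => (hxQ j hj).trans_le (hthr x)]
  -- The support that `x` gets from `Q` is already part of its load, so it is not counted a second
  -- time.
  have hload : ∀ d, d ≠ y → (P.filter fun j => B j d).card +
      (if d = x then 0 else (Q.filter fun j => B j d).card) + load t V M x y l Q.card d ≤
        (n - 1) / 2 := by
    intro d hdy
    have := hsupp d hdy
    unfold load
    split_ifs with h
    · subst h; omega
    · omega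
  have hsuff : ∀ (S : Finset (Fin m)) (u v : ℕ), y ∉ S →
      u ≤ ∑ j ∈ P, (S.filter fun d => B j d).card →
      v ≤ ∑ j ∈ Q, ((S.erase x).filter fun d => B j d).card →
      Suffices S (fun d => (n - 1) / 2 - load t V M x y l Q.card d) (fun _ => M.card - Q.card)
        (fun d => if d = x then 0 else Q.card) u v := by
    intro S u v hyS hu hv
    rw [hP']
    refine Suffices.of_exists (u := fun d => (P.filter fun j => B j d).card)
      (v := fun d => if d = x then 0 else (Q.filter fun j => B j d).card) (fun d hdS => ?_) ?_ ?_
    · have := hload d (fun h => hyS (h ▸ hdS))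
      refine ⟨Finset.card_filter_le _ _, ?_, ?_⟩
      · split_ifs
        · exact le_rfl
        · exact Finset.card_filter_le _ _
      · omega
    · rwa [sum_card_filter_comm]
    · rw [← sum_card_filter_comm] at hv
      refine hv.trans ?_
      calc ∑ d ∈ S.erase x, (Q.filter fun j => B j d).card
          = ∑ d ∈ S.erase x, (if d = x then 0 else (Q.filter fun j => B j d).card) :=
            Finset.sum_congr rfl fun d hd => by rw [if_neg (Finset.ne_of_mem_erase hd)]
        _ ≤ _ := Finset.sum_le_sum_of_subset (Finset.erase_subset _ _)
  -- the top segments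
  let T : Fin n → Finset (Fin m) := fun j => Finset.univ.filter fun d => ((W j).symm d : ℕ) < l + 1
  have hT : ∀ j, (T j).card = l + 1 := fun j => card_top (W j) (l + 1) (by omega)
  have hyW : y ∉ weakRivals t y := by simp [mem_weakRivals]
  have hyS : y ∉ strongRivals t y := by simp [mem_strongRivals, not_prefers_self]
  -- Only the candidate at position `l`, the last place of the segment, can be a weak rival that is
  -- not counted.
  have hweak : ∀ j, ∀ S ⊆ weakRivals t y, (T j ∩ S).card ≤ (S.filter fun d => B j d).card + 1 := by
    intro j S hS
    have h1 : T j ∩ S ⊆ insert ((W j) ⟨l, hl⟩) (S.filter fun d => B j d) := by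
      intro d hd
      simp only [T, Finset.mem_inter, Finset.mem_filter, Finset.mem_univ, true_and] at hd
      have h2 := mem_weakRivals.1 (hS hd.2)
      by_cases h : ((W j).symm d : ℕ) = l
      · refine Finset.mem_insert.2 (.inl ?_)
        rw [← Equiv.symm_apply_eq]
        exact Fin.ext h
      · refine Finset.mem_insert.2 (.inr (Finset.mem_filter.2 ⟨hd.2, ?_⟩))
        simp only [B, threshold, h2.2, if_false]
        omega
    exact (Finset.card_le_card h1).trans (Finset.card_insert_le _ _)
  have hstrong : ∀ j, ∀ S ⊆ strongRivals t y, T j ∩ S = S.filter fun d => B j d := by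
    intro j S hS
    ext d
    simp only [T, Finset.mem_inter, Finset.mem_filter, Finset.mem_univ, true_and, B]
    rw [and_comm]
    refine and_congr_right fun hd => ?_
    rw [threshold, if_pos (mem_strongRivals.1 (hS hd))]
  have hsplit : ∀ E : Finset (Fin m), y ∉ E →
      (E ∩ weakRivals t y).card + (E ∩ strongRivals t y).card = E.card := by
    intro E hE
    rw [← Finset.card_union_of_disjoint]
    · congr 1
      ext d
      simp only [Finset.mem_union, Finset.mem_inter, mem_weakRivals, mem_strongRivals]
      constructor
      · tauto
      · intro hd
        have : d ≠ y := fun h => hE (h ▸ hd)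
        tauto
    · refine Finset.disjoint_left.2 fun d h1 h2 => ?_
      exact (mem_weakRivals.1 (Finset.mem_inter.1 h1).2).2
        (mem_strongRivals.1 (Finset.mem_inter.1 h2).2)
  have hTP : ∀ j ∈ P, (T j ∩ weakRivals t y).card + (T j ∩ strongRivals t y).card = l + 1 := by
    intro j hj
    rw [hsplit, hT]
    have := (Finset.mem_filter.1 hj).2
    simpa [T] using this
  have hTQ : ∀ j ∈ Q, (T j ∩ (weakRivals t y).erase x).card +
      (T j ∩ (strongRivals t y).erase x).card = l - 1 := by
    intro j hj
    have hxT : x ∈ T j := by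
      have := hxQ j hj
      simp only [T, Finset.mem_filter, Finset.mem_univ, true_and]
      omega
    have hyT : y ∈ (T j).erase x := by
      have := (Finset.mem_filter.1 hj).2
      simpa [T, hxy.symm] using this
    have h1 := hsplit (((T j).erase x).erase y) (by simp)
    rw [Finset.card_erase_of_mem hyT, Finset.card_erase_of_mem hxT, hT] at h1
    rw [show l - 1 = l + 1 - 1 - 1 by omega, ← h1]
    congr 2
    · ext d
      simp only [Finset.mem_inter, Finset.mem_erase, mem_weakRivals]
      tauto
    · ext d
      have : t.Prefers d y → d ≠ y := fun h h' => by subst h'; exact not_prefers_self t d h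
      simp only [Finset.mem_inter, Finset.mem_erase, mem_strongRivals]
      tauto
  have hsumP : ∑ j ∈ P, (T j ∩ weakRivals t y).card + ∑ j ∈ P, (T j ∩ strongRivals t y).card =
      P.card * (l + 1) := by
    rw [← Finset.sum_add_distrib, Finset.sum_congr rfl hTP, Finset.sum_const, smul_eq_mul]
  have hsumQ : ∑ j ∈ Q, (T j ∩ (weakRivals t y).erase x).card +
      ∑ j ∈ Q, (T j ∩ (strongRivals t y).erase x).card = Q.card * (l - 1) := by
    rw [← Finset.sum_add_distrib, Finset.sum_congr rfl hTQ, Finset.sum_const, smul_eq_mul]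
  have hle : ∀ (P' : Finset (Fin n)) (S : Finset (Fin m)), ∑ j ∈ P', (T j ∩ S).card ≤
      P'.card * S.card := fun P' S => by
    rw [← smul_eq_mul]
    exact Finset.sum_le_card_nsmul _ _ _ fun j _ => Finset.card_le_card Finset.inter_subset_right
  have hminus : ∀ (P' : Finset (Fin n)) (S : Finset (Fin m)), S ⊆ weakRivals t y →
      ∑ j ∈ P', (T j ∩ S).card - P'.card ≤ ∑ j ∈ P', (S.filter fun d => B j d).card := by
    intro P' S hS
    have h1 : ∑ j ∈ P', (T j ∩ S).card ≤ ∑ j ∈ P', ((S.filter fun d => B j d).card + 1) :=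
      Finset.sum_le_sum fun j _ => hweak j S hS
    rw [Finset.sum_add_distrib, Finset.sum_const, smul_eq_mul, mul_one] at h1
    omega
  refine ⟨l, hl, Q.card, Finset.card_le_card hQM, ∑ j ∈ P, (T j ∩ weakRivals t y).card,
    by rw [hP']; omega, ∑ j ∈ Q, (T j ∩ (weakRivals t y).erase x).card, by omega,
    fun h => ?_, ?_, fun d hdy => ?_, ⟨?_, hle _ _⟩, ?_, ?_⟩
  · rw [Finset.card_eq_zero, Finset.eq_empty_iff_forall_notMem]
    intro j hj
    have := hxQ j hj
    omega
  · rw [topCount_piecewise] at hy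
    exact hy
  · have := hload d hdy
    omega
  · rw [hP']; exact hle _ _
  · refine hsuff _ _ _ hyW ?_ (hminus _ _ (Finset.erase_subset _ _))
    rw [hP']
    exact hminus _ _ subset_rfl
  · refine hsuff _ _ _ hyS ?_ ?_
    · have : ∑ j ∈ P, ((strongRivals t y).filter fun d => B j d).card =
          ∑ j ∈ P, (T j ∩ strongRivals t y).card :=
        Finset.sum_congr rfl fun j _ => by rw [hstrong j _ subset_rfl]
      rw [hP', this]
      omega
    · have : ∑ j ∈ Q, (((strongRivals t y).erase x).filter fun d => B j d).card =
          ∑ j ∈ Q, (T j ∩ (strongRivals t y).erase x).card :=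
        Finset.sum_congr rfl fun j _ => by rw [hstrong j _ (Finset.erase_subset _ _)]
      rw [this]
      omega

/-- The three inequalities are turned into multiplicities `u` for `P` and `v` for `Q`, these into
sets by dealing, and the sets into votes. The sets `A` and `T` bound the top `l` and the top `l +
1`, which is where weak and strong rivals respectively are counted. -/
theorem exists_manipulation [NeZero m] (hn : 0 < n) (t : Preference m) (V : Profile m n)
    (M : Finset (Fin n)) {x y : Fin m} (hxy : x ≠ y) {l τ U U' : ℕ} (hl : l < m) (hτ : τ ≤ M.card)
    (hU : U ≤ (M.card - τ) * (l + 1)) (hU' : U' ≤ τ * (l - 1))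
    (h : Feasible t V M x y l τ U U') :
    ∃ W : Profile m n, (∀ j ∈ M, (W j).Prefers x y) ∧ bucklin m n t (M.piecewise W V) = y := by
  obtain ⟨hl0, hy, hload, ⟨hUW, hUW'⟩, hsW, hsS⟩ := h
  obtain ⟨Q, hQM, rfl⟩ := Finset.exists_subset_card_eq hτ
  set P := M \ Q with hP
  have hPc : M.card - Q.card = P.card := by rw [hP, Finset.card_sdiff_of_subset hQM]
  rw [hPc] at hU hUW hsW hsS
  obtain ⟨u₁, v₁, h₁, hu₁, hv₁⟩ := hsW.exists
  obtain ⟨u₂, v₂, h₂, hu₂, hv₂⟩ := hsS.exists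
  set u : Fin m → ℕ := fun d => if t.Prefers d y then u₂ d else u₁ d with hu
  set v : Fin m → ℕ := fun d => if t.Prefers d y then v₂ d else v₁ d with hv
  have huv : ∀ d, d ≠ y → u d ≤ P.card ∧ v d ≤ (if d = x then 0 else Q.card) ∧
      u d + v d ≤ (n - 1) / 2 - load t V M x y l Q.card d := by
    intro d hdy
    simp only [hu, hv]
    split_ifs with h3 h4 h4
    · simpa [h4] using h₂ d (mem_strongRivals.2 h3)
    · simpa [h4] using h₂ d (mem_strongRivals.2 h3)
    · simpa [h4] using h₁ d (mem_weakRivals.2 ⟨hdy, h3⟩)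
    · simpa [h4] using h₁ d (mem_weakRivals.2 ⟨hdy, h3⟩)
  have hvx : v x = 0 := by have := (huv x hxy).2.1; simpa using this
  have hsdiff : Finset.univ.erase y \ weakRivals t y = strongRivals t y := by
    ext d
    simp only [Finset.mem_sdiff, Finset.mem_erase, Finset.mem_univ, and_true, mem_weakRivals,
      mem_strongRivals, not_and, not_not]
    exact ⟨fun h => h.2 h.1, fun h => ⟨fun h' => by subst h'; exact not_prefers_self t d h,
      fun _ => h⟩⟩
  have hsdiff' : (Finset.univ.erase y).erase x \ (weakRivals t y).erase x =
      (strongRivals t y).erase x := by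
    rw [← hsdiff]
    ext d
    simp only [Finset.mem_sdiff, Finset.mem_erase]
    tauto
  have hsub : weakRivals t y ⊆ Finset.univ.erase y := fun d hd => by
    simpa using (mem_weakRivals.1 hd).1
  have huW : ∀ d ∈ weakRivals t y, u d = u₁ d ∧ v d = v₁ d := fun d hd => by
    simp [hu, hv, (mem_weakRivals.1 hd).2]
  have huS : ∀ d ∈ strongRivals t y, u d = u₂ d ∧ v d = v₂ d := fun d hd => by
    simp [hu, hv, mem_strongRivals.1 hd]
  have herase : ∀ S : Finset (Fin m), ∑ d ∈ S.erase x, v d = ∑ d ∈ S, v d :=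
    fun S => Finset.sum_erase S hvx
  -- Members of `P` put `y` last, so all `l + 1` places go to rivals.
  obtain ⟨A, T, hAT, hA, hT⟩ := exists_deal P hsub u (l + 1) U
    (fun d hd => (huv d (Finset.ne_of_mem_erase hd)).1) hU hUW
    (by rw [Finset.sum_congr rfl fun d hd => (huW d hd).1, hu₁])
    (by rw [hsdiff, Finset.sum_congr rfl fun d hd => (huS d hd).1, hu₂])
  -- Members of `Q` spend two places on `x` and `y`, which leaves `l - 1`; dealing excludes `x`,
  -- whose multiplicity `v x` is zero.
  obtain ⟨A', T', hAT', hA', hT'⟩ := exists_deal Q (Finset.erase_subset_erase x hsub) v (l - 1) U'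
    (fun d hd => (huv d (Finset.ne_of_mem_erase (Finset.mem_of_mem_erase hd))).2.1.trans (by
      split_ifs <;> omega)) hU' hUW'
    (by rw [herase, Finset.sum_congr rfl fun d hd => (huW d hd).2, hv₁])
    (by rw [hsdiff', herase, Finset.sum_congr rfl fun d hd => (huS d hd).2, hv₂])
  rw [hsdiff] at hT
  rw [hsdiff'] at hT'
  have hvote : ∀ j, ∃ p : Preference m, (j ∈ M → p.Prefers x y) ∧
      (j ∈ Q → (p.symm y : ℕ) < l + 1 ∧ ∀ d, d ≠ y → d ≠ x →
        ((p.symm d : ℕ) < l → d ∈ A' j) ∧ ((p.symm d : ℕ) < l + 1 → d ∈ T' j)) ∧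
      (j ∈ P → ∀ d, d ≠ y → ((p.symm d : ℕ) < l → d ∈ A j) ∧
        ((p.symm d : ℕ) < l + 1 → d ∈ T j)) := by
    intro j
    by_cases hjQ : j ∈ Q
    · have hlpos : 0 < l := by
        by_contra h0
        have := hl0 (by omega)
        rw [Finset.card_eq_zero] at this
        simp [this] at hjQ
      obtain ⟨hj1, hj2, hj3, hj4⟩ := hAT' j hjQ
      obtain ⟨p, hp1, hp2, hp3⟩ := exists_vote_top (l := l) hxy hj1
        (fun h => by have := hj2 h; simp at this) (fun h => by have := hj2 h; simp at this)
        hlpos (by omega) (by omega)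
      exact ⟨p, fun _ => hp1, fun _ => ⟨hp2, hp3⟩, fun h => absurd hjQ (Finset.mem_sdiff.1 h).2⟩
    · by_cases hjP : j ∈ P
      · obtain ⟨hj1, hj2, hj3, hj4⟩ := hAT j hjP
        obtain ⟨p, hp1, hp2⟩ := exists_vote_bot (l := l) hxy hj1
          (fun h => by have := hj2 h; simp at this) (by omega) (by omega)
        exact ⟨p, fun _ => hp1, fun h => absurd h hjQ, fun _ => hp2⟩
      -- Outside of `M` the vote is a dummy: `piecewise` never uses it.
      · exact ⟨1, fun h => absurd (Finset.mem_sdiff.2 ⟨h, hjQ⟩) hjP, fun h => absurd h hjQ,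
          fun h => absurd h hjP⟩
  choose W hW1 hW2 hW3 using hvote
  refine ⟨W, fun j hj => hW1 j hj, ?_⟩
  have hmain : ∀ d, d ≠ y → 2 * topCount (M.piecewise W V) d (threshold t y l d) < n := by
    intro d hdy
    rw [topCount_piecewise]
    have hsplitM : (M.filter fun j => ((W j).symm d : ℕ) < threshold t y l d).card ≤
        (P.filter fun j => ((W j).symm d : ℕ) < threshold t y l d).card +
        (Q.filter fun j => ((W j).symm d : ℕ) < threshold t y l d).card := by
      rw [show M = P ∪ Q by rw [hP, Finset.sdiff_union_of_subset hQM], Finset.filter_union]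
      exact Finset.card_union_le _ _
    have hPd : (P.filter fun j => ((W j).symm d : ℕ) < threshold t y l d).card ≤ u d := by
      by_cases hs : t.Prefers d y
      · refine (Finset.card_le_card fun j hj => ?_).trans (hT d (mem_strongRivals.2 hs))
        rw [Finset.mem_filter, threshold, if_pos hs] at hj
        exact Finset.mem_filter.2 ⟨hj.1, (hW3 j hj.1 d hdy).2 hj.2⟩
      · refine (Finset.card_le_card fun j hj => ?_).trans (hA d (mem_weakRivals.2 ⟨hdy, hs⟩))
        rw [Finset.mem_filter, threshold, if_neg hs] at hj
        exact Finset.mem_filter.2 ⟨hj.1, (hW3 j hj.1 d hdy).1 hj.2⟩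
    have hQd : (Q.filter fun j => ((W j).symm d : ℕ) < threshold t y l d).card ≤
        v d + if d = x then Q.card else 0 := by
      by_cases hdx : d = x
      · rw [if_pos hdx]
        exact (Finset.card_filter_le _ _).trans (Nat.le_add_left _ _)
      rw [if_neg hdx, add_zero]
      by_cases hs : t.Prefers d y
      · refine (Finset.card_le_card fun j hj => ?_).trans
          (hT' d (Finset.mem_erase.2 ⟨hdx, mem_strongRivals.2 hs⟩))
        rw [Finset.mem_filter, threshold, if_pos hs] at hj
        exact Finset.mem_filter.2 ⟨hj.1, ((hW2 j hj.1).2 d hdy hdx).2 hj.2⟩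
      · refine (Finset.card_le_card fun j hj => ?_).trans
          (hA' d (Finset.mem_erase.2 ⟨hdx, mem_weakRivals.2 ⟨hdy, hs⟩⟩))
        rw [Finset.mem_filter, threshold, if_neg hs] at hj
        exact Finset.mem_filter.2 ⟨hj.1, ((hW2 j hj.1).2 d hdy hdx).1 hj.2⟩
    have h1 := (huv d hdy).2.2
    have h2 := hload d hdy
    unfold load at h1 h2
    omega
  refine (bucklin_eq_iff hn t _ y).2 ⟨l, hl, ?_, fun d hdy => ?_⟩
  · rw [topCount_piecewise]
    have : Q.card ≤ (M.filter fun j => ((W j).symm y : ℕ) < l + 1).card :=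
      Finset.card_le_card fun j hj => Finset.mem_filter.2 ⟨hQM hj, (hW2 j hj).1⟩
    omega
  · have h1 := hmain d hdy
    unfold threshold at h1
    split_ifs at h1 with hs
    · have := topCount_mono (M.piecewise W V) d (show l ≤ l + 1 by omega)
      exact ⟨by omega, fun _ => h1⟩
    · exact ⟨h1, fun h => absurd h hs⟩

theorem exists_manipulation_iff [NeZero m] (hn : 0 < n) (t : Preference m) (V : Profile m n)
    (M : Finset (Fin n)) {x y : Fin m} (hxy : x ≠ y) :
    (∃ W : Profile m n, (∀ j ∈ M, (W j).Prefers x y) ∧ bucklin m n t (M.piecewise W V) = y) ↔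
      ∃ l < m, ∃ τ ≤ M.card, ∃ U ≤ (M.card - τ) * (l + 1), ∃ U' ≤ τ * (l - 1),
        Feasible t V M x y l τ U U' :=
  ⟨fun ⟨W, hW, h⟩ => exists_feasible hn t V W M hxy hW h,
    fun ⟨_, hl, _, hτ, _, hU, _, hU', h⟩ => exists_manipulation hn t V M hxy hl hτ hU hU' h⟩

end Criterion

end PossibleManipulators

namespace PossibleManipulators

open Computability

/-! ### The criterion in terms of the input word -/

open Classical in
/-- The candidate at position `j` of the preference `b` in the word `w`, in which every preference
lists `m` candidates: the number of occurrences of the symbol `1` between two commas. -/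
noncomputable def entryAt (w : List Γ') (m b j : ℕ) : ℕ :=
  ((Finset.range w.length).filter fun p => w[p]? = some (Γ'.bit true) ∧
    ((Finset.range p).filter fun q => w[q]? = some Γ'.comma).card = m * b + j).card

/-- The first preference of the word ranks `d` above `y`. -/
def Above (w : List Γ') (m d y : ℕ) : Prop :=
  ∃ j < m, entryAt w m 0 j = y ∧ ∃ j' < j, entryAt w m 0 j' = d

open Classical in
/-- The number of voters outside of `mem` that rank `d` in their top `l` positions. -/
noncomputable def countOut (w : List Γ') (m n : ℕ) (mem : ℕ → Prop) (d l : ℕ) : ℕ :=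
  ((Finset.range n).filter fun i => ¬ mem i ∧ ∃ j < l, entryAt w m (i + 1) j = d).card

/-- `x` wins the election. -/
def Wins (w : List Γ') (m n x : ℕ) : Prop :=
  ∃ l < m, n ≤ 2 * countOut w m n (fun _ => False) x (l + 1) ∧
    ∀ d < m, d ≠ x → 2 * countOut w m n (fun _ => False) d l < n ∧
      (Above w m d x → 2 * countOut w m n (fun _ => False) d (l + 1) < n)

open Classical in
/-- The numerical version of `load`. -/
noncomputable def loadAt (w : List Γ') (m n : ℕ) (mem : ℕ → Prop) (x y l τ d : ℕ) : ℕ :=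
  countOut w m n mem d (if Above w m d y then l + 1 else l) + if d = x then τ else 0

open Classical in
/-- The numerical version of `Suffices`. -/
def SufficesBelow (m : ℕ) (S : ℕ → Prop) (c : ℕ → ℕ) (p : ℕ) (q : ℕ → ℕ) (U V : ℕ) : Prop :=
  U ≤ ∑ d ∈ Finset.range m, (if S d then min (c d) p else 0) ∧
    V ≤ ∑ d ∈ Finset.range m, (if S d then min (c d) (q d) else 0) ∧
    U + V ≤ ∑ d ∈ Finset.range m, (if S d then min (c d) (p + q d) else 0)

open Classical in
/-- The numerical version of `Feasible`, for `k` manipulators. -/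
def FeasibleAt (w : List Γ') (m n : ℕ) (mem : ℕ → Prop) (k x y l τ U U' : ℕ) : Prop :=
  (l = 0 → τ = 0) ∧ n ≤ 2 * (countOut w m n mem y (l + 1) + τ) ∧
  (∀ d < m, d ≠ y → loadAt w m n mem x y l τ d ≤ (n - 1) / 2) ∧
  (U ≤ (k - τ) * ((Finset.range m).filter fun d => d ≠ y ∧ ¬ Above w m d y).card ∧
    U' ≤ τ * ((Finset.range m).filter fun d => d ≠ x ∧ d ≠ y ∧ ¬ Above w m d y).card) ∧
  SufficesBelow m (fun d => d ≠ y ∧ ¬ Above w m d y)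
    (fun d => (n - 1) / 2 - loadAt w m n mem x y l τ d) (k - τ)
    (fun d => if d = x then 0 else τ) (U - (k - τ)) (U' - τ) ∧
  SufficesBelow m (fun d => Above w m d y)
    (fun d => (n - 1) / 2 - loadAt w m n mem x y l τ d) (k - τ)
    (fun d => if d = x then 0 else τ) ((k - τ) * (l + 1) - U) (τ * (l - 1) - U')

/-- There is a number of at most `b` with the property `p`. -/
def ExistsLE (b : ℕ) (p : ℕ → Prop) : Prop := ∃ i < b + 1, p i

open Classical in
/-- The set `mem` is a coalition of possible manipulators against `y`. -/
def CoalitionAt (w : List Γ') (m n y : ℕ) (mem : ℕ → Prop) : Prop :=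
  ∃ x < m, x ≠ y ∧ Wins w m n x ∧ ∃ l < m,
    ExistsLE ((Finset.range n).filter mem).card fun τ =>
    ExistsLE ((((Finset.range n).filter mem).card - τ) * (l + 1)) fun U =>
    ExistsLE (τ * (l - 1)) fun U' =>
      FeasibleAt w m n mem ((Finset.range n).filter mem).card x y l τ U U'

/-- The word describes the tie-breaking preference `t` and the profile `V`. -/
def Describes {m n : ℕ} (w : List Γ') (t : Preference m) (V : Profile m n) : Prop :=
  (∀ j : Fin m, entryAt w m 0 j = t j) ∧ ∀ (i : Fin n) (j : Fin m), entryAt w m (i + 1) j = V i j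

/-! ### Transfer of the criterion between words and elections -/

section Describes

variable {m n : ℕ} {w : List Γ'} {t : Preference m} {V : Profile m n}

theorem exists_lt_eq_iff {p : Preference m} {f : ℕ → ℕ} (h : ∀ j : Fin m, f j = p j) {l : ℕ}
    (hl : l ≤ m) (d : Fin m) : (∃ j < l, f j = d) ↔ (p.symm d : ℕ) < l := by
  constructor
  · rintro ⟨j, hj, hd⟩
    have h1 := h ⟨j, hj.trans_le hl⟩
    have h2 : p ⟨j, hj.trans_le hl⟩ = d := Fin.ext (h1.symm.trans hd)
    rw [← h2, Equiv.symm_apply_apply]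
    exact hj
  · intro hd
    exact ⟨p.symm d, hd, by rw [h, Equiv.apply_symm_apply]⟩

theorem Describes.above_iff (h : Describes w t V) (d y : Fin m) :
    Above w m d y ↔ t.Prefers d y := by
  constructor
  · rintro ⟨j, hj, hy, hd⟩
    rw [exists_lt_eq_iff h.1 hj.le] at hd
    have h1 : t ⟨j, hj⟩ = y := Fin.ext ((h.1 ⟨j, hj⟩).symm.trans hy)
    have h2 : t.symm y = ⟨j, hj⟩ := by rw [← h1, Equiv.symm_apply_apply]
    unfold Preference.Prefers
    rw [h2]
    exact hd
  · intro hd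
    exact ⟨t.symm y, (t.symm y).2, by rw [h.1, Equiv.apply_symm_apply],
      (exists_lt_eq_iff h.1 (t.symm y).2.le d).2 hd⟩

theorem card_filter_range {S : ℕ → Prop} [DecidablePred S] (S' : Finset (Fin m))
    (hS : ∀ d : Fin m, S d ↔ d ∈ S') : ((Finset.range m).filter S).card = S'.card := by
  rw [Finset.card_filter, Finset.sum_range, Finset.card_eq_sum_ones]
  simp only [hS, Finset.sum_ite_mem, Finset.univ_inter]

theorem sum_range_ite {S : ℕ → Prop} [DecidablePred S] {f : ℕ → ℕ} {S' : Finset (Fin m)}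
    {f' : Fin m → ℕ} (hS : ∀ d : Fin m, S d ↔ d ∈ S') (hf : ∀ d : Fin m, f d = f' d) :
    ∑ d ∈ Finset.range m, (if S d then f d else 0) = ∑ d ∈ S', f' d := by
  rw [Finset.sum_range]
  simp only [hS, hf, Finset.sum_ite_mem, Finset.univ_inter]

theorem Describes.countOut_eq (h : Describes w t V) {mem : ℕ → Prop} {M : Finset (Fin n)}
    (hM : ∀ i : Fin n, mem i ↔ i ∈ M) (d : Fin m) {l : ℕ} (hl : l ≤ m) :
    countOut w m n mem d l = outCount V M d l := by
  classical
  refine card_filter_range _ fun i => ?_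
  rw [exists_lt_eq_iff (h.2 i) hl, hM]
  simp

theorem Describes.countOut_eq_topCount (h : Describes w t V) (d : Fin m) {l : ℕ} (hl : l ≤ m) :
    countOut w m n (fun _ => False) d l = topCount V d l := by
  rw [h.countOut_eq (M := ∅) (by simp) d hl]
  simp [outCount, topCount]

theorem forall_lt_iff {p : ℕ → Prop} : (∀ d < m, p d) ↔ ∀ d : Fin m, p d :=
  ⟨fun h d => h d d.2, fun h d hd => h ⟨d, hd⟩⟩

theorem exists_lt_iff {p : ℕ → Prop} : (∃ d < m, p d) ↔ ∃ d : Fin m, p d :=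
  ⟨fun ⟨d, hd, h⟩ => ⟨⟨d, hd⟩, h⟩, fun ⟨d, h⟩ => ⟨d, d.2, h⟩⟩

theorem Describes.wins_iff [NeZero m] (hn : 0 < n) (h : Describes w t V) (x : Fin m) :
    Wins w m n x ↔ bucklin m n t V = x := by
  rw [bucklin_eq_iff hn]
  refine exists_congr fun l => and_congr_right fun hl => ?_
  rw [h.countOut_eq_topCount x hl, forall_lt_iff]
  refine and_congr_right fun _ => forall_congr' fun d => ?_
  rw [h.countOut_eq_topCount d hl, h.countOut_eq_topCount d hl.le, h.above_iff, Ne, Fin.val_inj]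

theorem Describes.feasibleAt_iff (h : Describes w t V) {mem : ℕ → Prop} {M : Finset (Fin n)}
    (hM : ∀ i : Fin n, mem i ↔ i ∈ M) (x y : Fin m) {l : ℕ} (hl : l < m) (τ U U' : ℕ) :
    FeasibleAt w m n mem M.card x y l τ U U' ↔ Feasible t V M x y l τ U U' := by
  classical
  have hload : ∀ d : Fin m, loadAt w m n mem x y l τ d = load t V M x y l τ d := by
    intro d
    unfold loadAt load threshold
    simp only [h.above_iff, Fin.val_inj]
    rw [h.countOut_eq hM]
    split_ifs <;> omega
  have hweak : ∀ d : Fin m, ((d : ℕ) ≠ y ∧ ¬ Above w m d y) ↔ d ∈ weakRivals t y := fun d => by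
    rw [mem_weakRivals, h.above_iff, Ne, Fin.val_inj]
  have hstrong : ∀ d : Fin m, Above w m d y ↔ d ∈ strongRivals t y := fun d => by
    rw [mem_strongRivals, h.above_iff]
  have hweak' : ∀ d : Fin m, ((d : ℕ) ≠ x ∧ (d : ℕ) ≠ y ∧ ¬ Above w m d y) ↔
      d ∈ (weakRivals t y).erase x := fun d => by
    rw [hweak, Finset.mem_erase, Ne, Fin.val_inj]
  have hsuff : ∀ (S : ℕ → Prop) (S' : Finset (Fin m)) (u v : ℕ), (∀ d : Fin m, S d ↔ d ∈ S') →
      (SufficesBelow m S (fun d => (n - 1) / 2 - loadAt w m n mem x y l τ d) (M.card - τ)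
        (fun d => if d = x then 0 else τ) u v ↔
      Suffices S' (fun d => (n - 1) / 2 - load t V M x y l τ d) (fun _ => M.card - τ)
        (fun d => if d = x then 0 else τ) u v) := by
    intro S S' u v hS
    unfold SufficesBelow Suffices
    rw [sum_range_ite (f' := fun d => min ((n - 1) / 2 - load t V M x y l τ d) (M.card - τ)) hS
        fun d => by simp only [hload],
      sum_range_ite (f' := fun d => min ((n - 1) / 2 - load t V M x y l τ d)
        (if d = x then 0 else τ)) hS fun d => by simp only [hload, Fin.val_inj],
      sum_range_ite (f' := fun d => min ((n - 1) / 2 - load t V M x y l τ d)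
        (M.card - τ + if d = x then 0 else τ)) hS fun d => by simp only [hload, Fin.val_inj]]
  unfold FeasibleAt Feasible
  rw [h.countOut_eq hM y hl, forall_lt_iff, card_filter_range _ hweak, card_filter_range _ hweak',
    hsuff _ _ _ _ hweak, hsuff _ _ _ _ hstrong]
  simp only [hload, Ne, Fin.val_inj]

theorem existsLE_iff {b : ℕ} {p : ℕ → Prop} : ExistsLE b p ↔ ∃ i ≤ b, p i := by
  simp only [ExistsLE, Nat.lt_succ_iff]

theorem Describes.coalitionAt_iff [NeZero m] (hn : 0 < n) (h : Describes w t V) {mem : ℕ → Prop}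
    {M : Finset (Fin n)} (hM : ∀ i : Fin n, mem i ↔ i ∈ M) (y : Fin m) :
    CoalitionAt w m n y mem ↔ IsPossibleCoalitionAgainst (bucklin m n t) V M y := by
  classical
  unfold CoalitionAt IsPossibleCoalitionAgainst
  simp only [existsLE_iff, card_filter_range M hM]
  rw [exists_lt_iff]
  constructor
  · rintro ⟨x, hxy, hx, l, hl, τ, hτ, U, hU, U', hU', hf⟩
    rw [h.wins_iff hn] at hx
    subst hx
    have hxy' : bucklin m n t V ≠ y := fun e => hxy (by rw [e])
    exact ⟨hxy'.symm, (exists_manipulation_iff hn t V M hxy').2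
      ⟨l, hl, τ, hτ, U, hU, U', hU', (h.feasibleAt_iff hM _ y hl τ U U').1 hf⟩⟩
  · rintro ⟨hy, hW⟩
    obtain ⟨l, hl, τ, hτ, U, hU, U', hU', hf⟩ := (exists_manipulation_iff hn t V M hy.symm).1 hW
    exact ⟨bucklin m n t V, fun e => hy (Fin.ext e.symm), (h.wins_iff hn _).2 rfl, l, hl, τ, hτ, U,
      hU, U', hU', (h.feasibleAt_iff hM _ y hl τ U U').2 hf⟩

/-- Some coalition arising from `mem` by adding at most `k` voters can manipulate. -/
def ExtensionAt (w : List Γ') (m n y : ℕ) : ℕ → (ℕ → Prop) → Prop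
  | 0, mem => CoalitionAt w m n y mem
  | k + 1, mem => ExtensionAt w m n y k mem ∨ ∃ i < n, ExtensionAt w m n y k fun j => mem j ∨ j = i

/-- One voter is added at a time. Adding a member again is harmless, so sets of fewer than `k`
voters are covered too. -/
theorem Describes.extensionAt_iff [NeZero m] (hn : 0 < n) (h : Describes w t V) (y : Fin m)
    (k : ℕ) : ∀ {mem : ℕ → Prop} {M : Finset (Fin n)}, (∀ i : Fin n, mem i ↔ i ∈ M) →
    (ExtensionAt w m n y k mem ↔ ∃ M' : Finset (Fin n), M'.card ≤ k ∧
      IsPossibleCoalitionAgainst (bucklin m n t) V (M ∪ M') y) := by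
  induction k with
  | zero =>
    intro mem M hM
    simp only [ExtensionAt, Nat.le_zero, Finset.card_eq_zero, exists_eq_left, Finset.union_empty]
    exact h.coalitionAt_iff hn hM y
  | succ k ih =>
    intro mem M hM
    rw [ExtensionAt, ih hM, exists_lt_iff]
    have hins : ∀ i : Fin n, ExtensionAt w m n y k (fun j => mem j ∨ j = i) ↔
        ∃ M' : Finset (Fin n), M'.card ≤ k ∧
          IsPossibleCoalitionAgainst (bucklin m n t) V (insert i M ∪ M') y := fun i =>
      ih fun j => by rw [hM, Fin.val_inj, Finset.mem_insert, or_comm]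
    constructor
    · rintro (⟨M', hM', hc⟩ | ⟨i, hi⟩)
      · exact ⟨M', by omega, hc⟩
      · obtain ⟨M', hM', hc⟩ := (hins i).1 hi
        exact ⟨insert i M', (Finset.card_insert_le _ _).trans (by omega), by
          rwa [Finset.union_insert, ← Finset.insert_union]⟩
    · rintro ⟨M', hM', hc⟩
      rcases M'.eq_empty_or_nonempty with rfl | ⟨i, hi⟩
      · exact .inl ⟨∅, by simp, hc⟩
      · refine .inr ⟨i, (hins i).2 ⟨M'.erase i, ?_, ?_⟩⟩
        · rw [Finset.card_erase_of_mem hi]; omega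
        · rwa [Finset.insert_union, ← Finset.union_insert, Finset.insert_erase hi]

end Describes

/-! ### Definability of the criterion -/

section Definability

variable {X : Type} [Ctx X] {m n k x y l τ U U' d b j : X → ℕ} {mem : X → ℕ → Prop}

theorem Def.half {f : X → ℕ} (hf : Def f) : Def fun x => f x / 2 := by
  have h : (fun x => f x / 2) = fun x =>
      ((Finset.range (f x)).filter fun i => 2 * (i + 1) ≤ f x).card := by
    funext x
    have : ((Finset.range (f x)).filter fun i => 2 * (i + 1) ≤ f x) = Finset.range (f x / 2) := by
      ext i
      simp only [Finset.mem_filter, Finset.mem_range]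
      omega
    rw [this, Finset.card_range]
  rw [h]
  exact Def.count hf (DefP.le ((Def.const 2).mul (Def.snd.add .one)) hf.fst)

theorem Def.entryAt (hm : Def m) (hb : Def b) (hj : Def j) :
    Def fun c => entryAt (Ctx.inp c) (m c) (b c) (j c) :=
  Def.count .length_inp ((DefP.sym (X := X × ℕ) _ Def.snd).and (DefP.eq
    (Def.count Def.snd (DefP.sym (X := (X × ℕ) × ℕ) _ Def.snd)) ((hm.fst.mul hb.fst).add hj.fst)))

theorem DefP.above (hm : Def m) (hd : Def d) (hy : Def y) :
    DefP fun c => Above (Ctx.inp c) (m c) (d c) (y c) :=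
  DefP.ex hm ((DefP.eq (Def.entryAt (X := X × ℕ) hm.fst (.const 0) .snd) hy.fst).and
    (DefP.ex .snd (DefP.eq (Def.entryAt (X := (X × ℕ) × ℕ) hm.fst.fst (.const 0) .snd) hd.fst.fst)))

theorem Def.countOut (hm : Def m) (hn : Def n) (hmem : DefP fun c : X × ℕ => mem c.1 c.2)
    (hd : Def d) (hl : Def l) :
    Def fun c => countOut (Ctx.inp c) (m c) (n c) (mem c) (d c) (l c) :=
  Def.count hn (hmem.not.and (DefP.ex hl.fst (DefP.eq
    (Def.entryAt (X := (X × ℕ) × ℕ) hm.fst.fst (Def.snd.fst.add .one) .snd) hd.fst.fst)))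

theorem DefP.false : DefP fun _ : X => False :=
  (DefP.lt (Def.const 0) (Def.const 0)).congr fun _ => by simp

theorem DefP.wins (hm : Def m) (hn : Def n) (hx : Def x) :
    DefP fun c => Wins (Ctx.inp c) (m c) (n c) (x c) :=
  DefP.ex hm ((DefP.le hn.fst ((Def.const 2).mul
      (Def.countOut (X := X × ℕ) hm.fst hn.fst DefP.false hx.fst (Def.snd.add .one)))).and
    (DefP.all hm.fst (.imp (DefP.ne .snd hx.fst.fst) (.and
      (DefP.lt ((Def.const 2).mul (Def.countOut (X := (X × ℕ) × ℕ) hm.fst.fst hn.fst.fst DefP.false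
        .snd Def.snd.fst)) hn.fst.fst)
      (.imp (DefP.above (X := (X × ℕ) × ℕ) hm.fst.fst .snd hx.fst.fst)
        (DefP.lt ((Def.const 2).mul (Def.countOut (X := (X × ℕ) × ℕ) hm.fst.fst hn.fst.fst DefP.false
          .snd (Def.snd.fst.add .one))) hn.fst.fst))))))

theorem Def.loadAt (hm : Def m) (hn : Def n) (hmem : DefP fun c : X × ℕ => mem c.1 c.2)
    (hx : Def x) (hy : Def y) (hl : Def l) (hτ : Def τ) (hd : Def d) :
    Def fun c => loadAt (Ctx.inp c) (m c) (n c) (mem c) (x c) (y c) (l c) (τ c) (d c) :=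
  (Def.countOut hm hn hmem hd (Def.ite (DefP.above hm hd hy) (hl.add .one) hl)).add
    (Def.ite (DefP.eq hd hx) hτ (.const 0))

theorem DefP.sufficesBelow {S : X → ℕ → Prop} {f q : X → ℕ → ℕ} {p : X → ℕ} (hm : Def m)
    (hS : DefP fun c : X × ℕ => S c.1 c.2) (hf : Def fun c : X × ℕ => f c.1 c.2) (hp : Def p)
    (hq : Def fun c : X × ℕ => q c.1 c.2) (hU : Def U) (hU' : Def U') :
    DefP fun c => SufficesBelow (m c) (S c) (f c) (p c) (q c) (U c) (U' c) :=
  (DefP.le hU (Def.sum hm (Def.ite hS (hf.min hp.fst) (.const 0)))).and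
    ((DefP.le hU' (Def.sum hm (Def.ite hS (hf.min hq) (.const 0)))).and
      (DefP.le (hU.add hU') (Def.sum hm (Def.ite hS (hf.min (hp.fst.add hq)) (.const 0)))))

theorem DefP.feasibleAt (hm : Def m) (hn : Def n) (hmem : DefP fun c : X × ℕ => mem c.1 c.2)
    (hk : Def k) (hx : Def x) (hy : Def y) (hl : Def l) (hτ : Def τ) (hU : Def U) (hU' : Def U') :
    DefP fun c => FeasibleAt (Ctx.inp c) (m c) (n c) (mem c) (k c) (x c) (y c) (l c) (τ c) (U c)
      (U' c) := by
  have hlow : Def fun c => (n c - 1) / 2 := (hn.sub .one).half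
  have hload : Def fun c : X × ℕ => loadAt (Ctx.inp c.1) (m c.1) (n c.1) (mem c.1) (x c.1) (y c.1)
      (l c.1) (τ c.1) c.2 :=
    Def.loadAt (X := X × ℕ) hm.fst hn.fst hmem.under hx.fst hy.fst hl.fst hτ.fst .snd
  have habove : DefP fun c : X × ℕ => Above (Ctx.inp c.1) (m c.1) c.2 (y c.1) :=
    DefP.above (X := X × ℕ) hm.fst .snd hy.fst
  have hweak : DefP fun c : X × ℕ => c.2 ≠ y c.1 ∧ ¬ Above (Ctx.inp c.1) (m c.1) c.2 (y c.1) :=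
    (DefP.ne .snd hy.fst).and habove.not
  have hq : Def fun c : X × ℕ => if c.2 = x c.1 then 0 else τ c.1 :=
    Def.ite (DefP.eq .snd hx.fst) (.const 0) hτ.fst
  exact (DefP.imp (DefP.eq hl (.const 0)) (DefP.eq hτ (.const 0))).and
    ((DefP.le hn ((Def.const 2).mul ((Def.countOut hm hn hmem hy (hl.add .one)).add hτ))).and
    ((DefP.all hm ((DefP.ne .snd hy.fst).imp (DefP.le hload hlow.fst))).and
    (((DefP.le hU ((hk.sub hτ).mul (Def.count hm hweak))).and
      (DefP.le hU' (hτ.mul (Def.count hm ((DefP.ne .snd hx.fst).and hweak))))).and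
    ((DefP.sufficesBelow hm hweak (hlow.fst.sub hload) (hk.sub hτ) hq (hU.sub (hk.sub hτ))
      (hU'.sub hτ)).and
    (DefP.sufficesBelow hm habove (hlow.fst.sub hload) (hk.sub hτ) hq
      (((hk.sub hτ).mul (hl.add .one)).sub hU) ((hτ.mul (hl.sub .one)).sub hU'))))))

theorem DefP.existsLE {p : X → ℕ → Prop} (hb : Def b) (hp : DefP fun c : X × ℕ => p c.1 c.2) :
    DefP fun c => ExistsLE (b c) (p c) :=
  DefP.ex (hb.add .one) hp

theorem DefP.coalitionAt (hm : Def m) (hn : Def n) (hy : Def y)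
    (hmem : DefP fun c : X × ℕ => mem c.1 c.2) :
    DefP fun c => CoalitionAt (Ctx.inp c) (m c) (n c) (y c) (mem c) := by
  classical
  have hk : Def fun c => ((Finset.range (n c)).filter (mem c)).card := Def.count hn hmem
  refine DefP.ex hm ((DefP.ne .snd hy.fst).and (.and (DefP.wins (X := X × ℕ) hm.fst hn.fst .snd)
    (DefP.ex hm.fst (DefP.existsLE ?_ (DefP.existsLE ?_ (DefP.existsLE ?_ ?_))))))
  · convert! hk.fst.fst
  · convert! (hk.fst.fst.fst.sub Def.snd).mul (Def.snd.fst.add .one)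
  · exact Def.snd.fst.mul (Def.snd.fst.fst.sub .one)
  · have := DefP.feasibleAt (X := ((((X × ℕ) × ℕ) × ℕ) × ℕ) × ℕ) (mem := fun c => mem c.1.1.1.1.1)
      hm.fst.fst.fst.fst.fst hn.fst.fst.fst.fst.fst (hmem.comp (φ := fun c : (((((X × ℕ) × ℕ) × ℕ) × ℕ) × ℕ) × ℕ =>
          (c.1.1.1.1.1.1, c.2))
        ((CtxMap.fst.comp (CtxMap.fst.comp (CtxMap.fst.comp (CtxMap.fst.comp
          (CtxMap.fst.comp CtxMap.fst))))).pair Def.snd))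
      hk.fst.fst.fst.fst.fst Def.snd.fst.fst.fst.fst hy.fst.fst.fst.fst.fst Def.snd.fst.fst.fst
      Def.snd.fst.fst Def.snd.fst Def.snd
    convert! this

/-- The number `k` is not a variable of the context: each `k` has its own expression, with one more
quantifier than its predecessor. The context is generalized because each guessed voter becomes a new
variable. -/
theorem DefP.extensionAt (k : ℕ) : ∀ {X : Type} [Ctx X] {m n y : X → ℕ} {mem : X → ℕ → Prop},
    Def m → Def n → Def y → (DefP fun c : X × ℕ => mem c.1 c.2) →
    DefP fun c => ExtensionAt (Ctx.inp c) (m c) (n c) (y c) k (mem c) := by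
  induction k with
  | zero => exact fun hm hn hy hmem => DefP.coalitionAt hm hn hy hmem
  | succ k ih =>
    intro X _ m n y mem hm hn hy hmem
    exact (ih hm hn hy hmem).or (DefP.ex hn (ih (X := X × ℕ)
      (mem := fun c j => mem c.1 j ∨ j = c.2) hm.fst hn.fst hy.fst
      (hmem.under.or (DefP.eq .snd Def.snd.fst))))

end Definability

end PossibleManipulators

namespace PossibleManipulators

open Computability

/-! ### Decoding the input word -/

section Decoding

open Classical in
/-- The number of occurrences of the symbol `1` after exactly `k` commas. -/
noncomputable def onesAt (w : List Γ') (k : ℕ) : ℕ :=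
  ∑ p ∈ Finset.range w.length, if w[p]? = some (Γ'.bit true) ∧
    (∑ q ∈ Finset.range p, if w[q]? = some Γ'.comma then 1 else 0) = k then 1 else 0

theorem entryAt_eq (w : List Γ') (m b j : ℕ) : entryAt w m b j = onesAt w (m * b + j) := by
  classical
  unfold entryAt onesAt
  simp only [Finset.card_filter]

theorem onesAt_comma_zero (w : List Γ') : onesAt (Γ'.comma :: w) 0 = 0 := by
  classical
  unfold onesAt
  refine Finset.sum_eq_zero fun p _ => if_neg ?_
  rintro ⟨h, h'⟩
  cases p with
  | zero => simp at h
  | succ p =>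
    rw [Finset.sum_range_succ'] at h'
    simp at h'

theorem onesAt_comma_succ (w : List Γ') (k : ℕ) : onesAt (Γ'.comma :: w) (k + 1) = onesAt w k := by
  classical
  unfold onesAt
  simp only [List.length_cons, Finset.sum_range_succ', List.getElem?_cons_succ,
    List.getElem?_cons_zero]
  simp

theorem onesAt_cons {a : Γ'} (ha : a ≠ Γ'.comma) (w : List Γ') (k : ℕ) :
    onesAt (a :: w) k = onesAt w k + if a = Γ'.bit true ∧ k = 0 then 1 else 0 := by
  classical
  unfold onesAt
  simp only [List.length_cons, Finset.sum_range_succ', List.getElem?_cons_succ,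
    List.getElem?_cons_zero]
  simp [ha, eq_comm (a := k)]

/-- A number in unary, followed by a comma. -/
def unary (c : ℕ) : List Γ' := List.replicate c (Γ'.bit true) ++ [Γ'.comma]

theorem onesAt_unary_zero (c : ℕ) (w : List Γ') : onesAt (unary c ++ w) 0 = c := by
  induction c with
  | zero => exact onesAt_comma_zero w
  | succ c ih =>
    have : unary (c + 1) ++ w = Γ'.bit true :: (unary c ++ w) := by
      simp [unary, List.replicate_succ]
    rw [this, onesAt_cons (by simp), ih]
    simp

theorem onesAt_unary_succ (c : ℕ) (w : List Γ') (k : ℕ) :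
    onesAt (unary c ++ w) (k + 1) = onesAt w k := by
  induction c with
  | zero => exact onesAt_comma_succ w k
  | succ c ih =>
    have : unary (c + 1) ++ w = Γ'.bit true :: (unary c ++ w) := by
      simp [unary, List.replicate_succ]
    rw [this, onesAt_cons (by simp), ih]
    simp

theorem onesAt_list (l : List ℕ) (w : List Γ') :
    (∀ k (hk : k < l.length), onesAt ((l.map unary).flatten ++ w) k = l[k]) ∧
      ∀ k, onesAt ((l.map unary).flatten ++ w) (l.length + k) = onesAt w k := by
  induction l with
  | nil => simp
  | cons c l ih =>
    simp only [List.map_cons, List.flatten_cons, List.append_assoc, List.length_cons]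
    constructor
    · rintro (_ | k) hk
      · exact onesAt_unary_zero c _
      · rw [onesAt_unary_succ, ih.1 k (by omega)]
        rfl
    · intro k
      rw [show l.length + 1 + k = (l.length + k) + 1 by omega, onesAt_unary_succ, ih.2]

/-- Only commas and ones influence the count, so brackets are invisible and consecutive preferences
read as one long list of numbers. -/
theorem onesAt_encodePreference {m : ℕ} (p : Preference m) (w : List Γ') :
    (∀ j : Fin m, onesAt (encodePreference p ++ w) j = p j) ∧
      ∀ k, onesAt (encodePreference p ++ w) (m + k) = onesAt w k := by
  have h : encodePreference p ++ w = Γ'.bra ::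
      (((List.ofFn fun j => (p j : ℕ)).map unary).flatten ++ Γ'.ket :: w) := by
    simp only [encodePreference, List.map_ofFn, List.cons_append, List.append_assoc,
      List.nil_append]
    rfl
  have hl := onesAt_list (List.ofFn fun j => (p j : ℕ)) (Γ'.ket :: w)
  rw [h]
  refine ⟨fun j => ?_, fun k => ?_⟩
  · rw [onesAt_cons (by simp), hl.1 j (by simp)]
    simp
  · have := hl.2 k
    rw [List.length_ofFn] at this
    rw [onesAt_cons (by simp), this, onesAt_cons (by simp)]
    simp

theorem onesAt_votes {m n : ℕ} (V : Profile m n) (w : List Γ') (i : Fin n) (j : Fin m) :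
    onesAt ((List.ofFn fun i => encodePreference (V i)).flatten ++ w) (m * i + j) = V i j := by
  induction n with
  | zero => exact i.elim0
  | succ n ih =>
    rw [List.ofFn_succ, List.flatten_cons, List.append_assoc]
    refine Fin.cases ?_ (fun i => ?_) i
    · simpa using (onesAt_encodePreference (V 0) _).1 j
    · rw [Fin.val_succ, show m * (i + 1 : ℕ) + j = m + (m * i + j) by ring,
        (onesAt_encodePreference (V 0) _).2]
      exact ih (fun i => V i.succ) i

theorem describes_encodeElection_append (E : Election) (w : List Γ') :
    Describes (encodeElection E ++ w) E.tie E.votes := by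
  unfold encodeElection
  rw [List.append_assoc]
  refine ⟨fun j => ?_, fun i j => ?_⟩
  · rw [entryAt_eq, mul_zero, zero_add]
    exact (onesAt_encodePreference _ _).1 j
  · rw [entryAt_eq, show E.numCand * (i + 1 : ℕ) + j = E.numCand + (E.numCand * i + j) by ring,
      (onesAt_encodePreference _ _).2]
    exact onesAt_votes _ _ i j

theorem flatten_ofFn {n : ℕ} (f : Fin n → List Γ') (g : ℕ → List Γ') (h : ∀ i, f i = g i) :
    (List.ofFn f).flatten = (List.range n).flatMap g := by
  rw [List.flatMap_def]
  congr 1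
  exact List.ext_getElem (by simp) fun i _ _ => by simp [h]

/-- The encoding of the preference `b`, rebuilt from its entries. -/
noncomputable def prefStr (w : List Γ') (m b : ℕ) : List Γ' :=
  [Γ'.bra] ++ ((List.range m).flatMap (fun j => unary (entryAt w m b j)) ++ [Γ'.ket])

/-- The encoding of the election, rebuilt from its entries. -/
noncomputable def electionStr (w : List Γ') (m n : ℕ) : List Γ' :=
  prefStr w m 0 ++ (List.range n).flatMap fun i => prefStr w m (i + 1)

open Classical in
/-- The encoding of the coalition `mem`. -/
noncomputable def coalitionStr (n : ℕ) (mem : ℕ → Prop) : List Γ' :=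
  (List.range n).flatMap fun i => List.replicate (if mem i then 1 else 0) (Γ'.bit true) ++
    List.replicate (if mem i then 0 else 1) (Γ'.bit false)

theorem encodePreference_eq {m b : ℕ} {w : List Γ'} {p : Preference m}
    (h : ∀ j : Fin m, entryAt w m b j = p j) : encodePreference p = prefStr w m b := by
  unfold encodePreference prefStr
  rw [flatten_ofFn (fun j => encodeCandidate (p j)) (fun j => unary (entryAt w m b j)) fun j => by
    rw [h]; rfl]
  rfl

/-- This replaces parsing: the only possible encoding is computed from the entries, and a comparison
with the input decides whether the input has the right form. -/
theorem Describes.encodeElection_eq {E : Election} {w : List Γ'}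
    (h : Describes w E.tie E.votes) :
    encodeElection E = electionStr w E.numCand E.numVoters := by
  unfold encodeElection electionStr
  rw [flatten_ofFn (fun i => encodePreference (E.votes i))
      (fun i => prefStr w E.numCand (i + 1)) fun i => encodePreference_eq (h.2 i),
    encodePreference_eq h.1]

theorem encodeCoalition_eq {n : ℕ} {M : Finset (Fin n)} {mem : ℕ → Prop}
    (hM : ∀ i : Fin n, mem i ↔ i ∈ M) : encodeCoalition M = coalitionStr n mem := by
  have h : encodeCoalition M = (List.ofFn fun i : Fin n => [Γ'.bit (decide (i ∈ M))]).flatten := by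
    rw [show (fun i : Fin n => [Γ'.bit (decide (i ∈ M))]) =
      (fun a => [a]) ∘ fun i : Fin n => Γ'.bit (decide (i ∈ M)) from rfl, ← List.map_ofFn,
      ← List.flatMap_def, List.flatMap_singleton']
    rfl
  rw [h]
  refine flatten_ofFn _ _ fun i => ?_
  by_cases hi : i ∈ M <;> simp [hM, hi]

/-- The bit at position `i` after the first `o` symbols is set. -/
def BitAt (w : List Γ') (o i : ℕ) : Prop := w[o + i]? = some (Γ'.bit true)

theorem bitAt_iff {n : ℕ} (M : Finset (Fin n)) (u v : List Γ') (i : Fin n) :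
    BitAt (u ++ (encodeCoalition M ++ v)) u.length i ↔ i ∈ M := by
  unfold BitAt
  rw [List.getElem?_append_right (by omega), Nat.add_sub_cancel_left,
    List.getElem?_append_left (by simp [encodeCoalition])]
  simp [encodeCoalition]

/-- Every entry contributes at least its comma. This bounds the search for the number of candidates
by the length of the word. -/
theorem le_length_prefStr (w : List Γ') (m b : ℕ) : m ≤ (prefStr w m b).length := by
  have : ∑ _j ∈ Finset.range m, 1 ≤ ∑ j ∈ Finset.range m, (unary (entryAt w m b j)).length :=
    Finset.sum_le_sum fun j _ => by simp [unary]
  simp only [prefStr, List.length_append, length_flatMap_range]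
  simp at this ⊢
  omega

theorem le_length_electionStr (w : List Γ') (m n : ℕ) :
    m ≤ (electionStr w m n).length ∧ n ≤ (electionStr w m n).length := by
  have h : ∑ _i ∈ Finset.range n, 1 ≤ ∑ i ∈ Finset.range n, (prefStr w m (i + 1)).length :=
    Finset.sum_le_sum fun i _ => by simp [prefStr]
  have := le_length_prefStr w m 0
  simp only [electionStr, List.length_append, length_flatMap_range]
  simp only [Finset.sum_const, Finset.card_range, smul_eq_mul, mul_one] at h
  omega

/-- The numbers `f 0, …, f (m - 1)` form a preference over `m` candidates. -/
def IsRanking (m : ℕ) (f : ℕ → ℕ) : Prop :=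
  (∀ j < m, f j < m) ∧ ∀ j < m, ∀ i < j, f i ≠ f j

theorem isRanking_iff {m : ℕ} {f : ℕ → ℕ} :
    IsRanking m f ↔ ∃ p : Preference m, ∀ j : Fin m, f j = p j := by
  constructor
  · rintro ⟨h, h'⟩
    have hinj : Function.Injective fun j : Fin m => (⟨f j, h j j.2⟩ : Fin m) := by
      intro i j hij
      have hij' : f i = f j := congrArg Fin.val hij
      rcases lt_trichotomy i j with hlt | rfl | hlt
      · exact absurd hij' (h' j j.2 i hlt)
      · rfl
      · exact absurd hij'.symm (h' i i.2 j hlt)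
    exact ⟨Equiv.ofBijective _ (Finite.injective_iff_bijective.1 hinj), fun j => rfl⟩
  · rintro ⟨p, hp⟩
    refine ⟨fun j hj => ?_, fun j hj i hi hij => ?_⟩
    · rw [hp ⟨j, hj⟩]
      exact Fin.is_lt _
    · rw [hp ⟨j, hj⟩, hp ⟨i, hi.trans hj⟩, Fin.val_inj, p.injective.eq_iff] at hij
      exact hi.ne (congrArg Fin.val hij)

/-- The word contains at least `n + 1` preferences over `m` candidates. -/
def IsElection (w : List Γ') (m n : ℕ) : Prop :=
  0 < m ∧ 0 < n ∧ ∀ b < n + 1, IsRanking m (entryAt w m b)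

theorem Describes.isElection {E : Election} {w : List Γ'} (h : Describes w E.tie E.votes) :
    IsElection w E.numCand E.numVoters := by
  refine ⟨NeZero.pos _, NeZero.pos _, fun b hb => isRanking_iff.2 ?_⟩
  cases b with
  | zero => exact ⟨_, h.1⟩
  | succ i => exact ⟨_, h.2 ⟨i, by omega⟩⟩

/-- The word need not be an encoding for this; its form is checked separately against the rebuilt
string. -/
theorem IsElection.exists_describes {w : List Γ'} {m n : ℕ} (h : IsElection w m n) :
    ∃ E : Election, E.numCand = m ∧ E.numVoters = n ∧ Describes w E.tie E.votes := by
  obtain ⟨hm, hn, h⟩ := h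
  obtain ⟨t, ht⟩ := isRanking_iff.1 (h 0 (by omega))
  choose V hV using fun i : Fin n => isRanking_iff.1 (h (i + 1) (by omega))
  exact ⟨⟨m, n, ⟨hm.ne'⟩, ⟨hn.ne'⟩, t, V⟩, rfl, rfl, ht, hV⟩

end Decoding

/-! ### Definability of the rebuilt encodings -/

section Definability

variable {X : Type} [Ctx X] {m n b o : X → ℕ}

theorem DefStr.unary (hb : Def b) : DefStr fun c => unary (b c) :=
  (DefStr.replicate _ hb).append (.const _)

theorem DefStr.prefStr (hm : Def m) (hb : Def b) :
    DefStr fun c => prefStr (Ctx.inp c) (m c) (b c) :=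
  (DefStr.const _).append ((DefStr.flatMap hm
    (DefStr.unary (Def.entryAt (X := X × ℕ) hm.fst hb.fst .snd))).append (.const _))

theorem DefStr.electionStr (hm : Def m) (hn : Def n) :
    DefStr fun c => electionStr (Ctx.inp c) (m c) (n c) :=
  (DefStr.prefStr hm (.const 0)).append
    (DefStr.flatMap hn (DefStr.prefStr (X := X × ℕ) hm.fst (Def.snd.add .one)))

theorem DefStr.coalitionStr {mem : X → ℕ → Prop} (hn : Def n)
    (hmem : DefP fun c : X × ℕ => mem c.1 c.2) : DefStr fun c => coalitionStr (n c) (mem c) :=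
  DefStr.flatMap hn ((DefStr.replicate _ (Def.ite hmem .one (.const 0))).append
    (DefStr.replicate _ (Def.ite hmem (.const 0) .one)))

theorem DefP.bitAt (ho : Def o) : DefP fun c : X × ℕ => BitAt (Ctx.inp c.1) (o c.1) c.2 :=
  DefP.sym (X := X × ℕ) _ (ho.fst.add .snd)

theorem DefP.isElection (hm : Def m) (hn : Def n) :
    DefP fun c => IsElection (Ctx.inp c) (m c) (n c) :=
  (DefP.lt (.const 0) hm).and ((DefP.lt (.const 0) hn).and (DefP.all (hn.add .one)
    ((DefP.all hm.fst (DefP.lt (Def.entryAt (X := (X × ℕ) × ℕ) hm.fst.fst Def.snd.fst .snd)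
      hm.fst.fst)).and
    (DefP.all hm.fst (DefP.all .snd (DefP.ne
      (Def.entryAt (X := ((X × ℕ) × ℕ) × ℕ) hm.fst.fst.fst Def.snd.fst.fst .snd)
      (Def.entryAt (X := ((X × ℕ) × ℕ) × ℕ) hm.fst.fst.fst Def.snd.fst.fst Def.snd.fst)))))))

theorem DefP.exists_le (K : ℕ) {p : ℕ → X → Prop} (hp : ∀ k, DefP (p k)) :
    DefP fun c => ∃ k ≤ K, p k c := by
  induction K with
  | zero => exact (hp 0).congr fun c => by simp
  | succ K ih => exact (ih.or (hp (K + 1))).congr fun c => by simp [Nat.le_succ_iff, or_and_right, exists_or]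

end Definability

/-! ### The four decision problems -/

/-- Problems on encoded elections that have a definable description are in `P`. -/
theorem inP_of_describes {P : List Γ' → Election → Prop} {Q : List Γ' → ℕ → ℕ → Prop}
    (hQ : DefP fun c : (List Γ' × ℕ) × ℕ => Q c.1.1 c.1.2 c.2)
    (hP : ∀ w E, P w E → ∃ u, w = encodeElection E ++ u)
    (hPQ : ∀ w E, Describes w E.tie E.votes → (P w E ↔ Q w E.numCand E.numVoters))
    {L : Language Γ'} (hL : ∀ w, w ∈ L ↔ ∃ E, P w E) : InP L := by
  -- The numbers of candidates and voters are not written in the input. They are searched for up to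
  -- the length of the word, which suffices because an encoding is at least as long as either of
  -- them.
  have hdef : DefP fun w : List Γ' => ∃ m < w.length + 1, ∃ n < w.length + 1,
      IsElection w m n ∧ Q w m n :=
    DefP.ex (Def.length_inp.add .one) (DefP.ex (Def.length_inp.add .one).fst
      ((DefP.isElection (X := (List Γ' × ℕ) × ℕ) Def.snd.fst .snd).and hQ))
  refine DefP.inP (hdef.congr fun w => (hL w).trans ⟨?_, ?_⟩)
  · rintro ⟨E, hE⟩
    obtain ⟨u, hu⟩ := hP w E hE
    have hd : Describes w E.tie E.votes := hu ▸ describes_encodeElection_append E u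
    have hlen := le_length_electionStr w E.numCand E.numVoters
    have hw := congrArg List.length hu
    rw [hd.encodeElection_eq, List.length_append] at hw
    exact ⟨_, by omega, _, by omega, hd.isElection, (hPQ w E hd).1 hE⟩
  · rintro ⟨m, -, n, -, hE, hq⟩
    obtain ⟨E, rfl, rfl, hd⟩ := hE.exists_describes
    exact ⟨E, (hPQ w E hd).2 hq⟩

/-- The quantifier over exponentially many sets `M` is vacuous: the bits after the election
determine `M`, so it can be replaced by the predicate reading these bits. -/
theorem Describes.coalition_iff {E : Election} {w : List Γ'} (h : Describes w E.tie E.votes)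
    (v : List Γ') (p : Finset (Fin E.numVoters) → Prop) (q : (ℕ → Prop) → Prop)
    (hpq : ∀ M mem, (∀ i : Fin E.numVoters, mem i ↔ i ∈ M) → (p M ↔ q mem)) :
    (∃ M, w = encodeElection E ++ (encodeCoalition M ++ v) ∧ p M) ↔
      w = electionStr w E.numCand E.numVoters ++ (coalitionStr E.numVoters
        (BitAt w (electionStr w E.numCand E.numVoters).length) ++ v) ∧
      q (BitAt w (electionStr w E.numCand E.numVoters).length) := by
  classical
  rw [h.encodeElection_eq]
  set o := (electionStr w E.numCand E.numVoters).length with ho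
  constructor
  · rintro ⟨M, hw, hM⟩
    have hbit : ∀ i : Fin E.numVoters, BitAt w o i ↔ i ∈ M := fun i => by
      rw [ho, ← bitAt_iff M (electionStr w E.numCand E.numVoters) v i, ← hw]
    rw [← encodeCoalition_eq hbit]
    exact ⟨hw, (hpq M _ hbit).1 hM⟩
  · rintro ⟨hw, hq⟩
    have hbit : ∀ i : Fin E.numVoters, BitAt w o i ↔
        i ∈ Finset.univ.filter fun i : Fin E.numVoters => BitAt w o i := by simp
    exact ⟨_, by rwa [encodeCoalition_eq hbit], (hpq _ _ hbit).2 hq⟩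

theorem defStr_electionStr : DefStr fun c : (List Γ' × ℕ) × ℕ => electionStr c.1.1 c.1.2 c.2 :=
  DefStr.electionStr (X := (List Γ' × ℕ) × ℕ) Def.snd.fst .snd

/-- The coalition that follows the encoding of an election is definable. -/
theorem defP_bitAt_electionStr : DefP fun c : ((List Γ' × ℕ) × ℕ) × ℕ =>
    BitAt c.1.1.1 (electionStr c.1.1.1 c.1.1.2 c.1.2).length c.2 :=
  DefP.bitAt (X := (List Γ' × ℕ) × ℕ) defStr_electionStr.1

theorem defStr_coalitionStr : DefStr fun c : (List Γ' × ℕ) × ℕ =>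
    coalitionStr c.2 (BitAt c.1.1 (electionStr c.1.1 c.1.2 c.2).length) :=
  DefStr.coalitionStr (mem := fun c : (List Γ' × ℕ) × ℕ =>
    BitAt c.1.1 (electionStr c.1.1 c.1.2 c.2).length) .snd defP_bitAt_electionStr

theorem defP_coalitionAt : DefP fun c : ((List Γ' × ℕ) × ℕ) × ℕ => CoalitionAt c.1.1.1 c.1.1.2 c.1.2
    c.2 (BitAt c.1.1.1 (electionStr c.1.1.1 c.1.1.2 c.1.2).length) :=
  DefP.coalitionAt (X := ((List Γ' × ℕ) × ℕ) × ℕ) Def.snd.fst.fst Def.snd.fst .snd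
    (DefP.under (p := fun (c : (List Γ' × ℕ) × ℕ) i =>
      BitAt c.1.1 (electionStr c.1.1 c.1.2 c.2).length i) defP_bitAt_electionStr)

theorem inP_CPMW : InP (CPMW bucklin) := by
  -- The candidate `y` is quantified before `M`, so that the part of the word behind the coalition
  -- is fixed when `Describes.coalition_iff` is applied.
  refine inP_of_describes (P := fun w E => ∃ y : Fin E.numCand, ∃ M : Finset (Fin E.numVoters),
      w = encodeElection E ++ (encodeCoalition M ++ ([Γ'.comma] ++ unary y)) ∧
      IsPossibleCoalitionAgainst (E.rule bucklin) E.votes M y)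
    (Q := fun w m n => ∃ y < m, w = electionStr w m n ++
      (coalitionStr n (BitAt w (electionStr w m n).length) ++ ([Γ'.comma] ++ unary y)) ∧
      CoalitionAt w m n y (BitAt w (electionStr w m n).length)) ?_ ?_ ?_ ?_
  · exact DefP.ex Def.snd.fst ((DefP.str_eq (DefStr.inp (X := ((List Γ' × ℕ) × ℕ) × ℕ))
      ((defStr_electionStr.comp .fst).append ((defStr_coalitionStr.comp .fst).append
        ((DefStr.const _).append (DefStr.unary .snd))))).and defP_coalitionAt)
  · rintro w E ⟨y, M, hw, -⟩
    exact ⟨_, hw⟩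
  · intro w E hd
    rw [exists_lt_iff]
    refine exists_congr fun y => hd.coalition_iff _ _ (fun mem => CoalitionAt w _ _ y mem)
      fun M mem hM => (hd.coalitionAt_iff (NeZero.pos _) hM y).symm
  · intro w
    constructor
    · rintro ⟨E, M, y, hw, h⟩
      exact ⟨E, y, M, by rw [hw]; simp only [List.append_assoc]; rfl, h⟩
    · rintro ⟨E, y, M, hw, h⟩
      exact ⟨E, M, y, by rw [hw]; simp only [List.append_assoc]; rfl, h⟩

theorem inP_CPM : InP (CPM bucklin) := by
  refine inP_of_describes (P := fun w E => ∃ M : Finset (Fin E.numVoters),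
      w = encodeElection E ++ (encodeCoalition M ++ []) ∧
      IsPossibleCoalition (E.rule bucklin) E.votes M)
    (Q := fun w m n => w = electionStr w m n ++
      (coalitionStr n (BitAt w (electionStr w m n).length) ++ []) ∧
      ∃ y < m, CoalitionAt w m n y (BitAt w (electionStr w m n).length)) ?_ ?_ ?_ ?_
  · exact (DefP.str_eq (DefStr.inp (X := (List Γ' × ℕ) × ℕ))
      (defStr_electionStr.append (defStr_coalitionStr.append (.const _)))).and
      (DefP.ex Def.snd.fst defP_coalitionAt)
  · rintro w E ⟨M, hw, -⟩
    exact ⟨_, hw⟩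
  · intro w E hd
    refine hd.coalition_iff _ _ (fun mem => ∃ y < E.numCand, CoalitionAt w _ _ y mem)
      fun M mem hM => ?_
    rw [exists_lt_iff]
    exact exists_congr fun y => (hd.coalitionAt_iff (NeZero.pos _) hM y).symm
  · intro w
    simp only [List.append_nil]
    rfl

/-- Extending the empty coalition. -/
theorem Describes.extensionAt_empty_iff {E : Election} {w : List Γ'}
    (h : Describes w E.tie E.votes) (y : Fin E.numCand) (k : ℕ) :
    ExtensionAt w E.numCand E.numVoters y k (fun _ => False) ↔
      ∃ M : Finset (Fin E.numVoters), M.card ≤ k ∧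
        IsPossibleCoalitionAgainst (E.rule bucklin) E.votes M y := by
  rw [h.extensionAt_iff (NeZero.pos _) y k (M := ∅) (by simp)]
  simp only [Finset.empty_union]
  rfl

theorem inP_CPMSW (K : ℕ) : InP (CPMSW bucklin K) := by
  refine inP_of_describes (P := fun w E => ∃ (y : Fin E.numCand) (k : ℕ), k ≤ K ∧
      w = encodeElection E ++ encodeCandidate y ++ encodeNumber k ∧
      ∃ M : Finset (Fin E.numVoters), M.card ≤ k ∧
        IsPossibleCoalitionAgainst (E.rule bucklin) E.votes M y)
    (Q := fun w m n => ∃ y < m, ∃ k ≤ K, w = electionStr w m n ++ unary y ++ encodeNumber k ∧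
      ExtensionAt w m n y k fun _ => False) ?_ ?_ ?_ fun _ => Iff.rfl
  · exact DefP.ex Def.snd.fst (DefP.exists_le K fun k =>
      (DefP.str_eq (DefStr.inp (X := ((List Γ' × ℕ) × ℕ) × ℕ))
        (((defStr_electionStr.comp .fst).append (.unary .snd)).append (.const _))).and
      (DefP.extensionAt k (X := ((List Γ' × ℕ) × ℕ) × ℕ) Def.snd.fst.fst Def.snd.fst .snd .false))
  · rintro w E ⟨y, k, -, hw, -⟩
    exact ⟨_, hw.trans (List.append_assoc _ _ _)⟩
  · intro w E hd
    rw [exists_lt_iff]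
    simp only [hd.extensionAt_empty_iff, ← hd.encodeElection_eq]
    rfl

theorem inP_CPMS (K : ℕ) : InP (CPMS bucklin K) := by
  refine inP_of_describes (P := fun w E => ∃ k ≤ K, w = encodeElection E ++ encodeNumber k ∧
      ∃ M : Finset (Fin E.numVoters), M.card ≤ k ∧
        IsPossibleCoalition (E.rule bucklin) E.votes M)
    (Q := fun w m n => ∃ k ≤ K, w = electionStr w m n ++ encodeNumber k ∧
      ∃ y < m, ExtensionAt w m n y k fun _ => False) ?_ ?_ ?_ fun _ => Iff.rfl
  · exact DefP.exists_le K fun k =>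
      (DefP.str_eq (DefStr.inp (X := (List Γ' × ℕ) × ℕ)) (defStr_electionStr.append (.const _))).and
      (DefP.ex Def.snd.fst (DefP.extensionAt k (X := ((List Γ' × ℕ) × ℕ) × ℕ) Def.snd.fst.fst
        Def.snd.fst .snd .false))
  · rintro w E ⟨k, -, hw, -⟩
    exact ⟨_, hw⟩
  · intro w E hd
    refine exists_congr fun k => and_congr_right fun _ => ?_
    rw [exists_lt_iff, ← hd.encodeElection_eq]
    refine and_congr_right fun _ => ?_
    simp only [hd.extensionAt_empty_iff, IsPossibleCoalition]
    constructor
    · rintro ⟨M, hM, y, h⟩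
      exact ⟨y, M, hM, h⟩
    · rintro ⟨y, M, hM, h⟩
      exact ⟨M, hM, y, h⟩

end PossibleManipulators

theorem mainTheorem6 :
    PossibleManipulators.InP (PossibleManipulators.CPMW PossibleManipulators.bucklin) ∧
    PossibleManipulators.InP (PossibleManipulators.CPM PossibleManipulators.bucklin) ∧
    ∀ K : ℕ,
      PossibleManipulators.InP (PossibleManipulators.CPMSW PossibleManipulators.bucklin K) ∧
      PossibleManipulators.InP (PossibleManipulators.CPMS PossibleManipulators.bucklin K) :=
  ⟨PossibleManipulators.inP_CPMW, PossibleManipulators.inP_CPM, fun K =>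
    ⟨PossibleManipulators.inP_CPMSW K, PossibleManipulators.inP_CPMS K⟩⟩
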